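/- Let $k$ be a field, $p$ a prime number with $\operatorname{char}(k)\neq p$, $n\ge 0$ an integer, and $K/k$ a cyclic extension of degree $p^n$ with a fixed isomorphism $\chi:\mathrm{Gal}(K/k)\to\mathbf Z/p^n\mathbf Z$. Let $(K_i)_{i\in I}$ be a finite family of finite separable field extensions of $k$, and put $L=K\times\prod_{i\in I}K_i$. Let $E$ be a Galois extension of $k$ containing $K$ and all the $K_i$, and let $G=\mathrm{Gal}(E/k)$. For $0\le m\le n$ let $K(m)$ be the subfield of $K$ of degree $p^m$ over $k$, let $E_i(m)=K(m)K_i\subseteq E$, and let $p^{e_i(m)}=[E_i(m):K_i]$. For $1\le m\le n$ let $\Gamma_i^m$ be the set of conjugacy classes of elements $g\in G$ such that $\langle g\rangle$ contains an element fixing $E_i(n-m)$ but not $E_i(n-m+1)$ pointwise. If $\Gamma_i^m\ne\varnothing$ then $e_i(n)-e_i(n-m)=m$. Let $C(L)$ be the group of all $c\in\prod_{i\in I}\mathbf Z/p^{e_i(n)}\mathbf Z$ such that, for all $1\le m\le n$ and all $i,j\in I$ with $\Gamma_i^m\cap\Gamma_j^m\neq\varnothing$, the images of $c(i)$ in $\mathbf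 Z/p^{e_i(n)-e_i(n-m)}\mathbf Z$ and of $c(j)$ in $\mathbf Z/p^{e_j(n)-e_j(n-m)}\mathbf Z$ coincide (both groups are then $\mathbf Z/p^m\mathbf Z$). Let $a\in k^\times$, let $X_a$ be the affine $k$-variety defined by $N_{L/k}(t)=a$, and let $F=k(X_a)$ be its function field. Let $y_i\in K_i\otimes_k F$ be the $K_i$-component of the generic point $t\in L\otimes_k F$, and let $N_i=N_{K_i\otimes_k F/F}(y_i)\in F^\times$. Let $(N_i,\tilde\chi)\in\mathrm{Br}(F)$ be the class of the cyclic algebra over $F$ associated with $N_i$ and the character $\tilde\chi$ of the absolute Galois group of $F$ induced by $\chi$. Then $$u:C(L)\to\mathrm{Br}(F),\qquad u(c)=\sum_{i\in I}c(i)\,(N_i,\tilde\chi),$$ is a well-defined group homomorphism (each term may be computed with any integer representing $c(i)$), and its image is a subgroup consisting of unramified classes: for every $c\in C(L)$ and every discrete valuation ring $R$ with field of fractions $F$ and with $k\subseteq R$, the class $u(c)$ is unramified at $R$, that is, it lies in the image of $\mathrm{Br}(R)\to\mathrm{Br}(F)$. -/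

import Mathlib

open scoped TensorProduct

universe u

namespace BrauerNorm

set_option linter.unusedSectionVars false

theorem isSimpleRing_of_one_mem {A : Type*} [Ring A] [Nontrivial A]
    (h : ∀ I : TwoSidedIdeal A, ∀ x ∈ I, x ≠ 0 → (1 : A) ∈ I) : IsSimpleRing A := by
  refine ⟨{ eq_bot_or_eq_top := fun I => ?_ }⟩
  by_cases hI : ∃ x ∈ I, x ≠ 0
  · obtain ⟨x, hx, hx0⟩ := hI
    exact Or.inr (I.one_mem_iff.mp (h I x hx hx0))
  · push Not at hI
    refine Or.inl (le_antisymm (fun x hx => ?_) bot_le)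
    simpa [TwoSidedIdeal.mem_bot] using hI x hx

section TensorProduct

variable (F : Type*) [Field F] (A B : Type*) [Ring A] [Algebra F A] [Ring B] [Algebra F B]

open TensorProduct in
theorem coord_mul_left {ι : Type*} [DecidableEq ι] (b : Module.Basis ι F B) (x : A ⊗[F] B)
    (a : A) (i : ι) :
    equivFinsuppOfBasisRight b ((a ⊗ₜ 1) * x) i = a * equivFinsuppOfBasisRight b x i := by
  induction x with
  | zero => simp
  | tmul c d => simp
  | add x y hx hy => simp only [mul_add, map_add, Finsupp.add_apply, hx, hy]

open TensorProduct in
theorem coord_mul_right {ι : Type*} [DecidableEq ι] (b : Module.Basis ι F B) (x : A ⊗[F] B)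
    (a : A) (i : ι) :
    equivFinsuppOfBasisRight b (x * (a ⊗ₜ 1)) i = equivFinsuppOfBasisRight b x i * a := by
  induction x with
  | zero => simp
  | tmul c d => simp
  | add x y hx hy => simp only [add_mul, map_add, Finsupp.add_apply, hx, hy]

open TensorProduct in
theorem exists_eq_one_tmul [Algebra.IsCentral F A] (x : A ⊗[F] B)
    (hx : ∀ a : A, (a ⊗ₜ 1) * x = x * (a ⊗ₜ 1)) : ∃ y : B, x = 1 ⊗ₜ y := by
  classical
  let b := Module.Free.chooseBasis F B
  have hc : ∀ i, ∃ f : F, equivFinsuppOfBasisRight b x i = algebraMap F A f := fun i => by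
    refine (Algebra.IsCentral.mem_center_iff F).mp (Subalgebra.mem_center_iff.mpr fun a => ?_)
    rw [← coord_mul_left, ← coord_mul_right, hx]
  choose f hf using hc
  refine ⟨(equivFinsuppOfBasisRight b x).sum fun i _ => f i • b i, ?_⟩
  conv_lhs => rw [← (equivFinsuppOfBasisRight b).symm_apply_apply x]
  rw [equivFinsuppOfBasisRight_symm_apply, Finsupp.sum, Finsupp.sum, tmul_sum]
  refine Finset.sum_congr rfl fun i _ => ?_
  rw [hf, Algebra.algebraMap_eq_smul_one, smul_tmul]

instance tensor_isCentral [Algebra.IsCentral F A] [Algebra.IsCentral F B] :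
    Algebra.IsCentral F (A ⊗[F] B) := by
  refine ⟨fun x hx => ?_⟩
  rcases subsingleton_or_nontrivial A with hA | hA
  · rw [← mul_one x, Algebra.TensorProduct.one_def, Subsingleton.elim (1 : A) 0,
      TensorProduct.zero_tmul, mul_zero]
    exact zero_mem _
  rw [Subalgebra.mem_center_iff] at hx
  obtain ⟨y, rfl⟩ := exists_eq_one_tmul F A B x fun a => hx _
  have hy : y ∈ Subalgebra.center F B := Subalgebra.mem_center_iff.mpr fun c => by
    have h := hx (1 ⊗ₜ c)
    simp only [Algebra.TensorProduct.tmul_mul_tmul, one_mul] at h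
    exact Algebra.TensorProduct.includeRight_injective (FaithfulSMul.algebraMap_injective F A) h
  obtain ⟨f, rfl⟩ := (Algebra.IsCentral.mem_center_iff F).mp hy
  refine Algebra.mem_bot.mpr ⟨f, ?_⟩
  rw [Algebra.TensorProduct.algebraMap_apply, Algebra.algebraMap_eq_smul_one,
    Algebra.algebraMap_eq_smul_one, TensorProduct.smul_tmul]

open TensorProduct in
instance tensor_isSimpleRing [Algebra.IsCentral F A] [IsSimpleRing A] [IsSimpleRing B] :
    IsSimpleRing (A ⊗[F] B) := by
  classical
  refine isSimpleRing_of_one_mem fun I x₀ hx₀ hx₀0 => ?_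
  let b := Module.Free.chooseBasis F B
  let e := equivFinsuppOfBasisRight (M := A) b
  obtain ⟨x, ⟨hxI, hx0⟩, hmin⟩ := WellFounded.has_min
    (measure fun x : A ⊗[F] B => (e x).support.card).wf {x | x ∈ I ∧ x ≠ 0} ⟨x₀, hx₀, hx₀0⟩
  have hmin' : ∀ y ∈ I, (e y).support.card < (e x).support.card → y = 0 := fun y hy h => by
    by_contra h0
    exact hmin y ⟨hy, h0⟩ h
  obtain ⟨j, hj⟩ : ∃ j, e x j ≠ 0 := by
    by_contra! h
    exact hx0 (e.map_eq_zero_iff.mp (Finsupp.ext h))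
  let T : TwoSidedIdeal A := TwoSidedIdeal.mk'
    {c | ∃ y ∈ I, (∀ i, e x i = 0 → e y i = 0) ∧ e y j = c}
    ⟨0, zero_mem I, by simp, by simp⟩
    (by
      rintro _ _ ⟨y, hy, hy1, rfl⟩ ⟨z, hz, hz1, rfl⟩
      exact ⟨y + z, add_mem hy hz, fun i hi => by simp [hy1 i hi, hz1 i hi], by simp⟩)
    (by
      rintro _ ⟨y, hy, hy1, rfl⟩
      exact ⟨-y, neg_mem hy, fun i hi => by simp [hy1 i hi], by simp⟩)
    (by
      rintro a _ ⟨y, hy, hy1, rfl⟩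
      refine ⟨(a ⊗ₜ 1) * y, I.mul_mem_left _ _ hy, fun i hi => ?_, coord_mul_left F A B b y a j⟩
      rw [coord_mul_left F A B b y a i]
      exact (congrArg (a * ·) (hy1 i hi)).trans (mul_zero a))
    (by
      rintro _ a ⟨y, hy, hy1, rfl⟩
      refine ⟨y * (a ⊗ₜ 1), I.mul_mem_right _ _ hy, fun i hi => ?_, coord_mul_right F A B b y a j⟩
      rw [coord_mul_right F A B b y a i]
      exact (congrArg (· * a) (hy1 i hi)).trans (zero_mul a))
  have h1 : (1 : A) ∈ T := IsSimpleRing.one_mem_of_ne_zero_mem T hj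
    ((TwoSidedIdeal.mem_mk' _ _ _ _ _ _ _).mpr ⟨x, hxI, fun i hi => hi, rfl⟩)
  obtain ⟨y, hyI, hy1, hyj⟩ := (TwoSidedIdeal.mem_mk' _ _ _ _ _ _ _).mp h1
  have hcomm : ∀ a : A, (a ⊗ₜ 1) * y = y * (a ⊗ₜ 1) := fun a => by
    refine sub_eq_zero.mp (hmin' _ (sub_mem (I.mul_mem_left _ _ hyI) (I.mul_mem_right _ _ hyI)) ?_)
    have hco : ∀ i, e ((a ⊗ₜ 1) * y - y * (a ⊗ₜ 1)) i = a * e y i - e y i * a := fun i => by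
      rw [map_sub, Finsupp.sub_apply]
      exact congrArg₂ _ (coord_mul_left F A B b y a i) (coord_mul_right F A B b y a i)
    refine Finset.card_lt_card ⟨fun i hi => ?_, fun h => ?_⟩
    · rw [Finsupp.mem_support_iff] at hi ⊢
      intro h0
      exact hi (by rw [hco, hy1 i h0]; simp)
    · have := Finsupp.mem_support_iff.mp (h (Finsupp.mem_support_iff.mpr hj))
      exact this (by rw [hco, hyj]; simp)
  obtain ⟨c, rfl⟩ := exists_eq_one_tmul F A B y hcomm
  have hc0 : c ≠ 0 := by
    rintro rfl
    rw [tmul_zero, map_zero] at hyj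
    exact zero_ne_one hyj
  have h1B := IsSimpleRing.one_mem_of_ne_zero_mem
    (I.comap (Algebra.TensorProduct.includeRight : B →ₐ[F] A ⊗[F] B)) hc0
    (TwoSidedIdeal.mem_comap _ |>.mpr hyI)
  simpa [Algebra.TensorProduct.one_def] using (TwoSidedIdeal.mem_comap _).mp h1B

end TensorProduct

section Group

variable {F : Type u} [Field F]

/-- The class in the Brauer group of a central simple algebra. -/
def brauerClass (F A : Type u) [Field F] [Ring A] [Algebra F A] [Algebra.IsCentral F A]
    [IsSimpleRing A] [FiniteDimensional F A] : BrauerGroup.{u, u} F :=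
  Quotient.mk (Brauer.CSA_Setoid F) ⟨.of F A⟩

theorem brauerClass_eq {A B : Type u} [Ring A] [Algebra F A] [Algebra.IsCentral F A]
    [IsSimpleRing A] [FiniteDimensional F A] [Ring B] [Algebra F B] [Algebra.IsCentral F B]
    [IsSimpleRing B] [FiniteDimensional F B] {n m : ℕ} (hn : n ≠ 0) (hm : m ≠ 0)
    (e : Matrix (Fin n) (Fin n) A ≃ₐ[F] Matrix (Fin m) (Fin m) B) :
    brauerClass F A = brauerClass F B :=
  Quotient.sound (s := Brauer.CSA_Setoid F) ⟨n, m, hn, hm, ⟨e⟩⟩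

theorem brauerClass_eq_of_algEquiv {A B : Type u} [Ring A] [Algebra F A] [Algebra.IsCentral F A]
    [IsSimpleRing A] [FiniteDimensional F A] [Ring B] [Algebra F B] [Algebra.IsCentral F B]
    [IsSimpleRing B] [FiniteDimensional F B] (e : A ≃ₐ[F] B) :
    brauerClass F A = brauerClass F B :=
  brauerClass_eq one_ne_zero one_ne_zero e.mapMatrix

theorem isBrauerEquivalent_tensor {A A' B B' : CSA.{u, u} F} (hA : IsBrauerEquivalent A A')
    (hB : IsBrauerEquivalent B B') :
    IsBrauerEquivalent (⟨.of F (A ⊗[F] B)⟩ : CSA.{u, u} F) ⟨.of F (A' ⊗[F] B')⟩ := by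
  obtain ⟨n, n', hn, hn', ⟨e⟩⟩ := hA
  obtain ⟨m, m', hm, hm', ⟨f⟩⟩ := hB
  refine ⟨n * m, n' * m', mul_ne_zero hn hm, mul_ne_zero hn' hm', ⟨?_⟩⟩
  exact (Matrix.reindexAlgEquiv F (A ⊗[F] B) finProdFinEquiv).symm.trans <|
    (Matrix.kroneckerTMulAlgEquiv (Fin n) (Fin m) F F A B).symm.trans <|
    (Algebra.TensorProduct.congr e f).trans <|
    (Matrix.kroneckerTMulAlgEquiv (Fin n') (Fin m') F F A' B').trans <|
    Matrix.reindexAlgEquiv F (A' ⊗[F] B') finProdFinEquiv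

theorem isBrauerEquivalent_op {A A' : CSA.{u, u} F} (hA : IsBrauerEquivalent A A') :
    IsBrauerEquivalent (⟨.of F Aᵐᵒᵖ⟩ : CSA.{u, u} F) ⟨.of F A'ᵐᵒᵖ⟩ := by
  obtain ⟨n, n', hn, hn', ⟨e⟩⟩ := hA
  exact ⟨n, n', hn, hn', ⟨AlgEquiv.mopMatrix.trans <| (AlgEquiv.op e).trans AlgEquiv.mopMatrix.symm⟩⟩

/-- `A ⊗ Aᵒᵖ` is a matrix algebra. -/
theorem brauerClass_tensor_op (A : Type u) [Ring A] [Algebra F A] [Algebra.IsCentral F A]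
    [IsSimpleRing A] [FiniteDimensional F A] :
    brauerClass F (A ⊗[F] Aᵐᵒᵖ) = brauerClass F F := by
  have hinj : Function.Injective (AlgHom.mulLeftRight F A) :=
    RingHom.injective (AlgHom.mulLeftRight F A).toRingHom
  have hbij : Function.Bijective (AlgHom.mulLeftRight F A) := by
    refine ⟨hinj, (LinearMap.injective_iff_surjective_of_finrank_eq_finrank
      (f := (AlgHom.mulLeftRight F A).toLinearMap) ?_).mp hinj⟩
    rw [Module.finrank_tensorProduct, Module.finrank_linearMap,
      LinearEquiv.finrank_eq (MulOpposite.opLinearEquiv F (M := A))]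
  refine brauerClass_eq (n := 1) (m := Module.finrank F A) one_ne_zero
    Module.finrank_pos.ne' ?_
  exact ((AlgEquiv.ofBijective _ hbij).trans (algEquivMatrix (Module.finBasis F A))).mapMatrix.trans
    <| (Matrix.compAlgEquiv (Fin 1) (Fin (Module.finrank F A)) F F).trans <|
    Matrix.reindexAlgEquiv F F (finProdFinEquiv.trans (finCongr (one_mul _)))

/-- The sum of two Brauer classes is the class of the tensor product. -/
instance instAddBrauerGroup : Add (BrauerGroup.{u, u} F) :=
  ⟨Quotient.map₂ (fun A B => ⟨.of F (A ⊗[F] B)⟩)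
    fun _ _ hA _ _ hB => isBrauerEquivalent_tensor hA hB⟩

/-- The zero of the Brauer group is the class of the base field. -/
instance instZeroBrauerGroup : Zero (BrauerGroup.{u, u} F) := ⟨brauerClass F F⟩

/-- The negative of a Brauer class is the class of the opposite algebra. -/
instance instNegBrauerGroup : Neg (BrauerGroup.{u, u} F) :=
  ⟨Quotient.map (fun A => ⟨.of F Aᵐᵒᵖ⟩) fun _ _ hA => isBrauerEquivalent_op hA⟩

/-- The Brauer group of a field is an abelian group, written additively. -/
instance instAddCommGroupBrauerGroup : AddCommGroup (BrauerGroup.{u, u} F) where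
  add_assoc := by
    rintro ⟨A⟩ ⟨B⟩ ⟨C⟩
    exact brauerClass_eq_of_algEquiv (Algebra.TensorProduct.assoc F F F A B C)
  zero_add := by
    rintro ⟨A⟩
    exact brauerClass_eq_of_algEquiv (Algebra.TensorProduct.lid F A)
  add_zero := by
    rintro ⟨A⟩
    exact brauerClass_eq_of_algEquiv (Algebra.TensorProduct.rid F F A)
  add_comm := by
    rintro ⟨A⟩ ⟨B⟩
    exact brauerClass_eq_of_algEquiv (Algebra.TensorProduct.comm F A B)
  neg_add_cancel := by
    rintro ⟨A⟩
    exact (brauerClass_eq_of_algEquiv (Algebra.TensorProduct.comm F Aᵐᵒᵖ A)).trans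
      (brauerClass_tensor_op A)
  nsmul := nsmulRec
  zsmul := zsmulRec

end Group
section Cyclic

open TensorProduct

variable {k K : Type u} (F : Type u) [Field k] [Field K] [Field F] [Algebra k K] [Algebra k F]

/-- The action of `Gal(K/k)` on `F ⊗ K` through the second factor. -/
noncomputable def galAct (g : Gal(K/k)) : (F ⊗[k] K) →ₐ[F] (F ⊗[k] K) :=
  Algebra.TensorProduct.map (AlgHom.id F F) (g : K →ₐ[k] K)

@[simp] theorem galAct_tmul (g : Gal(K/k)) (f : F) (x : K) :
    galAct F g (f ⊗ₜ[k] x) = f ⊗ₜ[k] g x := by simp [galAct]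

theorem galAct_mul (g h : Gal(K/k)) (s : F ⊗[k] K) :
    galAct F (g * h) s = galAct F g (galAct F h s) := by
  induction s with
  | zero => simp
  | tmul f x => simp
  | add x y hx hy => simp only [map_add, hx, hy]

theorem galAct_one (s : F ⊗[k] K) : galAct F (1 : Gal(K/k)) s = s := by
  induction s with
  | zero => simp
  | tmul f x => simp
  | add x y hx hy => simp only [map_add, hx, hy]

theorem coord_galAct {ι : Type*} [DecidableEq ι] (b : Module.Basis ι k F) (g : Gal(K/k))
    (s : F ⊗[k] K) (i : ι) :
    equivFinsuppOfBasisLeft b (galAct F g s) i = g (equivFinsuppOfBasisLeft b s i) := by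
  induction s with
  | zero => simp
  | tmul f x => simp
  | add x y hx hy => simp only [map_add, Finsupp.add_apply, hx, hy]

theorem coord_one_tmul_mul {ι : Type*} [DecidableEq ι] (b : Module.Basis ι k F) (x : K)
    (s : F ⊗[k] K) (i : ι) :
    equivFinsuppOfBasisLeft b ((1 ⊗ₜ x) * s) i = x * equivFinsuppOfBasisLeft b s i := by
  induction s with
  | zero => simp
  | tmul f y => simp
  | add y z hy hz => simp only [mul_add, map_add, Finsupp.add_apply, hy, hz]

theorem exists_of_galAct_eq [FiniteDimensional k K] [IsGalois k K] (s : F ⊗[k] K)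
    (hs : ∀ g : Gal(K/k), galAct F g s = s) : ∃ f : F, s = f ⊗ₜ 1 := by
  classical
  let b := Module.Free.chooseBasis k F
  have hc : ∀ i, ∃ c : k, algebraMap k K c = equivFinsuppOfBasisLeft b s i := fun i =>
    (IsGalois.mem_range_algebraMap_iff_fixed _).mpr fun g => by rw [← coord_galAct, hs]
  choose c hc using hc
  refine ⟨(equivFinsuppOfBasisLeft b s).sum fun i _ => c i • b i, ?_⟩
  conv_lhs => rw [← (equivFinsuppOfBasisLeft b).symm_apply_apply s]
  rw [equivFinsuppOfBasisLeft_symm_apply, Finsupp.sum, Finsupp.sum, sum_tmul]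
  refine Finset.sum_congr rfl fun i _ => ?_
  rw [← hc, Algebra.algebraMap_eq_smul_one, ← smul_tmul]

/-- `F ⊗ K` has no proper nonzero ideal stable under `Gal(K/k)`. -/
theorem one_mem_of_galAct_stable [FiniteDimensional k K] [IsGalois k K] (J : Ideal (F ⊗[k] K))
    (hJ : ∀ (g : Gal(K/k)), ∀ s ∈ J, galAct F g s ∈ J) {s₀ : F ⊗[k] K} (hs₀ : s₀ ∈ J)
    (hs₀0 : s₀ ≠ 0) : (1 : F ⊗[k] K) ∈ J := by
  classical
  let b := Module.Free.chooseBasis k F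
  let e := equivFinsuppOfBasisLeft (N := K) b
  obtain ⟨x, ⟨hxI, hx0⟩, hmin⟩ := WellFounded.has_min
    (measure fun x : F ⊗[k] K => (e x).support.card).wf {x | x ∈ J ∧ x ≠ 0} ⟨s₀, hs₀, hs₀0⟩
  have hmin' : ∀ y ∈ J, (e y).support.card < (e x).support.card → y = 0 := fun y hy h => by
    by_contra h0
    exact hmin y ⟨hy, h0⟩ h
  obtain ⟨j, hj⟩ : ∃ j, e x j ≠ 0 := by
    by_contra! h
    exact hx0 (e.map_eq_zero_iff.mp (Finsupp.ext h))
  set y := ((1 : F) ⊗ₜ[k] (e x j)⁻¹) * x with hy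
  have hyJ : y ∈ J := J.mul_mem_left _ hxI
  have hyc : ∀ i, e y i = (e x j)⁻¹ * e x i := fun i => coord_one_tmul_mul F b _ _ _
  obtain ⟨f, hf⟩ := exists_of_galAct_eq F y fun g => by
    refine sub_eq_zero.mp (hmin' _ (sub_mem (hJ g y hyJ) hyJ) ?_)
    have hco : ∀ i, e (galAct F g y - y) i = g (e y i) - e y i := fun i => by
      rw [map_sub, Finsupp.sub_apply]
      exact congrArg (· - _) (coord_galAct F b g y i)
    refine Finset.card_lt_card ⟨fun i hi => ?_, fun h => ?_⟩
    · rw [Finsupp.mem_support_iff] at hi ⊢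
      intro h0
      exact hi (by rw [hco, hyc, h0]; simp)
    · have := Finsupp.mem_support_iff.mp (h (Finsupp.mem_support_iff.mpr hj))
      exact this (by rw [hco, hyc, inv_mul_cancel₀ hj]; simp)
  have hf0 : f ≠ 0 := by
    rintro rfl
    have := hyc j
    rw [hf, inv_mul_cancel₀ hj, zero_tmul, map_zero] at this
    exact zero_ne_one this
  have := J.mul_mem_left (f⁻¹ ⊗ₜ 1) (hf ▸ hyJ)
  simpa [hf0, Algebra.TensorProduct.one_def] using this

theorem isUnit_sub {g : Gal(K/k)} (hg : g ≠ 1) :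
    ∃ x : K, IsUnit ((1 : F) ⊗ₜ[k] (g x - x)) := by
  obtain ⟨x, hx⟩ : ∃ x, g x ≠ x := by
    by_contra! h
    exact hg (AlgEquiv.ext h)
  exact ⟨x, ((sub_ne_zero.mpr hx).isUnit).map
    (Algebra.TensorProduct.includeRight : K →ₐ[k] F ⊗[k] K)⟩

variable {F} {d : ℕ} [NeZero d] [FiniteDimensional k K]

/-- The cocycle of the cyclic algebra: `b` if the representatives in `[0, d)` of `χ g` and `χ h` have
sum at least `d`, and `1` otherwise. -/
def cyclicCocycle (χ : Gal(K/k) ≃* Multiplicative (ZMod d)) (b : Fˣ) (g h : Gal(K/k)) : F :=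
  if d ≤ (χ g).toAdd.val + (χ h).toAdd.val then b else 1

theorem cyclicCocycle_eq (χ : Gal(K/k) ≃* Multiplicative (ZMod d)) (b : Fˣ) (g h : Gal(K/k)) :
    cyclicCocycle χ b g h = (b : F) ^ (((χ g).toAdd.val + (χ h).toAdd.val) / d) := by
  have hg := ZMod.val_lt (χ g).toAdd
  have hh := ZMod.val_lt (χ h).toAdd
  unfold cyclicCocycle
  split_ifs with h1
  · rw [Nat.div_eq_of_lt_le (k := 1) (by omega) (by omega), pow_one]
  · rw [Nat.div_eq_of_lt (by omega), pow_zero]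

theorem cyclicCocycle_ne_zero (χ : Gal(K/k) ≃* Multiplicative (ZMod d)) (b : Fˣ)
    (g h : Gal(K/k)) : cyclicCocycle χ b g h ≠ 0 := by
  rw [cyclicCocycle_eq]; exact pow_ne_zero _ b.ne_zero

@[simp] theorem cyclicCocycle_one_left (χ : Gal(K/k) ≃* Multiplicative (ZMod d)) (b : Fˣ)
    (g : Gal(K/k)) : cyclicCocycle χ b 1 g = 1 := by
  have hg := ZMod.val_lt (χ g).toAdd
  rw [cyclicCocycle, if_neg (by simpa using hg)]

@[simp] theorem cyclicCocycle_one_right (χ : Gal(K/k) ≃* Multiplicative (ZMod d)) (b : Fˣ)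
    (g : Gal(K/k)) : cyclicCocycle χ b g 1 = 1 := by
  have hg := ZMod.val_lt (χ g).toAdd
  rw [cyclicCocycle, if_neg (by simpa using hg)]

theorem cyclicCocycle_assoc (χ : Gal(K/k) ≃* Multiplicative (ZMod d)) (b : Fˣ)
    (g h l : Gal(K/k)) :
    cyclicCocycle χ b g h * cyclicCocycle χ b (g * h) l =
      cyclicCocycle χ b h l * cyclicCocycle χ b g (h * l) := by
  simp only [cyclicCocycle_eq, ← pow_add, map_mul, toAdd_mul, ZMod.val_add]
  congr 1
  set x := (χ g).toAdd.val
  set y := (χ h).toAdd.val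
  set z := (χ l).toAdd.val
  have hd : 0 < d := Nat.pos_of_neZero d
  have h1 := Nat.div_add_mod (x + y) d
  have h2 := Nat.div_add_mod (y + z) d
  have h3 := Nat.div_add_mod ((x + y) % d + z) d
  have h4 := Nat.div_add_mod (x + (y + z) % d) d
  have h5 : ((x + y) % d + z) % d = (x + (y + z) % d) % d := by
    simp [Nat.add_assoc]
  apply Nat.eq_of_mul_eq_mul_left hd
  rw [mul_add, mul_add]
  omega

/-- The cyclic algebra `(b, χ)` over `F`, for a finite cyclic extension `K / k` with an isomorphism
`χ : Gal(K/k) ≃ ℤ/d`, an extension field `F` of `k` and `b ∈ Fˣ`. It is the direct sum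
`⨁ (F ⊗ K) e_g` over `g ∈ Gal(K/k)`; the family `x` stands for `∑ x g • e_g`. The multiplication
is given by `e_g s = g(s) e_g` and `e_g e_h = cyclicCocycle χ b g h • e_{gh}`. With `σ = χ⁻¹(1)` and
`y = e_σ` this means `e_{σ ^ i} = y ^ i` for `0 ≤ i < d`, `y ^ d = b` and `y s = σ(s) y`. -/
def CyclicAlgebra (_χ : Gal(K/k) ≃* Multiplicative (ZMod d)) (_b : Fˣ) : Type u :=
  Gal(K/k) → F ⊗[k] K

namespace CyclicAlgebra

variable (χ : Gal(K/k) ≃* Multiplicative (ZMod d)) (b : Fˣ)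

noncomputable instance : AddCommGroup (CyclicAlgebra χ b) :=
  inferInstanceAs (AddCommGroup (Gal(K/k) → F ⊗[k] K))

noncomputable instance : Module F (CyclicAlgebra χ b) :=
  inferInstanceAs (Module F (Gal(K/k) → F ⊗[k] K))

instance : FiniteDimensional F (CyclicAlgebra χ b) :=
  inferInstanceAs (FiniteDimensional F (Gal(K/k) → F ⊗[k] K))

noncomputable instance : Mul (CyclicAlgebra χ b) :=
  ⟨fun x y g => ∑ h, cyclicCocycle χ b h (h⁻¹ * g) • (x h * galAct F h (y (h⁻¹ * g)))⟩

noncomputable instance : One (CyclicAlgebra χ b) :=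
  ⟨by classical exact Pi.single 1 1⟩

/-- The element `s • e_g`. -/
noncomputable def single (g : Gal(K/k)) (s : F ⊗[k] K) : CyclicAlgebra χ b := by
  classical exact Pi.single g s

variable {χ b}

@[ext] theorem ext {x y : CyclicAlgebra χ b} (h : ∀ g, x g = y g) : x = y := funext h

theorem mul_apply (x y : CyclicAlgebra χ b) (g : Gal(K/k)) : (x * y) g =
    ∑ h, cyclicCocycle χ b h (h⁻¹ * g) • (x h * galAct F h (y (h⁻¹ * g))) := rfl

@[simp] theorem add_apply (x y : CyclicAlgebra χ b) (g : Gal(K/k)) : (x + y) g = x g + y g := rfl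

@[simp] theorem neg_apply (x : CyclicAlgebra χ b) (g : Gal(K/k)) : (-x) g = -x g := rfl

@[simp] theorem sub_apply (x y : CyclicAlgebra χ b) (g : Gal(K/k)) : (x - y) g = x g - y g := rfl

@[simp] theorem zero_apply (g : Gal(K/k)) : (0 : CyclicAlgebra χ b) g = 0 := rfl

@[simp] theorem smul_apply (f : F) (x : CyclicAlgebra χ b) (g : Gal(K/k)) :
    (f • x) g = f • x g := rfl

theorem one_eq : (1 : CyclicAlgebra χ b) = single χ b 1 1 := rfl

theorem single_same (g : Gal(K/k)) (s : F ⊗[k] K) : single χ b g s g = s := by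
  classical exact Pi.single_eq_same (M := fun _ : Gal(K/k) => F ⊗[k] K) g s

theorem single_of_ne {g h : Gal(K/k)} (hgh : h ≠ g) (s : F ⊗[k] K) : single χ b g s h = 0 := by
  classical exact Pi.single_eq_of_ne (M := fun _ : Gal(K/k) => F ⊗[k] K) hgh s

theorem single_mul_apply (h : Gal(K/k)) (s : F ⊗[k] K) (y : CyclicAlgebra χ b) (g : Gal(K/k)) :
    (single χ b h s * y) g = cyclicCocycle χ b h (h⁻¹ * g) • (s * galAct F h (y (h⁻¹ * g))) := by
  rw [mul_apply, Finset.sum_eq_single h, single_same]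
  · intro l _ hl
    rw [single_of_ne hl, zero_mul, smul_zero]
  · simp

theorem mul_single_apply (x : CyclicAlgebra χ b) (h : Gal(K/k)) (s : F ⊗[k] K) (g : Gal(K/k)) :
    (x * single χ b h s) g =
      cyclicCocycle χ b (g * h⁻¹) h • (x (g * h⁻¹) * galAct F (g * h⁻¹) s) := by
  rw [mul_apply, Finset.sum_eq_single (g * h⁻¹)]
  · rw [show (g * h⁻¹)⁻¹ * g = h by group, single_same]
  · intro l _ hl
    rw [single_of_ne, map_zero, mul_zero, smul_zero]
    rintro rfl
    exact hl (by group)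
  · simp

theorem mul_assoc' (x y z : CyclicAlgebra χ b) : x * y * z = x * (y * z) := by
  ext g
  simp only [mul_apply, map_sum, Finset.sum_mul, Finset.mul_sum, Finset.smul_sum]
  rw [Finset.sum_comm]
  refine Finset.sum_congr rfl fun l _ => ?_
  refine Fintype.sum_equiv (Equiv.mulLeft l⁻¹) _ _ fun h => ?_
  simp only [Equiv.coe_mulLeft, map_smul, map_mul, ← galAct_mul, smul_mul_assoc, mul_smul_comm,
    smul_smul]
  rw [show l * (l⁻¹ * h) = h by group, show (l⁻¹ * h)⁻¹ * (l⁻¹ * g) = h⁻¹ * g by group, mul_assoc,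
    mul_comm (cyclicCocycle χ b h _)]
  congr 1
  have := cyclicCocycle_assoc χ b l (l⁻¹ * h) (h⁻¹ * g)
  rw [show l * (l⁻¹ * h) = h by group, show l⁻¹ * h * (h⁻¹ * g) = l⁻¹ * g by group] at this
  rw [this, mul_comm]

noncomputable instance : Ring (CyclicAlgebra χ b) where
  __ := (inferInstance : AddCommGroup (CyclicAlgebra χ b))
  left_distrib x y z := by
    ext g; simp only [mul_apply, add_apply, map_add, mul_add, smul_add, Finset.sum_add_distrib]
  right_distrib x y z := by
    ext g; simp only [mul_apply, add_apply, add_mul, smul_add, Finset.sum_add_distrib]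
  zero_mul x := by ext g; simp [mul_apply]
  mul_zero x := by ext g; simp [mul_apply]
  mul_assoc := mul_assoc'
  one_mul x := by ext g; simp [one_eq, single_mul_apply, galAct_one]
  mul_one x := by ext g; simp [one_eq, mul_single_apply]

noncomputable instance : Algebra F (CyclicAlgebra χ b) :=
  Algebra.ofModule
    (fun f x y => by
      ext g
      simp only [mul_apply, smul_apply, smul_mul_assoc, Finset.smul_sum, smul_comm f])
    (fun f x y => by
      ext g
      simp only [mul_apply, smul_apply, map_smul, mul_smul_comm, Finset.smul_sum, smul_comm f])

theorem single_mul_single (g h : Gal(K/k)) (s t : F ⊗[k] K) :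
    single χ b g s * single χ b h t =
      single χ b (g * h) (cyclicCocycle χ b g h • (s * galAct F g t)) := by
  ext l
  rw [single_mul_apply]
  by_cases hl : l = g * h
  · subst hl
    rw [show g⁻¹ * (g * h) = h by group, single_same, single_same]
  · rw [single_of_ne hl, single_of_ne, map_zero, mul_zero, smul_zero]
    rintro rfl
    exact hl (by group)

theorem algebraMap_eq (f : F) : algebraMap F (CyclicAlgebra χ b) f = single χ b 1 (f ⊗ₜ 1) := by
  rw [Algebra.algebraMap_eq_smul_one, one_eq]
  ext g
  by_cases hg : g = 1
  · subst hg
    rw [smul_apply, single_same, single_same, Algebra.TensorProduct.one_def, smul_tmul', smul_eq_mul,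
      mul_one]
  · rw [smul_apply, single_of_ne hg, single_of_ne hg, smul_zero]

instance : Nontrivial (CyclicAlgebra χ b) :=
  ⟨0, 1, fun h => by
    have := congrFun h 1
    rw [zero_apply, one_eq, single_same] at this
    exact zero_ne_one this⟩

theorem apply_eq_zero_of_comm {x : CyclicAlgebra χ b}
    (hx : ∀ c : K, single χ b 1 (1 ⊗ₜ c) * x = x * single χ b 1 (1 ⊗ₜ c)) {g : Gal(K/k)}
    (hg : g ≠ 1) : x g = 0 := by
  obtain ⟨c, hc⟩ := isUnit_sub F hg
  have := congrFun (hx c) g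
  simp only [single_mul_apply, mul_single_apply, cyclicCocycle_one_left, cyclicCocycle_one_right,
    inv_one, one_mul, mul_one, one_smul, galAct_one, galAct_tmul] at this
  rw [mul_comm] at this
  rw [← hc.mul_left_eq_zero, tmul_sub, mul_sub, this, sub_self]

variable [IsGalois k K]

instance : Algebra.IsCentral F (CyclicAlgebra χ b) := by
  refine ⟨fun x hx => ?_⟩
  rw [Subalgebra.mem_center_iff] at hx
  obtain ⟨f, hf⟩ := exists_of_galAct_eq F (x 1) fun h => by
    have := congrFun (hx (single χ b h 1)) h
    simpa [single_mul_apply, mul_single_apply] using this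
  refine Algebra.mem_bot.mpr ⟨f, ?_⟩
  rw [algebraMap_eq]
  ext g
  by_cases hg : g = 1
  · subst hg; rw [single_same, hf]
  · rw [single_of_ne hg, apply_eq_zero_of_comm (fun c => hx _) hg]

instance : IsSimpleRing (CyclicAlgebra χ b) := by
  classical
  refine isSimpleRing_of_one_mem fun I x₀ hx₀ hx₀0 => ?_
  let supp : CyclicAlgebra χ b → Finset Gal(K/k) := fun x => Finset.univ.filter fun g => x g ≠ 0
  obtain ⟨x, ⟨hxI, hx0⟩, hmin⟩ := WellFounded.has_min
    (measure fun x : CyclicAlgebra χ b => (supp x).card).wf {x | x ∈ I ∧ x ≠ 0}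
    ⟨x₀, hx₀, hx₀0⟩
  have hmin' : ∀ y ∈ I, (supp y).card < (supp x).card → y = 0 := fun y hy h => by
    by_contra h0
    exact hmin y ⟨hy, h0⟩ h
  obtain ⟨j, hj⟩ : ∃ j, x j ≠ 0 := by
    by_contra! h
    exact hx0 (ext h)
  set y := x * single χ b j⁻¹ 1 with hy
  have hyI : y ∈ I := I.mul_mem_right _ _ hxI
  have hyc : ∀ g, y g = cyclicCocycle χ b (g * j) j⁻¹ • x (g * j) := fun g => by
    rw [hy, mul_single_apply, inv_inv, map_one, mul_one]
  have hy1 : y 1 ≠ 0 := by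
    rw [hyc, one_mul]
    exact smul_ne_zero (cyclicCocycle_ne_zero χ b _ _) hj
  have hycard : (supp y).card ≤ (supp x).card :=
    Finset.card_le_card_of_injOn (· * j)
      (fun g hg => by
        simp only [supp, Finset.coe_filter, Finset.mem_univ, true_and, Set.mem_ofPred_eq, hyc] at hg ⊢
        exact fun h => hg (by rw [h, smul_zero]))
      (mul_left_injective j).injOn
  have hcomm : ∀ c : K, single χ b 1 (1 ⊗ₜ c) * y = y * single χ b 1 (1 ⊗ₜ c) := fun c => by
    refine sub_eq_zero.mp (hmin' _ (sub_mem (I.mul_mem_left _ _ hyI) (I.mul_mem_right _ _ hyI))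
      (lt_of_lt_of_le (Finset.card_lt_card ⟨fun g hg => ?_, fun h => ?_⟩) hycard))
    · simp only [supp, Finset.mem_filter, Finset.mem_univ, true_and] at hg ⊢
      intro h0
      exact hg (by simp [single_mul_apply, mul_single_apply, h0])
    · have h1 : (1 : Gal(K/k)) ∈ supp y := by simpa [supp] using hy1
      have := h h1
      simp only [supp, Finset.mem_filter, Finset.mem_univ, true_and] at this
      exact this (by simp [single_mul_apply, mul_single_apply, galAct_one, mul_comm])
  have hys : y = single χ b 1 (y 1) := by
    ext g
    by_cases hg : g = 1
    · subst hg; rw [single_same]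
    · rw [single_of_ne hg, apply_eq_zero_of_comm hcomm hg]
  let J : Ideal (F ⊗[k] K) :=
    { carrier := {s | single χ b 1 s ∈ I}
      zero_mem' := by
        have : single χ b 1 (0 : F ⊗[k] K) = 0 := by
          classical exact Pi.single_zero (M := fun _ : Gal(K/k) => F ⊗[k] K) 1
        simp [this]
      add_mem' := fun {s t} hs ht => by
        have : single χ b 1 (s + t) = single χ b 1 s + single χ b 1 t := by
          classical exact Pi.single_add (f := fun _ : Gal(K/k) => F ⊗[k] K) 1 s t
        simpa [this] using add_mem hs ht
      smul_mem' := fun t s hs => by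
        have := I.mul_mem_left (single χ b 1 t) _ hs
        simpa [single_mul_single, galAct_one] using this }
  have hJ : (1 : F ⊗[k] K) ∈ J := by
    refine one_mem_of_galAct_stable F J (fun g s hs => ?_) (s₀ := y 1)
      (show single χ b 1 (y 1) ∈ I from hys ▸ hyI) hy1
    have h1 := I.mul_mem_right _ (single χ b g⁻¹ 1) (I.mul_mem_left (single χ b g 1) _ hs)
    rw [single_mul_single, single_mul_single] at h1
    simp only [mul_one, cyclicCocycle_one_right, one_smul, one_mul, map_one,
      mul_inv_cancel] at h1
    have h2 := I.mul_mem_left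
      (algebraMap F (CyclicAlgebra χ b) (cyclicCocycle χ b g g⁻¹)⁻¹) _ h1
    rw [algebraMap_eq, single_mul_single] at h2
    rw [cyclicCocycle_one_left, one_smul, one_mul, galAct_one, mul_smul_comm, ← smul_mul_assoc, smul_tmul',
      smul_eq_mul, mul_inv_cancel₀ (cyclicCocycle_ne_zero χ b _ _), ← Algebra.TensorProduct.one_def,
      one_mul] at h2
    exact h2
  rw [one_eq]
  exact hJ

end CyclicAlgebra

/-- The class of the cyclic algebra `(b, χ)` in the Brauer group of `F`. -/
noncomputable def cyclicClass [IsGalois k K] (χ : Gal(K/k) ≃* Multiplicative (ZMod d)) (b : Fˣ) :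
    BrauerGroup.{u, u} F :=
  brauerClass F (CyclicAlgebra χ b)

end Cyclic

section Unramified

variable {k F : Type u} [Field k] [Field F] [Algebra k F]

/-- A Brauer class of `F` is unramified at a valuation ring `R` of `F` if it lies in the image of
the Brauer group of `R`, i.e. if it is the class of `F ⊗ B` for an Azumaya algebra `B` over `R`. -/
def IsUnramifiedAt (R : ValuationSubring F) (α : BrauerGroup.{u, u} F) : Prop :=
  ∃ (B : Type u) (_ : Ring B) (_ : Algebra R B) (_ : IsAzumaya R B) (A : CSA.{u, u} F),
    Nonempty (A ≃ₐ[F] F ⊗[R] B) ∧ α = Quotient.mk (Brauer.CSA_Setoid F) A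

variable (k) in
/-- A Brauer class of `F` is unramified over `k` if it is unramified at every discrete valuation ring
with field of fractions `F` that contains `k`. -/
def IsUnramifiedOver (α : BrauerGroup.{u, u} F) : Prop :=
  ∀ R : ValuationSubring F, IsDiscreteValuationRing R → (∀ x : k, algebraMap k F x ∈ R) →
    IsUnramifiedAt R α

end Unramified

section NormEquation

variable {k L ι : Type*} [Field k] [CommRing L] [Algebra k L] [Fintype ι]

/-- The coordinate ring `k[x_j] / (N_{L/k}(∑ x_j β_j) - a)` of the affine variety `N_{L/k}(t) = a`,
with respect to a basis `β` of `L` over `k`. -/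
abbrev NormCoordRing (β : Module.Basis ι k L) (a : k) : Type _ :=
  MvPolynomial ι k ⧸ Ideal.span {Algebra.norm (MvPolynomial ι k)
    (∑ j, (MvPolynomial.X j : MvPolynomial ι k) ⊗ₜ[k] β j) - MvPolynomial.C a}

variable {F : Type*} [Field F] [Algebra k F] (β : Module.Basis ι k L) (a : k)
  [Algebra (NormCoordRing β a) F]

variable (F) in
/-- The generic point `t = ∑ x_j β_j` of the variety `N_{L/k}(t) = a`, in `F ⊗ L`. -/
noncomputable def genericPoint : F ⊗[k] L :=
  ∑ j, algebraMap (NormCoordRing β a) F (Ideal.Quotient.mk _ (MvPolynomial.X j)) ⊗ₜ[k] β j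

theorem norm_genericPoint [IsScalarTower k (NormCoordRing β a) F] :
    Algebra.norm F (genericPoint F β a) = algebraMap k F a := by
  classical
  let P := MvPolynomial ι k
  let φ : P →+* F := (algebraMap (NormCoordRing β a) F).comp (Ideal.Quotient.mk _)
  let _ : Algebra P F := φ.toAlgebra
  have hφ : ∀ x, algebraMap P F x = algebraMap (NormCoordRing β a) F (Ideal.Quotient.mk _ x) :=
    fun _ => rfl
  have : IsScalarTower k P F := IsScalarTower.of_algebraMap_eq fun x => by
    rw [hφ, IsScalarTower.algebraMap_apply k (NormCoordRing β a) F]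
    rfl
  have : Module.Free k L := Module.Free.of_basis β
  have : Module.Finite k L := Module.Finite.of_basis β
  let x : P ⊗[k] L := ∑ j, (MvPolynomial.X j : P) ⊗ₜ[k] β j
  have h1 : Algebra.TensorProduct.cancelBaseChange k P F F L (1 ⊗ₜ[P] x) = genericPoint F β a := by
    simp only [x, TensorProduct.tmul_sum, map_sum, genericPoint]
    refine Finset.sum_congr rfl fun j _ => ?_
    rw [Algebra.TensorProduct.cancelBaseChange_tmul, Algebra.smul_def, mul_one, hφ]
  rw [← h1, Algebra.norm_eq_of_algEquiv, Algebra.norm_apply, ← Algebra.baseChange_lmul,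
    LinearMap.det_baseChange, ← Algebra.norm_apply, hφ,
    IsScalarTower.algebraMap_apply k (NormCoordRing β a) F]
  congr 1
  exact Ideal.Quotient.eq.mpr (Ideal.subset_span rfl)

variable {β a} in
theorem isUnit_genericPoint [IsScalarTower k (NormCoordRing β a) F] (ha : a ≠ 0) :
    IsUnit (genericPoint F β a) := by
  have : Module.Free k L := Module.Free.of_basis β
  have : Module.Finite k L := Module.Finite.of_basis β
  have h : IsUnit (LinearMap.det (Algebra.lmul F (F ⊗[k] L) (genericPoint F β a))) := by
    rw [← Algebra.norm_apply, norm_genericPoint]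
    exact ((map_ne_zero _).mpr ha).isUnit
  have h2 := (LinearEquiv.ofIsUnitDet (v := Module.finBasis F (F ⊗[k] L))
    (v' := Module.finBasis F (F ⊗[k] L)) (f := Algebra.lmul F _ (genericPoint F β a))
    (by rwa [LinearMap.det_toMatrix])).surjective 1
  obtain ⟨y, hy⟩ := h2
  exact IsUnit.of_mul_eq_one y hy

/-- The norm from `F ⊗ M` to `F` of the image of the generic point of `N_{L/k}(t) = a` under a
homomorphism of `k`-algebras `π : L → M`. If `L = K × ∏ K_i` and `π` is the projection to `K_i`, this
is the element `N_i` of `Fˣ`. -/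
noncomputable def normUnit {M : Type*} [CommRing M] [Algebra k M]
    [IsScalarTower k (NormCoordRing β a) F] (ha : a ≠ 0) (π : L →ₐ[k] M) : Fˣ :=
  ((isUnit_genericPoint (F := F) (β := β) ha).map ((Algebra.norm F).comp
    (Algebra.TensorProduct.map (AlgHom.id F F) π : F ⊗[k] L →* F ⊗[k] M))).unit

end NormEquation

section Combinatorics

variable {k E : Type*} [Field k] [Field E] [Algebra k E]

/-- The subfield of `K` of degree `d` over `k`, if there is exactly one. -/
noncomputable def subfieldOfDegree (K : IntermediateField k E) (d : ℕ) : IntermediateField k E :=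
  sSup {M | M ≤ K ∧ Module.finrank k M = d}

/-- The field `E_i(m)`, the compositum of `K_i` and the subfield `K(m)` of `K` of degree `p ^ m`; it is
a factor of the `K_i`-algebra `K(m) ⊗ K_i`. -/
noncomputable def factorField (p : ℕ) (K Ki : IntermediateField k E) (m : ℕ) :
    IntermediateField k E :=
  subfieldOfDegree K (p ^ m) ⊔ Ki

/-- The integer `e_i(m)`: the degree of `E_i(m)` over `K_i` is `p ^ e_i(m)`. -/
noncomputable def factorExp (p : ℕ) (K Ki : IntermediateField k E) (m : ℕ) : ℕ :=
  Nat.log p (IntermediateField.relfinrank Ki (factorField p K Ki m))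

/-- The set `Γ_i^m` of conjugacy classes of `g ∈ Gal(E/k)` such that `⟨g⟩` meets
`Gal(E/E_i(n-m)) ∖ Gal(E/E_i(n-m+1))`. It is used for `1 ≤ m ≤ n` only. -/
def gammaSet (p n : ℕ) (K Ki : IntermediateField k E) (m : ℕ) : Set (ConjClasses Gal(E/k)) :=
  ConjClasses.mk '' {g | ∃ h ∈ Subgroup.zpowers g,
    h ∈ (factorField p K Ki (n - m)).fixingSubgroup ∧
    h ∉ (factorField p K Ki (n - m + 1)).fixingSubgroup}

/-- The group `C(L)` for `L = K × ∏ K_i`: families `c(i) ∈ ℤ/p^{e_i(n)}` such that for `1 ≤ m ≤ n` the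
images of `c(i)` in `ℤ/p^{e_i(n)-e_i(n-m)}` and of `c(j)` in `ℤ/p^{e_j(n)-e_j(n-m)}` agree whenever
`Γ_i^m` and `Γ_j^m` meet. In that case both exponents are equal to `m`; that the two classes agree
is expressed by a common integral representative. -/
def combGroup {I : Type*} (p n : ℕ) (K : IntermediateField k E) (Ki : I → IntermediateField k E) :
    AddSubgroup (∀ i, ZMod (p ^ factorExp p K (Ki i) n)) where
  carrier := {c | ∀ m, 1 ≤ m → m ≤ n → ∀ i j,
    (gammaSet p n K (Ki i) m ∩ gammaSet p n K (Ki j) m).Nonempty →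
    ∃ z : ℤ, ∀ l, l = i ∨ l = j →
      ZMod.castHom (pow_dvd_pow p (Nat.sub_le _ _))
        (ZMod (p ^ (factorExp p K (Ki l) n - factorExp p K (Ki l) (n - m)))) (c l) = z}
  zero_mem' := fun m _ _ i j _ => ⟨0, fun l _ => by simp⟩
  add_mem' := fun {c d} hc hd m h1 hn i j hij => by
    obtain ⟨y, hy⟩ := hc m h1 hn i j hij
    obtain ⟨z, hz⟩ := hd m h1 hn i j hij
    exact ⟨y + z, fun l hl => by rw [Pi.add_apply, map_add, hy l hl, hz l hl, Int.cast_add]⟩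
  neg_mem' := fun {c} hc m h1 hn i j hij => by
    obtain ⟨y, hy⟩ := hc m h1 hn i j hij
    exact ⟨-y, fun l hl => by rw [Pi.neg_apply, map_neg, hy l hl, Int.cast_neg]⟩

end Combinatorics

end BrauerNorm

namespace BrauerNorm

set_option linter.unusedSectionVars false

/-! ### Norms as products over embeddings -/

section Embeddings

open TensorProduct

variable {k M Ω J : Type*} [Field k] [CommRing M] [Algebra k M] [Field Ω] [Algebra k Ω]
  [Fintype J] [DecidableEq J]

/-! Why `u` is defined: let N be a field containing both K and M, and let y ∈ F ⊗ M. The norm of y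
from F ⊗ N to F, taken through M, is N_{M/k}(y)^[N : M]; taken through K, it is visibly a norm from
F ⊗ K. The algebra (b, χ) splits when b is a norm from F ⊗ K (`cyclicClass_norm`), and b ↦ (b, χ) is
additive (`cyclicClass_mul`). With M = K_i and N = K K_i this gives p^{e_i(n)} (N_i, χ) = 0.

Why u(c) is unramified at R: no residue map is used. Instead u(c) is rewritten as (b, χ) with b a
unit of R, and for such b the obvious order in the cyclic algebra is Azumaya
(`isUnramifiedAt_cyclicClass`). To find b, choose a finite Galois E' ⊆ E containing K and all K_i,
and a prime q of R ⊗ E' above the maximal ideal of R. A uniformizer of R stays one at q, so the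
order w at q extends the valuation of R and is invariant under the decomposition group D of q. The
image of D in the cyclic group Gal(K/k) is generated by the restriction of some g ∈ D, of order p^f
say. By prime avoidance some norm from F ⊗ K has order exactly p^f (`exists_invariant_order_hom`).
Norms have trivial class, so it remains to show that p^f divides ∑ c(i) V_i, where V_i = w(N_i).

A norm is the product of its images under the embeddings, and g permutes these images without
changing w. Hence an integer that divides all orbit lengths of g on the embeddings of M divides the
order of every norm from M (`dvd_order_norm`). On the embeddings of K all orbits have length p^f.
Since a is a unit of R and is the product of the norm from K and the N_i, it follows that p^f
divides ∑ V_i. For K_i let p^{m_i} be the largest order on K of a power of g fixing some embedding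
of K_i; then p^{f - m_i} divides V_i. Take j with m_j maximal. Suitable powers of g put the class of
g in both Γ_i^{m_i} and Γ_j^{m_i}, so membership in C(L) gives c(i) ≡ c(j) mod p^{m_i}. Therefore ∑
c(i) V_i ≡ c(j) ∑ V_i ≡ 0 mod p^f (`dvd_sum_of_mem_combGroup`). -/

theorem isUnit_embeddingMatrix {τ : J → M →ₐ[k] Ω} (hτ : Function.Injective τ)
    (β : Module.Basis J k M) : IsUnit (Matrix.of fun t j => τ t (β j)) := by
  rw [← Matrix.linearIndependent_rows_iff_isUnit, Fintype.linearIndependent_iff]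
  intro g hg
  refine Fintype.linearIndependent_iff.mp
    ((linearIndependent_toLinearMap k M Ω).comp τ hτ) g (β.ext fun j => ?_)
  have := congrFun hg j
  simp only [Finset.sum_apply, Pi.smul_apply, Matrix.row_apply, Matrix.of_apply, smul_eq_mul,
    Pi.zero_apply] at this
  simp only [LinearMap.sum_apply, LinearMap.smul_apply, Function.comp_apply,
    AlgHom.toLinearMap_apply, smul_eq_mul, LinearMap.zero_apply]
  exact this

/-- The norm from `T ⊗ M` to `T` is the product of the images under the embeddings of `M`. -/
theorem norm_tmul_one (T : Type*) [CommRing T] [Algebra k T] {τ : J → M →ₐ[k] Ω}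
    (hτ : Function.Injective τ) (β : Module.Basis J k M) (y : T ⊗[k] M) :
    (Algebra.norm T y) ⊗ₜ[k] (1 : Ω) =
      ∏ t, Algebra.TensorProduct.map (AlgHom.id T T) (τ t) y := by
  let b := Algebra.TensorProduct.basis T β
  let φ : J → T ⊗[k] M →ₐ[T] T ⊗[k] Ω := fun t => Algebra.TensorProduct.map (AlgHom.id T T) (τ t)
  let V : Matrix J J (T ⊗[k] Ω) := Matrix.of fun t j => φ t (b j)
  have hV : IsUnit V.det := by
    have h := ((Matrix.isUnit_iff_isUnit_det _).mp (isUnit_embeddingMatrix hτ β)).map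
      (Algebra.TensorProduct.includeRight : Ω →ₐ[k] T ⊗[k] Ω)
    rw [AlgHom.map_det] at h
    convert h using 2
    ext t j
    simp [V, b, φ]
  -- Each row of V is an algebra homomorphism evaluated on the basis, so V diagonalizes
  -- multiplication by y. Since T ⊗ Ω may have zero divisors, cancelling `V.det` needs it to be a
  -- unit; this comes from the independence of characters over Ω.
  have key : V * (Algebra.leftMulMatrix b y).map (algebraMap T (T ⊗[k] Ω)) =
      Matrix.diagonal (fun t => φ t y) * V := by
    ext t j
    rw [Matrix.diagonal_mul, Matrix.mul_apply]
    simp only [V, Matrix.of_apply, Matrix.map_apply, Algebra.leftMulMatrix_eq_repr_mul]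
    rw [← map_mul]
    conv_rhs => rw [← b.sum_repr (y * b j), map_sum]
    refine Finset.sum_congr rfl fun i _ => ?_
    rw [map_smul, Algebra.smul_def, mul_comm]
  have hdet := congrArg Matrix.det key
  rw [Matrix.det_mul, Matrix.det_mul, Matrix.det_diagonal, mul_comm] at hdet
  have := hV.mul_right_cancel hdet
  rw [← this, Algebra.norm_eq_matrix_det b, ← RingHom.mapMatrix_apply, ← RingHom.map_det]
  rfl

end Embeddings

/-! ### Dual bases of Galois extensions -/

section Galois

variable (k K : Type*) [Field k] [Field K] [Algebra k K]

theorem algEquivToAlgHom_injective : Function.Injective fun g : Gal(K/k) => (g : K →ₐ[k] K) :=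
  fun _ _ h => AlgEquiv.ext fun x => DFunLike.congr_fun h x

variable [FiniteDimensional k K]

theorem exists_basis_gal [IsGalois k K] : Nonempty (Module.Basis Gal(K/k) k K) := by
  have h : Module.finrank k K = Fintype.card Gal(K/k) := by
    rw [← IsGalois.card_aut_eq_finrank, Nat.card_eq_fintype_card]
  exact ⟨(Module.finBasisOfFinrankEq k K h).reindex (Fintype.equivFin _).symm⟩

variable {k K}

/-- A basis of a Galois extension has a dual basis with respect to the trace form, and the two
together give the separability idempotent. -/
theorem exists_dual_basis [DecidableEq Gal(K/k)] (β : Module.Basis Gal(K/k) k K) :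
    ∃ α : Gal(K/k) → K,
    (∀ g : Gal(K/k), ∑ j, α j * g (β j) = if g = 1 then 1 else 0) ∧
    ∀ i j, ∑ g : Gal(K/k), g (α j) * g (β i) = if j = i then 1 else 0 := by
  obtain ⟨W, hW⟩ := isUnit_iff_exists.mp (isUnit_embeddingMatrix (algEquivToAlgHom_injective k K) β)
  set V := Matrix.of fun (t : Gal(K/k)) (j : Gal(K/k)) => (t : K →ₐ[k] K) (β j) with hVdef
  have h1 : ∀ g : Gal(K/k), ∑ j, W j 1 * g (β j) = if g = 1 then 1 else 0 := fun g => by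
    have := congrFun (congrFun hW.1 g) 1
    rw [Matrix.mul_apply, Matrix.one_apply] at this
    rw [← this]
    exact Finset.sum_congr rfl fun j _ => mul_comm _ _
  refine ⟨fun j => W j 1, h1, ?_⟩
  -- Applying g to the first relation at g⁻¹h shows that the matrix (g α_j) is a right inverse of V
  -- = (h β_j). It is then a left inverse too, and this is the second relation.
  have h2 : V * Matrix.of (fun j g : Gal(K/k) => g (W j 1)) = 1 := by
    ext h g
    rw [Matrix.mul_apply, Matrix.one_apply]
    have := congrArg g (h1 (g⁻¹ * h))
    rw [map_sum] at this
    simp only [map_mul, ← AlgEquiv.mul_apply, mul_inv_cancel_left, inv_mul_eq_one,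
      apply_ite g, map_one, map_zero] at this
    simp only [V, Matrix.of_apply, AlgEquiv.coe_toAlgHom]
    simpa [mul_comm, eq_comm] using this
  intro i j
  have := congrFun (congrFun (mul_eq_one_comm (M := Matrix Gal(K/k) Gal(K/k) K)|>.mp h2) j) i
  rw [Matrix.mul_apply, Matrix.one_apply] at this
  exact this

end Galois

/-! ### Homomorphisms from cyclic algebras, traces, and splitting by norms -/

section Cyclic

variable {k K F : Type u} [Field k] [Field K] [Field F] [Algebra k K] [Algebra k F]
  {d : ℕ} [NeZero d] [FiniteDimensional k K] (χ : Gal(K/k) ≃* Multiplicative (ZMod d)) (b : Fˣ)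

/-- An algebra homomorphism from a cyclic algebra is given by its values on `F ⊗ K` and on the basis
elements `e_g`. -/
noncomputable def CyclicAlgebra.lift {B : Type*} [Ring B] [Algebra F B] (f : F ⊗[k] K →ₐ[F] B)
    (w : Gal(K/k) → B) (h1 : w 1 = 1) (hf : ∀ g s, w g * f s = f (galAct F g s) * w g)
    (hw : ∀ g h, w g * w h = cyclicCocycle χ b g h • w (g * h)) : CyclicAlgebra χ b →ₐ[F] B :=
  AlgHom.ofLinearMap
    { toFun := fun x => ∑ g, f (x g) * w g
      map_add' := fun x y => by simp [add_mul, Finset.sum_add_distrib]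
      map_smul' := fun c x => by simp [Finset.smul_sum] }
    (by
      change ∑ g, f ((1 : CyclicAlgebra χ b) g) * w g = 1
      rw [Finset.sum_eq_single 1, one_eq, single_same, map_one, h1, one_mul]
      · intro g _ hg
        rw [one_eq, single_of_ne hg, map_zero, zero_mul]
      · simp)
    (fun x y => by
      change ∑ g, f ((x * y) g) * w g = (∑ g, f (x g) * w g) * ∑ g, f (y g) * w g
      rw [Finset.sum_mul]
      simp only [mul_apply, map_sum, Finset.sum_mul, Finset.mul_sum]
      rw [Finset.sum_comm]
      refine Finset.sum_congr rfl fun h _ => ?_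
      refine Fintype.sum_equiv (Equiv.mulLeft h⁻¹) _ _ fun g => ?_
      simp only [Equiv.coe_mulLeft]
      rw [mul_assoc, ← mul_assoc (w h), hf, mul_assoc (f _) (w h), hw, mul_inv_cancel_left]
      simp only [map_smul, map_mul, mul_assoc, smul_mul_assoc, mul_smul_comm])

theorem CyclicAlgebra.finrank_eq [IsGalois k K] :
    Module.finrank F (CyclicAlgebra χ b) = Fintype.card Gal(K/k) * Fintype.card Gal(K/k) := by
  change Module.finrank F (Gal(K/k) → F ⊗[k] K) = _
  rw [Module.finrank_pi_fintype, Finset.sum_const, Module.finrank_baseChange,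
    ← IsGalois.card_aut_eq_finrank, Nat.card_eq_fintype_card, smul_eq_mul, Finset.card_univ]

/-- Simplicity of the source gives injectivity. The isomorphisms of central simple algebras below
are obtained in this way, with no inverse written down. -/
theorem nonempty_algEquiv_of_finrank {A B : Type*} [Ring A] [Algebra F A] [IsSimpleRing A]
    [Ring B] [Algebra F B] [Nontrivial B] [FiniteDimensional F A] [FiniteDimensional F B]
    (f : A →ₐ[F] B) (h : Module.finrank F A = Module.finrank F B) : Nonempty (A ≃ₐ[F] B) := by
  have hinj : Function.Injective f := RingHom.injective f.toRingHom
  exact ⟨AlgEquiv.ofBijective f ⟨hinj,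
    (LinearMap.injective_iff_surjective_of_finrank_eq_finrank (f := f.toLinearMap) h).mp hinj⟩⟩

theorem prod_galAct [IsGalois k K] (x : F ⊗[k] K) :
    ∏ g : Gal(K/k), galAct F g x = algebraMap F (F ⊗[k] K) (Algebra.norm F x) := by
  classical
  obtain ⟨β⟩ := exists_basis_gal k K
  exact (norm_tmul_one F (algEquivToAlgHom_injective k K) β x).symm

end Cyclic

section Cyclic

variable {k K : Type u} (F : Type u) [Field k] [Field K] [Field F] [Algebra k K] [Algebra k F]

/-- The trace `F ⊗ K → F`, as the base change of the trace of `K / k`. -/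
noncomputable def tensorTrace : F ⊗[k] K →ₗ[F] F :=
  (Algebra.TensorProduct.rid k F F).toLinearMap ∘ₗ (Algebra.trace k K).baseChange F

@[simp] theorem tensorTrace_tmul (f : F) (x : K) :
    tensorTrace F (f ⊗ₜ[k] x) = Algebra.trace k K x • f := by
  simp [tensorTrace]

theorem tensorTrace_galAct (g : Gal(K/k)) (s : F ⊗[k] K) :
    tensorTrace F (galAct F g s) = tensorTrace F s := by
  induction s with
  | zero => simp
  | tmul f x => simp [Algebra.trace_eq_of_algEquiv]
  | add x y hx hy => simp only [map_add, hx, hy]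

variable [FiniteDimensional k K] [IsGalois k K]

theorem sum_galAct (s : F ⊗[k] K) :
    ∑ g : Gal(K/k), galAct F g s = algebraMap F (F ⊗[k] K) (tensorTrace F s) := by
  induction s with
  | zero => simp
  | tmul f x =>
    simp only [galAct_tmul, tensorTrace_tmul, ← TensorProduct.tmul_sum,
      ← trace_eq_sum_automorphisms, Algebra.TensorProduct.algebraMap_apply, Algebra.algebraMap_self,
      RingHom.id_apply]
    rw [Algebra.algebraMap_eq_smul_one, TensorProduct.smul_tmul]
  | add x y hx hy => simp only [map_add, Finset.sum_add_distrib, hx, hy]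

section Dual

variable {F} {β : Module.Basis Gal(K/k) k K} {α : Gal(K/k) → K} [DecidableEq Gal(K/k)]

theorem sum_dual_mul_galAct
    (h1 : ∀ g : Gal(K/k), ∑ j, α j * g (β j) = if g = 1 then 1 else 0) (g : Gal(K/k)) :
    ∑ j, ((1 : F) ⊗ₜ[k] α j) * galAct F g (1 ⊗ₜ β j) = if g = 1 then 1 else 0 := by
  simp only [galAct_tmul, Algebra.TensorProduct.tmul_mul_tmul, mul_one, ← TensorProduct.tmul_sum, h1]
  split_ifs <;> simp [Algebra.TensorProduct.one_def]

theorem sum_trace_smul_basis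
    (h2 : ∀ i j, ∑ g : Gal(K/k), g (α j) * g (β i) = if j = i then 1 else 0) (s : F ⊗[k] K) :
    ∑ i, tensorTrace F ((1 ⊗ₜ α i) * s) • ((1 : F) ⊗ₜ[k] β i) = s := by
  have h : ∀ i j, Algebra.trace k K (α j * β i) = if j = i then 1 else 0 := fun i j => by
    apply (algebraMap k K).injective
    rw [trace_eq_sum_automorphisms, apply_ite (algebraMap k K), map_one, map_zero, ← h2]
    simp
  let T : F ⊗[k] K →ₗ[F] F ⊗[k] K := ∑ i, LinearMap.smulRight
    (tensorTrace F ∘ₗ LinearMap.mulLeft F (1 ⊗ₜ α i)) ((1 : F) ⊗ₜ[k] β i)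
  have hT : T = LinearMap.id := by
    refine (Algebra.TensorProduct.basis F β).ext fun i => ?_
    simp [T, h, ite_smul]
  have := LinearMap.congr_fun hT s
  simpa [T] using this

theorem sum_trace_smul_dual
    (h1 : ∀ g : Gal(K/k), ∑ j, α j * g (β j) = if g = 1 then 1 else 0) (s : F ⊗[k] K) :
    ∑ i, tensorTrace F (s * (1 ⊗ₜ β i)) • ((1 : F) ⊗ₜ[k] α i) = s := by
  simp only [Algebra.smul_def, ← sum_galAct, map_mul, Finset.sum_mul]
  rw [Finset.sum_comm]
  simp only [mul_assoc, mul_comm (galAct F _ (1 ⊗ₜ β _)), ← Finset.mul_sum,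
    sum_dual_mul_galAct h1]
  simp [galAct_one]

end Dual

variable {F} {d : ℕ} [NeZero d] (χ : Gal(K/k) ≃* Multiplicative (ZMod d)) (b : Fˣ)

/-- The algebra acts on the d-dimensional space F ⊗ K: elements of F ⊗ K by multiplication, and e_σ
by Y = x · σ for the generator σ. The product of the conjugates of x is b, so Y ^ d = b, and
counting dimensions identifies the algebra with the full endomorphism ring. -/
theorem cyclicClass_norm (x : F ⊗[k] K) (hx : (b : F) = Algebra.norm F x) :
    cyclicClass χ b = 0 := by
  classical
  let S := F ⊗[k] K
  let σ : Gal(K/k) := χ.symm (Multiplicative.ofAdd 1)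
  have hσ : ∀ g, σ ^ (χ g).toAdd.val = g := fun g => by
    apply χ.injective
    rw [map_pow, MulEquiv.apply_symm_apply, ← ofAdd_nsmul, nsmul_eq_mul, mul_one,
      ZMod.natCast_zmod_val, ofAdd_toAdd]
  let f := Algebra.lmul F S
  let Y : Module.End F S := f x * (galAct F σ).toLinearMap
  have hYs : ∀ s, Y * f s = f (galAct F σ s) * Y := fun s => by
    refine LinearMap.ext fun t => ?_
    simp [Y, f, mul_left_comm]
  have hpow : ∀ (i : ℕ) s, Y ^ i * f s = f (galAct F (σ ^ i) s) * Y ^ i := fun i => by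
    induction i with
    | zero => intro s; simp [galAct_one]
    | succ i ih =>
      intro s
      rw [pow_succ, mul_assoc, hYs, ← mul_assoc, ih, ← galAct_mul, ← pow_succ, mul_assoc, ← pow_succ]
  have hYi : ∀ (i : ℕ) t, (Y ^ i) t =
      (∏ j ∈ Finset.range i, galAct F (σ ^ j) x) * galAct F (σ ^ i) t := fun i => by
    induction i with
    | zero => intro t; simp [galAct_one]
    | succ i ih =>
      intro t
      rw [pow_succ, Module.End.mul_apply, ih, Finset.prod_range_succ]
      simp [Y, f, pow_succ, galAct_mul, mul_assoc]
  have hYd : Y ^ d = (b : F) • 1 := by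
    refine LinearMap.ext fun t => ?_
    have h1 : σ ^ d = 1 := by
      apply χ.injective
      rw [map_pow, MulEquiv.apply_symm_apply, ← ofAdd_nsmul, nsmul_eq_mul, mul_one,
        ZMod.natCast_self, ofAdd_zero, map_one χ]
    have h2 : ∏ j ∈ Finset.range d, galAct F (σ ^ j) x = ∏ g : Gal(K/k), galAct F g x := by
      refine Finset.prod_bij' (fun j _ => σ ^ j) (fun g _ => (χ g).toAdd.val) (by simp)
        (fun g _ => Finset.mem_range.mpr (ZMod.val_lt _)) (fun j hj => ?_) (fun g _ => hσ g)
        (by simp)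
      rw [map_pow, MulEquiv.apply_symm_apply, ← ofAdd_nsmul, nsmul_eq_mul, mul_one, toAdd_ofAdd,
        ZMod.val_natCast, Nat.mod_eq_of_lt (Finset.mem_range.mp hj)]
    rw [hYi, h1, h2, prod_galAct, ← hx, galAct_one, ← Algebra.smul_def]
    simp
  let e : CyclicAlgebra χ b →ₐ[F] Module.End F S := CyclicAlgebra.lift χ b f
    (fun g => Y ^ (χ g).toAdd.val) (by simp)
    (fun g s => by
      have := hpow (χ g).toAdd.val s
      rwa [hσ] at this)
    -- Exponents in [0, d) add with a carry, and Y ^ d = b turns the carry into the cocycle.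
    (fun g h => by
      rw [cyclicCocycle_eq, map_mul, toAdd_mul, ZMod.val_add, ← pow_add]
      conv_lhs => rw [← Nat.mod_add_div ((χ g).toAdd.val + (χ h).toAdd.val) d, pow_add, pow_mul, hYd,
        smul_pow, one_pow, mul_smul_comm, mul_one])
  have hfr : Module.finrank F S = Fintype.card Gal(K/k) := by
    rw [Module.finrank_baseChange, ← IsGalois.card_aut_eq_finrank, Nat.card_eq_fintype_card]
  obtain ⟨e'⟩ := nonempty_algEquiv_of_finrank e (by
    rw [CyclicAlgebra.finrank_eq, Module.finrank_linearMap, hfr])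
  refine brauerClass_eq (n := 1) (m := Module.finrank F S) one_ne_zero
    Module.finrank_pos.ne' ?_
  exact (e'.trans (algEquivMatrix (Module.finBasis F S))).mapMatrix.trans
    <| (Matrix.compAlgEquiv (Fin 1) (Fin (Module.finrank F S)) F F).trans <|
    Matrix.reindexAlgEquiv F F (finProdFinEquiv.trans (finCongr (one_mul _)))

/-- An algebra that contains `n × n` matrix units commuting with the image of `A` receives a
homomorphism from the algebra of `n × n` matrices over `A`. -/
noncomputable def matrixLift {n A B : Type*} [Fintype n] [DecidableEq n] [Ring A] [Algebra F A]
    [Ring B] [Algebra F B] (φ : A →ₐ[F] B) (E : n → n → B)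
    (hE : ∀ i j k l, E i j * E k l = if j = k then E i l else 0) (h1 : ∑ i, E i i = 1)
    (hc : ∀ i j a, E i j * φ a = φ a * E i j) : Matrix n n A →ₐ[F] B :=
  AlgHom.ofLinearMap
    { toFun := fun X => ∑ i, ∑ j, φ (X i j) * E i j
      map_add' := fun X Y => by simp [add_mul, Finset.sum_add_distrib]
      map_smul' := fun c X => by simp [Finset.smul_sum] }
    (by
      change ∑ i, ∑ j, φ ((1 : Matrix n n A) i j) * E i j = 1
      simp [Matrix.one_apply, apply_ite φ, ite_mul, h1])
    (fun X Y => by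
      change ∑ i, ∑ j, φ ((X * Y) i j) * E i j =
        (∑ i, ∑ j, φ (X i j) * E i j) * ∑ i, ∑ j, φ (Y i j) * E i j
      have h : ∀ i j k l, φ (X i j) * E i j * (φ (Y k l) * E k l) =
          if j = k then φ (X i j) * φ (Y k l) * E i l else 0 := fun i j k l => by
        rw [mul_assoc, ← mul_assoc (E i j), hc, mul_assoc (φ (Y k l)), hE, ← mul_assoc]
        split_ifs <;> simp
      simp only [Finset.sum_mul, Matrix.mul_apply, map_sum, map_mul]
      simp only [Finset.mul_sum, h]
      refine Finset.sum_congr rfl fun i _ => ?_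
      rw [Finset.sum_comm]
      refine Finset.sum_congr rfl fun j _ => ?_
      rw [Finset.sum_comm (s := Finset.univ (α := n))]
      simp)

end Cyclic

/-! ### The separability idempotent and additivity of the cyclic class -/

section Cyclic

variable {k K F : Type u} [Field k] [Field K] [Field F] [Algebra k K] [Algebra k F]
  [FiniteDimensional k K]

section SeparabilityIdempotent

variable [IsGalois k K] [DecidableEq Gal(K/k)] {β : Module.Basis Gal(K/k) k K}
  {α : Gal(K/k) → K}

variable (F) in
/-- The element `∑ α_j ⊗ β_j` of `(F ⊗ K) ⊗ (F ⊗ K)`; it is the separability idempotent if `α` is the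
dual basis of `β`. -/
noncomputable def sepIdempotent (α β : Gal(K/k) → K) : (F ⊗[k] K) ⊗[F] (F ⊗[k] K) :=
  ∑ j, ((1 : F) ⊗ₜ[k] α j) ⊗ₜ[F] ((1 : F) ⊗ₜ[k] β j)

variable (h1 : ∀ g : Gal(K/k), ∑ j, α j * g (β j) = if g = 1 then 1 else 0)
  (h2 : ∀ i j, ∑ g : Gal(K/k), g (α j) * g (β i) = if j = i then 1 else 0)

include h1 h2

/-- Expand β_j s in the basis β with trace coefficients, move the scalars across the tensor sign,
and recognize the expansion of s α_i in the dual basis. -/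
theorem sepIdempotent_mul_comm (s : F ⊗[k] K) :
    sepIdempotent F α β * (1 ⊗ₜ s) = sepIdempotent F α β * (s ⊗ₜ 1) := by
  simp only [sepIdempotent, Finset.sum_mul, Algebra.TensorProduct.tmul_mul_tmul, mul_one]
  have hl : ∀ j, ((1 : F) ⊗ₜ[k] α j) ⊗ₜ[F] (((1 : F) ⊗ₜ[k] β j) * s) =
      ∑ i, (tensorTrace F ((1 ⊗ₜ α i) * s * (1 ⊗ₜ β j)) • ((1 : F) ⊗ₜ[k] α j)) ⊗ₜ[F]
        ((1 : F) ⊗ₜ[k] β i) := fun j => by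
    conv_lhs => rw [← sum_trace_smul_basis h2 (((1 : F) ⊗ₜ[k] β j) * s), TensorProduct.tmul_sum]
    refine Finset.sum_congr rfl fun i _ => ?_
    rw [← TensorProduct.smul_tmul, mul_assoc, mul_comm s]
  rw [Finset.sum_congr rfl fun j _ => hl j, Finset.sum_comm]
  refine Finset.sum_congr rfl fun i _ => ?_
  rw [← TensorProduct.sum_tmul, sum_trace_smul_dual h1]

/-- The trace form is invariant under g, so g carries a pair of dual bases to another such pair, and
the idempotent does not depend on the pair. -/
theorem map_sepIdempotent (g : Gal(K/k)) :
    Algebra.TensorProduct.map (galAct F g) (galAct F g) (sepIdempotent F α β) =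
      sepIdempotent F α β := by
  simp only [sepIdempotent, map_sum, Algebra.TensorProduct.map_tmul]
  have hl : ∀ j, galAct F g ((1 : F) ⊗ₜ[k] α j) ⊗ₜ[F] galAct F g ((1 : F) ⊗ₜ[k] β j) =
      ∑ i, galAct F g (tensorTrace F (galAct F g⁻¹ (1 ⊗ₜ α i) * (1 ⊗ₜ β j)) • ((1 : F) ⊗ₜ[k] α j))
        ⊗ₜ[F] ((1 : F) ⊗ₜ[k] β i) := fun j => by
    conv_lhs => rw [← sum_trace_smul_basis h2 (galAct F g ((1 : F) ⊗ₜ[k] β j)),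
      TensorProduct.tmul_sum]
    refine Finset.sum_congr rfl fun i _ => ?_
    rw [← TensorProduct.smul_tmul, map_smul, ← tensorTrace_galAct F g⁻¹, map_mul, ← galAct_mul,
      inv_mul_cancel, galAct_one]
  rw [Finset.sum_congr rfl fun j _ => hl j, Finset.sum_comm]
  refine Finset.sum_congr rfl fun i _ => ?_
  rw [← TensorProduct.sum_tmul, ← map_sum, sum_trace_smul_dual h1, ← galAct_mul, mul_inv_cancel,
    galAct_one]

/-- On multiples of the idempotent both tensor factors act alike, so the product collapses to
multiplication by ∑ α_j g(β_j), which is 1 or 0. The conjugates under 1 ⊗ g are thus orthogonal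
idempotents. -/
theorem sepIdempotent_mul_map (g : Gal(K/k)) :
    sepIdempotent F α β * Algebra.TensorProduct.map (AlgHom.id F _) (galAct F g)
      (sepIdempotent F α β) = if g = 1 then sepIdempotent F α β else 0 := by
  have h : ∀ s t : F ⊗[k] K, sepIdempotent F α β * (s ⊗ₜ t) =
      sepIdempotent F α β * ((s * t) ⊗ₜ 1) := fun s t => by
    rw [show s ⊗ₜ[F] t = (1 ⊗ₜ t) * (s ⊗ₜ 1) by simp, ← mul_assoc, sepIdempotent_mul_comm h1 h2,
      mul_assoc, Algebra.TensorProduct.tmul_mul_tmul, mul_one, mul_comm t]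
  conv_lhs => rw [sepIdempotent, map_sum, Finset.mul_sum, ← sepIdempotent]
  simp only [Algebra.TensorProduct.map_tmul, AlgHom.id_apply]
  rw [Finset.sum_congr rfl fun j _ => h _ _, ← Finset.mul_sum, ← TensorProduct.sum_tmul,
    sum_dual_mul_galAct h1]
  split_ifs
  · rw [← Algebra.TensorProduct.one_def, mul_one]
  · rw [TensorProduct.zero_tmul, mul_zero]

omit h2 in
theorem sum_map_sepIdempotent :
    ∑ g : Gal(K/k), Algebra.TensorProduct.map (AlgHom.id F _) (galAct F g)
      (sepIdempotent F α β) = 1 := by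
  simp only [sepIdempotent, map_sum, Algebra.TensorProduct.map_tmul, AlgHom.id_apply]
  rw [Finset.sum_comm]
  simp only [← TensorProduct.tmul_sum, sum_galAct]
  have := sum_trace_smul_dual (F := F) h1 1
  simp only [one_mul] at this
  simp only [Algebra.algebraMap_eq_smul_one, ← TensorProduct.smul_tmul, ← TensorProduct.sum_tmul]
  rw [this]
  simp only [Algebra.TensorProduct.one_def]

end SeparabilityIdempotent

variable {d : ℕ} [NeZero d] (χ : Gal(K/k) ≃* Multiplicative (ZMod d)) (b : Fˣ)

include χ in
theorem gal_mul_comm (g h : Gal(K/k)) : g * h = h * g :=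
  χ.injective (by rw [map_mul, map_mul, mul_comm])

theorem cyclicCocycle_comm (g h : Gal(K/k)) : cyclicCocycle χ b g h = cyclicCocycle χ b h g := by
  rw [cyclicCocycle, cyclicCocycle, add_comm]

theorem cyclicCocycle_mul (b' : Fˣ) (g h : Gal(K/k)) :
    cyclicCocycle χ (b * b') g h = cyclicCocycle χ b g h * cyclicCocycle χ b' g h := by
  simp only [cyclicCocycle_eq, Units.val_mul, mul_pow]

namespace CyclicAlgebra

theorem single_add (g : Gal(K/k)) (s t : F ⊗[k] K) :
    single χ b g (s + t) = single χ b g s + single χ b g t := by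
  classical exact Pi.single_add (f := fun _ : Gal(K/k) => F ⊗[k] K) g s t

theorem single_smul (g : Gal(K/k)) (c : F) (s : F ⊗[k] K) :
    single χ b g (c • s) = c • single χ b g s := by
  classical exact Pi.single_smul (f := fun _ : Gal(K/k) => F ⊗[k] K) g c s

/-- The embedding of `F ⊗ K` in the cyclic algebra. -/
noncomputable def ofTensor : F ⊗[k] K →ₐ[F] CyclicAlgebra χ b :=
  AlgHom.ofLinearMap
    { toFun := single χ b 1
      map_add' := single_add χ b 1
      map_smul' := single_smul χ b 1 }
    rfl
    (fun s t => by
      change single χ b 1 (s * t) = single χ b 1 s * single χ b 1 t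
      rw [single_mul_single]
      simp [galAct_one])

/-- The basis element `e_g` of the cyclic algebra. -/
noncomputable def basisElt (g : Gal(K/k)) : CyclicAlgebra χ b := single χ b g 1

theorem ofTensor_mul_basisElt (g : Gal(K/k)) (s : F ⊗[k] K) :
    ofTensor χ b s * basisElt χ b g = single χ b g s := by
  change single χ b 1 s * single χ b g 1 = _
  rw [single_mul_single]
  simp

theorem basisElt_mul_ofTensor (g : Gal(K/k)) (s : F ⊗[k] K) :
    basisElt χ b g * ofTensor χ b s = ofTensor χ b (galAct F g s) * basisElt χ b g := by
  rw [ofTensor_mul_basisElt]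
  change single χ b g 1 * single χ b 1 s = _
  rw [single_mul_single]
  simp

theorem basisElt_mul (g h : Gal(K/k)) :
    basisElt χ b g * basisElt χ b h = cyclicCocycle χ b g h • basisElt χ b (g * h) := by
  simp only [basisElt]
  rw [single_mul_single, map_one, mul_one, single_smul]

theorem basisElt_one : basisElt χ b 1 = 1 := rfl

theorem basisElt_mul_comm (g h : Gal(K/k)) :
    basisElt χ b g * basisElt χ b h = basisElt χ b h * basisElt χ b g := by
  rw [basisElt_mul, basisElt_mul, cyclicCocycle_comm, gal_mul_comm χ g h]

/-- The inverse of `e_g`. -/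
noncomputable def basisEltInv (g : Gal(K/k)) : CyclicAlgebra χ b :=
  (cyclicCocycle χ b g g⁻¹)⁻¹ • basisElt χ b g⁻¹

theorem basisElt_mul_inv (g : Gal(K/k)) : basisElt χ b g * basisEltInv χ b g = 1 := by
  rw [basisEltInv, mul_smul_comm, basisElt_mul, mul_inv_cancel, smul_smul,
    inv_mul_cancel₀ (cyclicCocycle_ne_zero χ b _ _), one_smul, basisElt_one]

theorem basisElt_inv_mul (g : Gal(K/k)) : basisEltInv χ b g * basisElt χ b g = 1 := by
  rw [basisEltInv, smul_mul_assoc, basisElt_mul, inv_mul_cancel, cyclicCocycle_comm, smul_smul,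
    inv_mul_cancel₀ (cyclicCocycle_ne_zero χ b _ _), one_smul, basisElt_one]

end CyclicAlgebra

open CyclicAlgebra in
-- Let ε be the separability idempotent, seen in the tensor product of the algebras of b and b'. The
-- elements W_g = 1 ⊗ e_g conjugate ε into orthogonal idempotents of sum 1, so the W_g ε W_h⁻¹ are d
-- × d matrix units. The elements D_g = e_g ⊗ e_g together with (F ⊗ K) ⊗ 1 satisfy the relations of
-- the algebra of b b', since cocycles multiply, and they commute with the matrix units. The
-- resulting map from d × d matrices over that algebra is an isomorphism because both sides have
-- dimension d⁴.
theorem cyclicClass_mul [IsGalois k K] (b' : Fˣ) :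
    cyclicClass χ (b * b') = cyclicClass χ b + cyclicClass χ b' := by
  classical
  obtain ⟨β⟩ := exists_basis_gal k K
  obtain ⟨α, h1, h2⟩ := exists_dual_basis β
  let Ψ : (F ⊗[k] K) ⊗[F] (F ⊗[k] K) →ₐ[F] CyclicAlgebra χ b ⊗[F] CyclicAlgebra χ b' :=
    Algebra.TensorProduct.map (ofTensor χ b) (ofTensor χ b')
  let W : Gal(K/k) → CyclicAlgebra χ b ⊗[F] CyclicAlgebra χ b' := fun g => 1 ⊗ₜ basisElt χ b' g
  let W' : Gal(K/k) → CyclicAlgebra χ b ⊗[F] CyclicAlgebra χ b' := fun g => 1 ⊗ₜ basisEltInv χ b' g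
  let D : Gal(K/k) → CyclicAlgebra χ b ⊗[F] CyclicAlgebra χ b' := fun g => basisElt χ b g ⊗ₜ basisElt χ b' g
  have hWΨ : ∀ g z, W g * Ψ z =
      Ψ (Algebra.TensorProduct.map (AlgHom.id F _) (galAct F g) z) * W g := fun g z => by
    induction z with
    | zero => simp
    | tmul s t => simp [W, Ψ, basisElt_mul_ofTensor]
    | add x y hx hy => simp only [map_add, mul_add, add_mul, hx, hy]
  have hDΨ : ∀ g z, D g * Ψ z =
      Ψ (Algebra.TensorProduct.map (galAct F g) (galAct F g) z) * D g := fun g z => by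
    induction z with
    | zero => simp
    | tmul s t => simp [D, Ψ, basisElt_mul_ofTensor]
    | add x y hx hy => simp only [map_add, mul_add, add_mul, hx, hy]
  have hWW' : ∀ g, W g * W' g = 1 := fun g => by
    simp [W, W', basisElt_mul_inv, Algebra.TensorProduct.one_def]
  have hW'W : ∀ g, W' g * W g = 1 := fun g => by
    simp [W, W', basisElt_inv_mul, Algebra.TensorProduct.one_def]
  have hW'WW : ∀ g h, ∃ c : F, W' g * W h = c • W (g⁻¹ * h) := fun g h =>
    ⟨(cyclicCocycle χ b' g g⁻¹)⁻¹ * cyclicCocycle χ b' g⁻¹ h, by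
      simp only [W, W', Algebra.TensorProduct.tmul_mul_tmul, basisEltInv, smul_mul_assoc,
        basisElt_mul, smul_smul, TensorProduct.tmul_smul, mul_one]⟩
  have hDW : ∀ g h, D g * W h = W h * D g := fun g h => by
    simp [D, W, basisElt_mul_comm χ b' g h]
  have hDW' : ∀ g h, D g * W' h = W' h * D g := fun g h => by
    simp only [D, W', Algebra.TensorProduct.tmul_mul_tmul, basisEltInv, mul_smul_comm,
      smul_mul_assoc, basisElt_mul_comm χ b' g, mul_one, one_mul]
  set ε := sepIdempotent F α β with hε
  let E : Gal(K/k) → Gal(K/k) → CyclicAlgebra χ b ⊗[F] CyclicAlgebra χ b' := fun g h => W g * Ψ ε * W' h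
  let f1 : F ⊗[k] K →ₐ[F] CyclicAlgebra χ b ⊗[F] CyclicAlgebra χ b' := Ψ.comp Algebra.TensorProduct.includeLeft
  let φ : CyclicAlgebra χ (b * b') →ₐ[F] CyclicAlgebra χ b ⊗[F] CyclicAlgebra χ b' := CyclicAlgebra.lift χ (b * b') f1 D
    (by simp [D, basisElt_one, Algebra.TensorProduct.one_def])
    (fun g s => by simp only [f1, AlgHom.comp_apply, hDΨ]; simp)
    (fun g h => by
      simp only [D, Algebra.TensorProduct.tmul_mul_tmul, basisElt_mul, cyclicCocycle_mul]
      rw [← TensorProduct.smul_tmul', TensorProduct.tmul_smul, smul_smul])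
  have hc : ∀ i j a, E i j * φ a = φ a * E i j := fun i j a => by
    have hEf : ∀ s, E i j * f1 s = f1 s * E i j := fun s => by
      have hW : ∀ g, W g * f1 s = f1 s * W g := fun g => by simp [W, f1, Ψ]
      have hW' : ∀ g, W' g * f1 s = f1 s * W' g := fun g => by simp [W', f1, Ψ]
      have hΨ : Commute (Ψ ε) (f1 s) := by
        simp only [f1, AlgHom.comp_apply, Commute, SemiconjBy, ← map_mul, mul_comm]
      exact (Commute.mul_left (Commute.mul_left (hW i) hΨ) (hW' j)).eq
    have hED : ∀ g, E i j * D g = D g * E i j := fun g => by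
      -- Conjugation by D_g is the diagonal action of g, which fixes ε.
      have hΨ : Commute (D g) (Ψ ε) := (hDΨ g ε).trans (by rw [map_sepIdempotent h1 h2])
      exact (Commute.mul_right (Commute.mul_right (hDW g i) hΨ) (hDW' g j)).eq.symm
    change E i j * ∑ g, f1 (a g) * D g = (∑ g, f1 (a g) * D g) * E i j
    rw [Finset.mul_sum, Finset.sum_mul]
    refine Finset.sum_congr rfl fun g _ => ?_
    rw [← mul_assoc, hEf, mul_assoc, hED, mul_assoc]
  let Φ := matrixLift φ E
    (fun i j m l => by
      simp only [E]
      have : W i * Ψ ε * W' j * (W m * Ψ ε * W' l) =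
          W i * (Ψ ε * (W' j * W m * Ψ ε)) * W' l := by simp only [mul_assoc]
      rw [this]
      split_ifs with hjm
      · subst hjm
        have := sepIdempotent_mul_map (F := F) h1 h2 1
        rw [if_pos rfl, show galAct F (1 : Gal(K/k)) = AlgHom.id F _ from
          AlgHom.ext fun s => galAct_one F s, Algebra.TensorProduct.map_id, AlgHom.id_apply] at this
        rw [hW'W, one_mul, ← map_mul, this]
      -- Up to a scalar the inner factor is W_{j⁻¹m}; moving it past ε produces ε · (1 ⊗ j⁻¹m)ε = 0.
      · obtain ⟨c, hc⟩ := hW'WW j m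
        rw [hc, smul_mul_assoc, hWΨ, mul_smul_comm, ← mul_assoc (Ψ ε), ← map_mul,
          sepIdempotent_mul_map h1 h2, if_neg (by rwa [inv_mul_eq_one]), map_zero, zero_mul,
          smul_zero, mul_zero, zero_mul])
    (by
      simp only [E, hWΨ, mul_assoc, hWW', mul_one, ← map_sum]
      rw [sum_map_sepIdempotent h1, map_one]) hc
  obtain ⟨e⟩ := nonempty_algEquiv_of_finrank Φ (by
    rw [Module.finrank_matrix, CyclicAlgebra.finrank_eq, Module.finrank_tensorProduct,
      CyclicAlgebra.finrank_eq, CyclicAlgebra.finrank_eq])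
  refine brauerClass_eq (A := CyclicAlgebra χ (b * b')) (B := CyclicAlgebra χ b ⊗[F] CyclicAlgebra χ b') (n := Fintype.card Gal(K/k))
    (m := 1) Fintype.card_ne_zero one_ne_zero ?_
  exact (Matrix.reindexAlgEquiv F _ ((Fintype.equivFin _).symm.trans
    (Equiv.uniqueProd Gal(K/k) (Fin 1)).symm)).trans <|
    (Matrix.compAlgEquiv (Fin 1) Gal(K/k) _ F).symm.trans e.mapMatrix

/-- The homomorphism `b ↦ (b, χ)`. -/
noncomputable def cyclicHom [IsGalois k K] : Additive Fˣ →+ BrauerGroup.{u, u} F :=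
  AddMonoidHom.mk' (fun b => cyclicClass χ b.toMul) fun b b' => cyclicClass_mul χ b.toMul b'.toMul

end Cyclic

/-! ### Azumaya orders -/

section Order

open MulOpposite

/-- The elementary endomorphisms span End_R(B), so the map from B ⊗ Bᵐᵒᵖ is surjective. Equality of
ranks makes it bijective. -/
theorem isAzumaya_of_basis {R B J : Type*} [CommRing R] [Ring B] [Algebra R B] [Nontrivial B]
    [Finite J] (b : Module.Basis J R B)
    (h : ∀ i j, ∃ z : B ⊗[R] Bᵐᵒᵖ, ∀ x, AlgHom.mulLeftRight R B z x = b.repr x i • b j) :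
    IsAzumaya R B := by
  classical
  cases nonempty_fintype J
  have : Module.Free R B := .of_basis b
  have : Module.Finite R B := .of_basis b
  have : Nontrivial R := Module.nontrivial R B
  have hsurj : Function.Surjective (AlgHom.mulLeftRight R B) := fun f => by
    choose z hz using h
    refine ⟨∑ i, ∑ j, b.repr (f (b i)) j • z i j, b.ext fun l => ?_⟩
    simp only [map_sum, map_smul, LinearMap.sum_apply, LinearMap.smul_apply, hz]
    simp only [Module.Basis.repr_self, Finsupp.single_apply, ite_smul, one_smul, zero_smul, smul_ite,
      smul_zero]
    rw [Finset.sum_comm]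
    simp [b.sum_repr]
  have hbij : Function.Bijective (AlgHom.mulLeftRight R B).toLinearMap := by
    refine OrzechProperty.bijective_of_surjective_of_finrank_le _ hsurj ?_
    rw [Module.finrank_tensorProduct, Module.finrank_linearMap,
      LinearEquiv.finrank_eq (opLinearEquiv R (M := B))]
  exact { bij := hbij }

variable {F A : Type u} [Field F] [Ring A] [Algebra F A] [Algebra.IsCentral F A] [IsSimpleRing A]
  [FiniteDimensional F A]

/-- The multiplications by elements of a subalgebra `B` of `A` generate a ring of endomorphisms
of `A`. -/
def mulRing {R : Type*} [CommRing R] [Algebra R A] (B : Subalgebra R A) :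
    Subring (AddMonoid.End A) :=
  Subring.closure {f | ∃ c ∈ B, f = AddMonoid.End.mulLeft c ∨ f = AddMonoid.End.mulRight c}

/-- This allows an endomorphism of the order to be constructed and computed inside A; being made of
multiplications by elements of B, it comes from B ⊗ Bᵐᵒᵖ. -/
theorem exists_mulLeftRight_of_mem_mulRing {R : Type*} [CommRing R] [Algebra R A]
    {B : Subalgebra R A} {f : AddMonoid.End A} (hf : f ∈ mulRing B) :
    ∃ z : B ⊗[R] Bᵐᵒᵖ, ∀ x : B, (AlgHom.mulLeftRight R B z x : A) = f x := by
  induction hf using Subring.closure_induction with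
  | mem f hf =>
    obtain ⟨c, hc, rfl | rfl⟩ := hf
    · exact ⟨⟨c, hc⟩ ⊗ₜ 1, fun x => by simp; rfl⟩
    · exact ⟨1 ⊗ₜ op ⟨c, hc⟩, fun x => by simp; rfl⟩
  | zero => exact ⟨0, fun x => by simp⟩
  | one => exact ⟨1, fun x => by simp⟩
  | add f g _ _ hf hg =>
    obtain ⟨y, hy⟩ := hf
    obtain ⟨z, hz⟩ := hg
    exact ⟨y + z, fun x => by simp only [map_add, LinearMap.add_apply, Subalgebra.coe_add, hy, hz]; rfl⟩
  | neg f _ hf =>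
    obtain ⟨y, hy⟩ := hf
    exact ⟨-y, fun x => by simp only [map_neg, LinearMap.neg_apply, Subalgebra.coe_neg, hy]; rfl⟩
  | mul f g _ _ hf hg =>
    obtain ⟨y, hy⟩ := hf
    obtain ⟨z, hz⟩ := hg
    exact ⟨y * z, fun x => by rw [map_mul, Module.End.mul_apply, hy, hz]; rfl⟩

/-- A criterion for a class to be unramified: the algebra contains an order over `R` spanned by a basis
such that all elementary endomorphisms come from multiplications by elements of the order. -/
theorem isUnramifiedAt_of_order (R : ValuationSubring F) {J : Type*} [Finite J]
    (b : Module.Basis J F A) (B : Subalgebra R A)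
    (hB : B.toSubmodule = Submodule.span R (Set.range b))
    (h : ∀ i j, ∃ f ∈ mulRing B, ∀ x, f x = b.repr x i • b j) :
    IsUnramifiedAt R (brauerClass F A) := by
  have : Nontrivial B := B.toSubring.instNontrivialSubtypeMem
  let bB : Module.Basis J R B := (b.restrictScalars R).map
    (LinearEquiv.ofEq _ _ hB.symm)
  have hbB : ∀ j, (bB j : A) = b j := b.restrictScalars_apply R
  have hrepr : ∀ (x : B) i, ((bB.repr x i : R) : F) = b.repr x i := fun x i =>
    b.restrictScalars_repr_apply R ((LinearEquiv.ofEq _ _ hB.symm).symm x) i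
  have hAz : IsAzumaya R B := isAzumaya_of_basis bB fun i j => by
    obtain ⟨f, hf, hfx⟩ := h i j
    obtain ⟨z, hz⟩ := exists_mulLeftRight_of_mem_mulRing hf
    refine ⟨z, fun x => Subtype.ext ?_⟩
    rw [hz, hfx, ← hrepr]
    simp only [Subalgebra.coe_smul, hbB]
    rfl
  have hcomm : ∀ (x : F) (y : B), Commute (Algebra.ofId F A x) (B.val y) :=
    fun x y => Algebra.commutes x _
  let e : F ⊗[R] B →ₐ[F] A := Algebra.TensorProduct.lift (Algebra.ofId F A) B.val hcomm
  -- The map sends the base change of the R-basis of B to the F-basis b.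
  have he : Function.Bijective e := by
    have : (e.toLinearMap : F ⊗[R] B →ₗ[F] A) =
        ((Algebra.TensorProduct.basis F bB).equiv b (Equiv.refl J) : F ⊗[R] B →ₗ[F] A) :=
      (Algebra.TensorProduct.basis F bB).ext fun j => by
        rw [LinearEquiv.coe_coe, Module.Basis.equiv_apply, Algebra.TensorProduct.basis_apply]
        refine (Algebra.TensorProduct.lift_tmul _ _ hcomm 1 (bB j)).trans ?_
        rw [map_one, one_mul]
        exact hbB j
    have h2 : ⇑e = ((Algebra.TensorProduct.basis F bB).equiv b (Equiv.refl J)) :=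
      congrArg DFunLike.coe this
    rw [h2]
    exact LinearEquiv.bijective _
  exact ⟨B, inferInstance, inferInstance, hAz, ⟨.of F A⟩,
    ⟨(AlgEquiv.ofBijective e he).symm⟩, rfl⟩

end Order

/-! ### Cyclic algebras of units are unramified -/

section Cyclic

variable {k K F : Type u} [Field k] [Field K] [Field F] [Algebra k K] [Algebra k F]
  [FiniteDimensional k K] [IsGalois k K] {d : ℕ} [NeZero d]
  (χ : Gal(K/k) ≃* Multiplicative (ZMod d)) (b : Fˣ)

namespace CyclicAlgebra

/-- The basis of the cyclic algebra given by a basis of `K / k`. -/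
noncomputable def basis (β : Module.Basis Gal(K/k) k K) :
    Module.Basis (Σ _ : Gal(K/k), Gal(K/k)) F (CyclicAlgebra χ b) :=
  Pi.basis fun _ => Algebra.TensorProduct.basis F β

theorem basis_apply (β : Module.Basis Gal(K/k) k K) (g j : Gal(K/k)) :
    basis χ b β ⟨g, j⟩ = single χ b g (1 ⊗ₜ β j) := by
  classical
  refine (Pi.basis_apply (fun _ => Algebra.TensorProduct.basis F β) ⟨g, j⟩).trans ?_
  rw [Algebra.TensorProduct.basis_apply]
  unfold single
  congr!

theorem basis_repr (β : Module.Basis Gal(K/k) k K) (x : CyclicAlgebra χ b) (g j : Gal(K/k)) :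
    (basis χ b β).repr x ⟨g, j⟩ = (Algebra.TensorProduct.basis F β).repr (x g) j :=
  Pi.basis_repr (fun _ => Algebra.TensorProduct.basis F β) x ⟨g, j⟩

theorem mul_basisEltInv_apply (x : CyclicAlgebra χ b) (h : Gal(K/k)) :
    (x * basisEltInv χ b h) 1 = x h := by
  rw [basisEltInv, mul_smul_comm, smul_apply, basisElt, mul_single_apply]
  simp only [inv_inv, one_mul, map_one, mul_one, smul_smul]
  rw [inv_mul_cancel₀ (cyclicCocycle_ne_zero χ b _ _), one_smul]

/-- Moving β_j past e_g turns the coefficient at g into its product with ∑ α_j g(β_j), which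
vanishes for g ≠ 1. The sum is thus the projection to F ⊗ K, written with multiplications only. -/
theorem sum_ofTensor_mul [DecidableEq Gal(K/k)] {β : Module.Basis Gal(K/k) k K} {α : Gal(K/k) → K}
    (h1 : ∀ g : Gal(K/k), ∑ j, α j * g (β j) = if g = 1 then 1 else 0) (x : CyclicAlgebra χ b) :
    ∑ j, ofTensor χ b (1 ⊗ₜ α j) * x * ofTensor χ b (1 ⊗ₜ β j) = ofTensor χ b (x 1) := by
  have hs : ∀ s, ofTensor χ b s = single χ b 1 s := fun _ => rfl
  have hsum : ∀ (f : Gal(K/k) → CyclicAlgebra χ b) g, (∑ j, f j) g = ∑ j, f j g := fun f g =>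
    Finset.sum_apply g _ _
  ext g
  simp only [hsum, hs, mul_single_apply, single_mul_apply, inv_one, mul_one, one_mul, galAct_one,
    cyclicCocycle_one_left, cyclicCocycle_one_right, one_smul]
  simp only [mul_assoc, mul_left_comm _ (x g), ← Finset.mul_sum, sum_dual_mul_galAct h1]
  split_ifs with hg
  · subst hg; rw [single_same, mul_one]
  · rw [single_of_ne hg, mul_zero]

variable (R : ValuationSubring F)

theorem cyclicCocycle_mem (hb : (b : F) ∈ R) (g h : Gal(K/k)) : cyclicCocycle χ b g h ∈ R := by
  rw [cyclicCocycle]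
  split_ifs
  exacts [hb, one_mem R]

theorem single_tmul_mem_span (hk : ∀ x : k, algebraMap k F x ∈ R) (β : Module.Basis Gal(K/k) k K)
    (g : Gal(K/k)) (c : K) :
    single χ b g (1 ⊗ₜ c) ∈ Submodule.span R (Set.range (basis χ b β)) := by
  have h : single χ b g (1 ⊗ₜ c) =
      ∑ j, (⟨algebraMap k F (β.repr c j), hk _⟩ : R) • basis χ b β ⟨g, j⟩ := by
    conv_lhs => rw [← β.sum_repr c, TensorProduct.tmul_sum]
    have : ∀ f : Gal(K/k) → F ⊗[k] K, single χ b g (∑ j, f j) = ∑ j, single χ b g (f j) :=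
      fun f => map_sum (AddMonoidHom.mk' (single χ b g) (single_add χ b g)) f _
    rw [this]
    refine Finset.sum_congr rfl fun j _ => ?_
    rw [basis_apply, Subring.smul_def, ← single_smul, TensorProduct.tmul_smul, algebraMap_smul]
  rw [h]
  exact sum_mem fun j _ => Submodule.smul_mem _ _ (Submodule.subset_span ⟨_, rfl⟩)

/-- The order `⨁ (R ⊗ K) e_g` of the cyclic algebra. -/
noncomputable def order (hk : ∀ x : k, algebraMap k F x ∈ R) (hb : (b : F) ∈ R)
    (β : Module.Basis Gal(K/k) k K) : Subalgebra R (CyclicAlgebra χ b) :=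
  (Submodule.span R (Set.range (basis χ b β))).toSubalgebra
    (single_tmul_mem_span χ b R hk β 1 1)
    (fun x y hx hy => by
      have h := Submodule.mul_mem_mul hx hy
      rw [Submodule.span_mul_span] at h
      refine Submodule.span_le.mpr ?_ h
      rintro _ ⟨_, ⟨⟨g, i⟩, rfl⟩, _, ⟨⟨h, j⟩, rfl⟩, rfl⟩
      simp only [basis_apply, single_mul_single, galAct_tmul, Algebra.TensorProduct.tmul_mul_tmul,
        mul_one, single_smul]
      exact Submodule.smul_mem _ (⟨_, cyclicCocycle_mem χ b R hb g h⟩ : R)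
        (single_tmul_mem_span χ b R hk β _ _))

end CyclicAlgebra

open CyclicAlgebra in
-- For a unit b the elements e_g are invertible in the order ⨁ (R ⊗ K) e_g. The projection to a
-- basis vector can then be written with multiplications by elements of the order, as
-- `isUnramifiedAt_of_order` requires.
theorem isUnramifiedAt_cyclicClass (R : ValuationSubring F) (hk : ∀ x : k, algebraMap k F x ∈ R)
    (hb : (b : F) ∈ R) (hb' : ((b⁻¹ : Fˣ) : F) ∈ R) : IsUnramifiedAt R (cyclicClass χ b) := by
  classical
  obtain ⟨β⟩ := exists_basis_gal k K
  obtain ⟨α, h1, h2⟩ := exists_dual_basis β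
  let B := order χ b R hk hb β
  refine isUnramifiedAt_of_order R (basis χ b β) B (Submodule.toSubalgebra_toSubmodule _ _ _) ?_
  rintro ⟨h, j⟩ ⟨g, i⟩
  have hs : ∀ g c, single χ b g (1 ⊗ₜ c) ∈ B := single_tmul_mem_span χ b R hk β
  -- Only here is b⁻¹ ∈ R needed: the inverse of e_g contains the inverse of a cocycle value.
  have hinv : ∀ g, basisEltInv χ b g ∈ B := fun g => by
    have hc : (cyclicCocycle χ b g g⁻¹)⁻¹ ∈ R := by
      rw [cyclicCocycle]
      split_ifs
      · simpa using hb'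
      · simp
    exact Subalgebra.smul_mem B (hs g⁻¹ 1) (⟨_, hc⟩ : R)
  have hl : ∀ c ∈ B, AddMonoid.End.mulLeft c ∈ mulRing B := fun c hc =>
    Subring.subset_closure ⟨c, hc, Or.inl rfl⟩
  have hr : ∀ c ∈ B, AddMonoid.End.mulRight c ∈ mulRing B := fun c hc =>
    Subring.subset_closure ⟨c, hc, Or.inr rfl⟩
  -- The coordinate of x at β_j e_h is the trace of α_j x_h. The five maps move x_h to the position
  -- of e_1, project to F ⊗ K, multiply by α_j, take the trace as ∑ e_l (·) e_l⁻¹, and multiply by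
  -- the target β_i e_g.
  let f1 : AddMonoid.End (CyclicAlgebra χ b) := AddMonoid.End.mulRight (basisEltInv χ b h)
  let f2 : AddMonoid.End (CyclicAlgebra χ b) := ∑ l,
    AddMonoid.End.mulRight (single χ b 1 (1 ⊗ₜ β l)) *
      AddMonoid.End.mulLeft (single χ b 1 (1 ⊗ₜ α l))
  let f3 : AddMonoid.End (CyclicAlgebra χ b) := AddMonoid.End.mulLeft (single χ b 1 (1 ⊗ₜ α j))
  let f4 : AddMonoid.End (CyclicAlgebra χ b) := ∑ l,
    AddMonoid.End.mulRight (basisEltInv χ b l) *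
      AddMonoid.End.mulLeft (basisElt χ b l)
  let f5 : AddMonoid.End (CyclicAlgebra χ b) := AddMonoid.End.mulRight (single χ b g (1 ⊗ₜ β i))
  refine ⟨f5 * (f4 * (f3 * (f2 * f1))), ?_, fun x => ?_⟩
  · refine mul_mem (hr _ (hs _ _)) (mul_mem (sum_mem fun l _ => mul_mem (hr _ (hinv l))
      (hl _ (hs l 1))) (mul_mem (hl _ (hs _ _)) (mul_mem (sum_mem fun l _ =>
      mul_mem (hr _ (hs _ _)) (hl _ (hs _ _))) (hr _ (hinv h)))))
  · have hsum : ∀ (f : Gal(K/k) → AddMonoid.End (CyclicAlgebra χ b)) y,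
        (∑ l, f l) y = ∑ l, f l y := fun f y => AddMonoidHom.finsetSum_apply _ _ _
    have e2 : ∀ y, f2 y = ofTensor χ b (y 1) := fun y => by
      rw [← sum_ofTensor_mul χ b h1 y]
      exact hsum _ y
    have e4 : ∀ s, f4 (ofTensor χ b s) = algebraMap F _ (tensorTrace F s) := fun s => by
      have : algebraMap F (CyclicAlgebra χ b) (tensorTrace F s) =
          ofTensor χ b (∑ g : Gal(K/k), galAct F g s) := by
        rw [sum_galAct, AlgHom.commutes]
      rw [this, map_sum]
      refine (hsum _ _).trans ?_
      refine Finset.sum_congr rfl fun l _ => ?_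
      change basisElt χ b l * ofTensor χ b s * basisEltInv χ b l = _
      rw [basisElt_mul_ofTensor, mul_assoc, basisElt_mul_inv, mul_one]
    have e3 : ∀ s, f3 (ofTensor χ b s) = ofTensor χ b ((1 ⊗ₜ α j) * s) := fun s => by
      rw [map_mul]
      rfl
    have e1 : f1 x 1 = x h := mul_basisEltInv_apply χ b x h
    change f5 (f4 (f3 (f2 (f1 x)))) = _
    rw [e2 (f1 x), e1, e3, e4]
    change algebraMap F _ _ * single χ b g (1 ⊗ₜ β i) = _
    rw [basis_apply, basis_repr, ← Algebra.smul_def]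
    congr 1
    conv_rhs => rw [← sum_trace_smul_basis h2 (x h)]
    simp only [← Algebra.TensorProduct.basis_apply, map_sum, map_smul, Module.Basis.repr_self]
    simp [Finsupp.single_apply]

end Cyclic

/-! ### Norms in towers and multiples of norm classes -/

section NormTower

variable {k : Type*} (F M N : Type*) [Field k] [Field F] [Field M] [Field N] [Algebra k F]
  [Algebra k M] [Algebra k N] [Algebra M N] [IsScalarTower k M N] [FiniteDimensional k M]
  [FiniteDimensional M N]

/-- The homomorphism `F ⊗ M → F ⊗ N` for an extension `N` of `M`. -/
noncomputable def tensorIncl : F ⊗[k] M →ₐ[F] F ⊗[k] N :=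
  Algebra.TensorProduct.map (AlgHom.id F F) (IsScalarTower.toAlgHom k M N)

variable {M N} in
theorem nonempty_basis_tensorIncl {J : Type*} [Fintype J] (b : Module.Basis J M N) :
    letI : Algebra (F ⊗[k] M) (F ⊗[k] N) := (tensorIncl F M N).toAlgebra
    Nonempty (Module.Basis J (F ⊗[k] M) (F ⊗[k] N)) := by
  let : Algebra (F ⊗[k] M) (F ⊗[k] N) := (tensorIncl F M N).toAlgebra
  have : IsScalarTower F (F ⊗[k] M) (F ⊗[k] N) :=
    IsScalarTower.of_algebraMap_eq fun x => ((tensorIncl F M N).commutes x).symm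
  let c := Module.finBasis k M
  let φ : (J → F ⊗[k] M) →ₗ[F ⊗[k] M] F ⊗[k] N :=
    Fintype.linearCombination (F ⊗[k] M) fun j => (1 : F) ⊗ₜ[k] b j
  let B1 : Module.Basis (Σ _ : J, Fin (Module.finrank k M)) F (J → F ⊗[k] M) :=
    Pi.basis fun _ => Algebra.TensorProduct.basis F c
  let B2 : Module.Basis (Fin (Module.finrank k M) × J) F (F ⊗[k] N) :=
    Algebra.TensorProduct.basis F (c.smulTower b)
  let e : (J → F ⊗[k] M) ≃ₗ[F] F ⊗[k] N :=
    B1.equiv B2 ((Equiv.sigmaEquivProd _ _).trans (Equiv.prodComm _ _))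
  have he : φ.restrictScalars F = e := B1.ext fun ⟨j, i⟩ => by
    classical
    have h1 : φ (B1 ⟨j, i⟩) = (1 : F) ⊗ₜ[k] c i • ((1 : F) ⊗ₜ[k] b j : F ⊗[k] N) := by
      simp only [φ, B1, Pi.basis_apply, Algebra.TensorProduct.basis_apply,
        Fintype.linearCombination_apply_single]
    have h2 : (e : (J → F ⊗[k] M) →ₗ[F] F ⊗[k] N) (B1 ⟨j, i⟩) = B2 (i, j) := by
      simp [e, Module.Basis.equiv_apply]
    rw [h2, LinearMap.restrictScalars_apply, h1]
    simp only [B2, Algebra.TensorProduct.basis_apply, Module.Basis.smulTower_apply]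
    rw [Algebra.smul_def]
    change tensorIncl F M N _ * _ = _
    simp [tensorIncl, Algebra.smul_def]
  have hbij : Function.Bijective φ := by
    have : (φ : (J → F ⊗[k] M) → F ⊗[k] N) = e := congrArg DFunLike.coe he
    rw [this]
    exact e.bijective
  exact ⟨.ofEquivFun (LinearEquiv.ofBijective φ hbij).symm⟩

variable {F N} in
/-- The norm `F ⊗ N → F` factors through a norm `F ⊗ N → F ⊗ M`. -/
theorem exists_norm_eq (z : F ⊗[k] N) : ∃ x : F ⊗[k] M, Algebra.norm F x = Algebra.norm F z ∧
    ∀ y, z = tensorIncl F M N y → x = y ^ Module.finrank M N := by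
  let : Algebra (F ⊗[k] M) (F ⊗[k] N) := (tensorIncl F M N).toAlgebra
  have : IsScalarTower F (F ⊗[k] M) (F ⊗[k] N) :=
    IsScalarTower.of_algebraMap_eq fun x => ((tensorIncl F M N).commutes x).symm
  obtain ⟨b⟩ := nonempty_basis_tensorIncl F (k := k) (Module.finBasis M N)
  have : Module.Free (F ⊗[k] M) (F ⊗[k] N) := .of_basis b
  refine ⟨Algebra.norm (F ⊗[k] M) z, Algebra.norm_norm, fun y hy => ?_⟩
  rw [hy]
  refine (Algebra.norm_algebraMap_of_basis b y).trans ?_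
  rw [Fintype.card_fin]

end NormTower

section Cyclic

variable {k K F : Type u} [Field k] [Field K] [Field F] [Algebra k K] [Algebra k F]
  [FiniteDimensional k K] [IsGalois k K] {d : ℕ} [NeZero d]
  (χ : Gal(K/k) ≃* Multiplicative (ZMod d))

/-- The multiple `[N : M] (N_{M/k}(y), χ)` vanishes if the extension `N` of `M` contains `K`. -/
theorem finrank_nsmul_cyclicClass_norm (M N : Type*) [Field M] [Field N] [Algebra k M] [Algebra k N]
    [Algebra M N] [IsScalarTower k M N] [FiniteDimensional k M] [FiniteDimensional M N]
    [Algebra K N] [IsScalarTower k K N] [FiniteDimensional K N] (y : F ⊗[k] M) (b : Fˣ)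
    (hb : (b : F) = Algebra.norm F y) :
    Module.finrank M N • cyclicHom χ (Additive.ofMul b) = 0 := by
  -- The same element of F ⊗ N is normed down through K and through M; the second route gives y ^ [N
  -- : M].
  obtain ⟨x, hx, -⟩ := exists_norm_eq K (tensorIncl F M N y)
  obtain ⟨x', hx', h⟩ := exists_norm_eq M (tensorIncl F M N y)
  rw [← map_nsmul]
  refine cyclicClass_norm χ _ x ?_
  rw [hx, ← hx', h y rfl, map_pow, ← hb]
  rfl

end Cyclic

/-! ### The order function at a prime of `R ⊗ E` -/

section Valuation

variable (k : Type u) {R : Type u} (F E : Type u) [Field k] [CommRing R] [Field F] [Field E]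
  [Algebra k R] [Algebra R F] [Algebra k F] [IsScalarTower k R F] [Algebra k E]

/-- The inclusion of `R ⊗ E` in `F ⊗ E`. -/
noncomputable def orderIncl : R ⊗[k] E →ₐ[k] F ⊗[k] E :=
  Algebra.TensorProduct.map (IsScalarTower.toAlgHom k R F) (AlgHom.id k E)

theorem orderIncl_algebraMap (r : R) :
    orderIncl k F E (algebraMap R (R ⊗[k] E) r) = algebraMap F _ (algebraMap R F r) := by
  simp [orderIncl]

theorem orderIncl_pow_mul (r : R) (n : ℕ) (s : R ⊗[k] E) :
    orderIncl k F E (algebraMap R (R ⊗[k] E) r ^ n * s) =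
      (algebraMap R F r) ^ n • orderIncl k F E s := by
  rw [map_mul, map_pow, orderIncl_algebraMap, ← map_pow, ← Algebra.smul_def]

theorem orderIncl_injective [FaithfulSMul R F] : Function.Injective (orderIncl (R := R) k F E) :=
  Module.Flat.rTensor_preserves_injective_linearMap (M := E)
    (IsScalarTower.toAlgHom k R F).toLinearMap (FaithfulSMul.algebraMap_injective R F)

/-- The action of the Galois group on `R ⊗ E`. -/
noncomputable def galActOrder (R : Type u) [CommRing R] [Algebra k R] (g : Gal(E/k)) :
    R ⊗[k] E →ₐ[R] R ⊗[k] E :=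
  Algebra.TensorProduct.map (AlgHom.id R R) (g : E →ₐ[k] E)

variable {k E}

theorem galActOrder_tmul (g : Gal(E/k)) (r : R) (x : E) :
    galActOrder k E R g (r ⊗ₜ x) = r ⊗ₜ g x := by
  simp [galActOrder]

theorem galActOrder_mul (g h : Gal(E/k)) (s : R ⊗[k] E) :
    galActOrder k E R (g * h) s = galActOrder k E R g (galActOrder k E R h s) := by
  induction s with
  | zero => simp
  | tmul f x => simp [galActOrder_tmul]
  | add x y hx hy => simp only [map_add, hx, hy]

theorem galActOrder_one (s : R ⊗[k] E) : galActOrder k E R 1 s = s := by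
  induction s with
  | zero => simp
  | tmul f x => simp [galActOrder_tmul]
  | add x y hx hy => simp only [map_add, hx, hy]

theorem orderIncl_galActOrder (g : Gal(E/k)) (s : R ⊗[k] E) :
    orderIncl k F E (galActOrder k E R g s) = galAct F g (orderIncl k F E s) := by
  induction s with
  | zero => simp
  | tmul f x => simp [galActOrder_tmul, orderIncl]
  | add x y hx hy => simp only [map_add, hx, hy]

variable (k E) in
/-- The algebra `R ⊗ E` has a maximal ideal over the maximal ideal `(π)` of `R`, and it is generated
by `π` in the local ring. -/
theorem exists_unramified_prime [IsDomain R] [IsDiscreteValuationRing R] [FiniteDimensional k E]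
    [Algebra.IsSeparable k E] {π : R} (hπ : Irreducible π) :
    ∃ q : Ideal (R ⊗[k] E), q.IsMaximal ∧ algebraMap R _ π ∈ q ∧
      ∀ s ∈ q, ∃ t ∉ q, ∃ s', t * s = algebraMap R _ π * s' := by
  let κ := IsLocalRing.ResidueField R
  let mk : R →ₐ[R] κ := Algebra.ofId R κ
  have hmk : Function.Surjective mk := IsLocalRing.residue_surjective
  let ρ : R ⊗[k] E →ₐ[R] κ ⊗[k] E := Algebra.TensorProduct.map mk (AlgHom.id k E)
  have hρ : Function.Surjective ρ := by
    intro z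
    induction z with
    | zero => exact ⟨0, map_zero _⟩
    | tmul f x =>
      obtain ⟨r, rfl⟩ := hmk f
      exact ⟨r ⊗ₜ x, by simp [ρ]⟩
    | add x y hx hy =>
      obtain ⟨a, rfl⟩ := hx
      obtain ⟨b, rfl⟩ := hy
      exact ⟨a + b, map_add _ _ _⟩
  have hker : ∀ s, ρ s = 0 → ∃ s', s = algebraMap R _ π * s' := fun s hs => by
    have h1 := Algebra.TensorProduct.rTensor_ker (R := k) (C := E) mk hmk
    have h2 : s ∈ RingHom.ker ρ := hs
    have h3 : RingHom.ker mk = Ideal.span {π} :=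
      (IsLocalRing.ker_residue (R := R)).trans hπ.maximalIdeal_eq
    rw [h1, h3, Ideal.map_span, Set.image_singleton, Ideal.mem_span_singleton] at h2
    exact h2
  have hρπ : ρ (algebraMap R _ π) = 0 := by
    rw [AlgHom.commutes, IsScalarTower.algebraMap_apply R κ _]
    have : algebraMap R κ π = 0 := (IsLocalRing.residue_eq_zero_iff π).mpr
      (hπ.maximalIdeal_eq ▸ Ideal.mem_span_singleton_self π)
    rw [this, map_zero]
  -- Separability of E / k passes to the residue field: the fibre κ ⊗ E is reduced, which is why π
  -- generates the maximal ideal at q.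
  have : Algebra.FormallyUnramified k E := Algebra.FormallyUnramified.of_isSeparable k E
  have : Algebra.FormallyUnramified κ (κ ⊗[k] E) := Algebra.FormallyUnramified.base_change κ
  have : IsReduced (κ ⊗[k] E) :=
    Algebra.FormallyUnramified.isReduced_of_field κ _
  have : IsArtinianRing (κ ⊗[k] E) := IsArtinianRing.of_finite κ _
  obtain ⟨m, hm⟩ := Ideal.exists_maximal (κ ⊗[k] E)
  refine ⟨m.comap ρ, Ideal.comap_isMaximal_of_surjective ρ hρ, ?_, fun s hs => ?_⟩
  · rw [Ideal.mem_comap, hρπ]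
    exact zero_mem m
  -- The powers of ρ(s) stabilize up to multiples, so ρ(s)^n = ρ(s)^{n+1} ρ(r). Reducedness then
  -- gives (1 - sr)s ∈ (π), and 1 - sr lies outside q because s lies in q.
  · obtain ⟨n, r', hr⟩ := IsArtinian.exists_pow_succ_smul_dvd (ρ s) (1 : κ ⊗[k] E)
    obtain ⟨r, rfl⟩ := hρ r'
    have h0 : ρ ((1 - s * r) * s) = 0 := by
      have : ρ ((1 - s * r) * s) ^ (n + 1) = 0 := by
        simp only [smul_eq_mul, mul_one] at hr
        rw [map_mul, mul_pow, map_sub, map_mul, map_one, pow_succ, pow_succ (ρ s)]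
        calc (1 - ρ s * ρ r) ^ n * (1 - ρ s * ρ r) * (ρ s ^ n * ρ s)
            = (1 - ρ s * ρ r) ^ n * (ρ s ^ n - ρ s ^ n.succ * ρ r) * ρ s := by
              rw [pow_succ]; ring
          _ = 0 := by rw [hr, sub_self, mul_zero, zero_mul]
      exact pow_eq_zero_iff (Nat.succ_ne_zero n) |>.mp this
    refine ⟨1 - s * r, fun h => ?_, hker _ h0⟩
    have : (1 : R ⊗[k] E) ∈ m.comap ρ := by
      have := add_mem h (Ideal.mul_mem_right r _ hs)
      rwa [sub_add_cancel] at this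
    rw [Ideal.mem_comap, map_one] at this
    exact hm.ne_top ((Ideal.eq_top_iff_one m).mpr this)

variable {F} (π : R) (q : Ideal (R ⊗[k] E))

/-- The element `z` of `F ⊗ E` has order `n` at the prime `q` of `R ⊗ E`, where `π` is a
uniformizer. -/
def HasOrder (z : F ⊗[k] E) (n : ℤ) : Prop :=
  ∃ t ∉ q, ∃ t' ∉ q, orderIncl k F E t * z = (algebraMap R F π) ^ n • orderIncl k F E t'

variable {π q}

theorem HasOrder.mul [q.IsPrime] (hπ : algebraMap R F π ≠ 0) {y z : F ⊗[k] E} {m n : ℤ}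
    (hy : HasOrder π q y m) (hz : HasOrder π q z n) : HasOrder π q (y * z) (m + n) := by
  obtain ⟨t, ht, t', ht', h⟩ := hy
  obtain ⟨u, hu, u', hu', h'⟩ := hz
  refine ⟨t * u, fun h => (Ideal.IsPrime.mem_or_mem ‹_› h).elim ht hu, t' * u',
    fun h => (Ideal.IsPrime.mem_or_mem ‹_› h).elim ht' hu', ?_⟩
  rw [map_mul, map_mul, mul_mul_mul_comm, h, h', smul_mul_smul_comm, zpow_add₀ hπ]

/-- If m > n, cross-multiplying the two relations and cancelling π^n exhibits a product of two
elements outside q as a multiple of π. -/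
theorem HasOrder.unique [q.IsPrime] [FaithfulSMul R F] (hπ : algebraMap R F π ≠ 0)
    (hq : algebraMap R _ π ∈ q) {z : F ⊗[k] E} {m n : ℤ}
    (hm : HasOrder π q z m) (hn : HasOrder π q z n) : m = n := by
  have key : ∀ {m n : ℤ}, HasOrder π q z m → HasOrder π q z n → m ≤ n := by
    rintro m n ⟨t, ht, t', ht', h⟩ ⟨u, hu, u', hu', h'⟩
    by_contra! hlt
    obtain ⟨d, rfl⟩ : ∃ d : ℕ, m = n + (d + 1 : ℕ) := ⟨(m - n - 1).toNat, by push_cast; omega⟩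
    have h1 : (algebraMap R F π) ^ n • orderIncl k F E (t * u') =
        (algebraMap R F π) ^ n • orderIncl k F E
          (algebraMap R _ π * (algebraMap R _ π ^ d * (u * t'))) := by
      have e1 : orderIncl k F E (t * u) * z =
          (algebraMap R F π) ^ n • orderIncl k F E (t * u') := by
        rw [map_mul, map_mul, mul_assoc, h', mul_smul_comm]
      have e2 : orderIncl k F E (t * u) * z = (algebraMap R F π) ^ (n + (d + 1 : ℕ)) •
          orderIncl k F E (u * t') := by
        rw [mul_comm t, map_mul, map_mul, mul_assoc, h, mul_smul_comm]
      rw [← e1, e2, zpow_add₀ hπ, mul_smul, zpow_natCast, ← mul_assoc, ← pow_succ',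
        orderIncl_pow_mul]
    have h2 := orderIncl_injective k F E (smul_right_injective _ (zpow_ne_zero n hπ) h1)
    have h3 : t * u' ∈ q := h2 ▸ Ideal.mul_mem_right _ _ hq
    exact (Ideal.IsPrime.mem_or_mem ‹_› h3).elim ht hu'
  exact le_antisymm (key hm hn) (key hn hm)

theorem HasOrder.map_galAct {z : F ⊗[k] E} {n : ℤ} {g : Gal(E/k)}
    (hg : ∀ s, galActOrder k E R g s ∈ q ↔ s ∈ q) (hz : HasOrder π q z n) :
    HasOrder π q (galAct F g z) n := by
  obtain ⟨t, ht, t', ht', h⟩ := hz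
  refine ⟨galActOrder k E R g t, by rwa [hg], galActOrder k E R g t', by rwa [hg], ?_⟩
  rw [orderIncl_galActOrder, orderIncl_galActOrder, ← map_mul, h, map_smul]

theorem hasOrder_zero {s : R ⊗[k] E} [q.IsPrime] (hs : s ∉ q) :
    HasOrder π q (orderIncl k F E s) 0 :=
  ⟨1, fun h => Ideal.IsPrime.ne_top ‹_› ((Ideal.eq_top_iff_one q).mpr h), s, hs, by simp⟩

/-- The exponent N bounds the order of s. If s lies in q, then up to a factor outside q it is π
times some s₁, and s₁ divides an element of the same form with exponent N - 1. -/
theorem exists_hasOrder_of_mul_eq [q.IsPrime] [FaithfulSMul R F] (hπ : algebraMap R F π ≠ 0)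
    (hq : ∀ s ∈ q, ∃ t ∉ q, ∃ s', t * s = algebraMap R _ π * s') (N : ℕ) :
    ∀ s s' t : R ⊗[k] E, t ∉ q → s * s' = t * algebraMap R _ π ^ N →
      ∃ n : ℤ, HasOrder π q (orderIncl k F E s) n := by
  induction N with
  | zero =>
    intro s s' t ht h
    refine ⟨0, hasOrder_zero fun hs => ht ?_⟩
    rw [pow_zero, mul_one] at h
    exact h ▸ Ideal.mul_mem_right _ _ hs
  | succ N ih =>
    intro s s' t ht h
    by_cases hs : s ∈ q
    · obtain ⟨t₁, ht₁, s₁, h₁⟩ := hq s hs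
      have hcancel : Function.Injective fun x : R ⊗[k] E => algebraMap R _ π * x := fun x y hxy => by
        have := congrArg (orderIncl k F E) hxy
        rw [← pow_one (algebraMap R _ π), orderIncl_pow_mul, orderIncl_pow_mul, pow_one] at this
        exact orderIncl_injective k F E (smul_right_injective _ hπ this)
      obtain ⟨n, t₂, ht₂, t₃, ht₃, h₂⟩ := ih s₁ s' (t₁ * t)
        (fun h => (Ideal.IsPrime.mem_or_mem ‹_› h).elim ht₁ ht) (hcancel (by
          change algebraMap R _ π * (s₁ * s') = algebraMap R _ π * (t₁ * t * algebraMap R _ π ^ N)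
          rw [← mul_assoc, ← h₁, mul_assoc, h, pow_succ]
          ring))
      refine ⟨n + 1, t₂ * t₁, fun h => (Ideal.IsPrime.mem_or_mem ‹_› h).elim ht₂ ht₁, t₃, ht₃, ?_⟩
      rw [map_mul, mul_assoc, ← map_mul, h₁, ← pow_one (algebraMap R _ π), orderIncl_pow_mul, pow_one,
        mul_smul_comm, h₂, smul_smul, zpow_add_one₀ hπ, mul_comm]
    · exact ⟨0, hasOrder_zero hs⟩

variable [IsDomain R] [IsDiscreteValuationRing R] [IsFractionRing R F]

theorem exists_pow_mul_mem (hπ : Irreducible π) (f : F) :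
    ∃ (N : ℕ) (r : R), (algebraMap R F π) ^ N * f = algebraMap R F r := by
  obtain ⟨a, b, hb, rfl⟩ := IsFractionRing.div_surjective (A := R) f
  have hb0 : b ≠ 0 := nonZeroDivisors.ne_zero hb
  obtain ⟨n, u, hu⟩ := IsDiscreteValuationRing.associated_pow_irreducible hb0 hπ
  refine ⟨n, u * a, ?_⟩
  have : algebraMap R F b ≠ 0 := by simpa using hb0
  rw [← map_pow, ← hu, map_mul, map_mul]
  field_simp

theorem exists_pow_smul_eq_orderIncl (hπ : Irreducible π) (z : F ⊗[k] E) :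
    ∃ (N : ℕ) (s : R ⊗[k] E), (algebraMap R F π) ^ N • z = orderIncl k F E s := by
  induction z with
  | zero => exact ⟨0, 0, by simp⟩
  | tmul f x =>
    obtain ⟨N, r, hr⟩ := exists_pow_mul_mem hπ f
    exact ⟨N, r ⊗ₜ x, by rw [TensorProduct.smul_tmul', smul_eq_mul, hr]; simp [orderIncl]⟩
  | add x y hx hy =>
    obtain ⟨M, s, hs⟩ := hx
    obtain ⟨N, t, ht⟩ := hy
    refine ⟨M + N, algebraMap R _ π ^ N * s + algebraMap R _ π ^ M * t, ?_⟩
    rw [smul_add, map_add, orderIncl_pow_mul, orderIncl_pow_mul, ← hs, ← ht, smul_smul, smul_smul,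
      ← pow_add, ← pow_add, add_comm N M]

theorem exists_hasOrder [q.IsPrime] (hπ : Irreducible π)
    (hq : ∀ s ∈ q, ∃ t ∉ q, ∃ s', t * s = algebraMap R _ π * s') (z : (F ⊗[k] E)ˣ) :
    ∃ n : ℤ, HasOrder π q (z : F ⊗[k] E) n := by
  have hπF : algebraMap R F π ≠ 0 := by simpa using hπ.ne_zero
  obtain ⟨M, s, hs⟩ := exists_pow_smul_eq_orderIncl (R := R) hπ (z : F ⊗[k] E)
  obtain ⟨N, s', hs'⟩ := exists_pow_smul_eq_orderIncl (R := R) hπ ((z⁻¹ : (F ⊗[k] E)ˣ) : F ⊗[k] E)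
  -- Clearing denominators in z and z⁻¹ gives elements of R ⊗ E whose product is a power of π.
  have h : s * s' = 1 * algebraMap R _ π ^ (M + N) := by
    apply orderIncl_injective k F E
    rw [map_mul, ← hs, ← hs', smul_mul_smul_comm, Units.mul_inv, one_mul,
      ← mul_one (algebraMap R _ π ^ (M + N)), orderIncl_pow_mul, map_one, pow_add]
  obtain ⟨n, t, ht, t', ht', h1⟩ := exists_hasOrder_of_mul_eq hπF hq (M + N) s s' 1
    (fun h => Ideal.IsPrime.ne_top ‹_› ((Ideal.eq_top_iff_one q).mpr h)) h
  refine ⟨n - M, t, ht, t', ht', ?_⟩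
  rw [← hs, mul_smul_comm] at h1
  rw [sub_eq_neg_add, zpow_add₀ hπF, mul_smul, ← h1, smul_smul, zpow_neg, zpow_natCast,
    inv_mul_cancel₀ (pow_ne_zero _ hπF), one_smul]

/-- The order at the prime `q` as a homomorphism on `(F ⊗ E)ˣ`. -/
theorem exists_order_hom [q.IsPrime] (hπ : Irreducible π) (hπq : algebraMap R _ π ∈ q)
    (hq : ∀ s ∈ q, ∃ t ∉ q, ∃ s', t * s = algebraMap R _ π * s') :
    ∃ w : (F ⊗[k] E)ˣ →* Multiplicative ℤ, ∀ z : (F ⊗[k] E)ˣ, ∀ n,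
      HasOrder π q (z : F ⊗[k] E) n ↔ w z = Multiplicative.ofAdd n := by
  have hπF : algebraMap R F π ≠ 0 := by simpa using hπ.ne_zero
  choose o ho using exists_hasOrder (F := F) hπ hq
  refine ⟨MonoidHom.mk' (fun z => Multiplicative.ofAdd (o z)) fun y z => ?_, fun z n =>
    ⟨fun h => ?_, fun h => ?_⟩⟩
  · rw [← ofAdd_add]
    exact congrArg _ ((ho (y * z)).unique hπF hπq ((ho y).mul hπF (ho z)))
  · exact congrArg Multiplicative.ofAdd ((ho z).unique hπF hπq h)
  · have : o z = n := Multiplicative.ofAdd.injective h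
    exact this ▸ ho z

end Valuation

/-! ### Decomposition groups and elements of prescribed order -/

section Decomposition

variable {k R F E : Type u} [Field k] [CommRing R] [Field F] [Field E]
  [Algebra k R] [Algebra R F] [Algebra k F] [IsScalarTower k R F] [Algebra k E]

/-- The decomposition group of a prime ideal of `R ⊗ E`. -/
def decompositionGroup (q : Ideal (R ⊗[k] E)) : Subgroup Gal(E/k) where
  carrier := {g | ∀ s, galActOrder k E R g s ∈ q ↔ s ∈ q}
  one_mem' := fun s => by rw [galActOrder_one]
  mul_mem' := fun {g h} hg hh s => by rw [galActOrder_mul, hg, hh]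
  inv_mem' := fun {g} hg s => by
    rw [← hg, ← galActOrder_mul, mul_inv_cancel, galActOrder_one]

/-- Prime avoidance: otherwise q is covered by the finitely many primes h⁻¹q with h outside the
decomposition group, hence lies in one of them. By maximality the two are equal, which puts h in the
group. -/
theorem exists_mem_forall_galActOrder_notMem [FiniteDimensional k E] (q : Ideal (R ⊗[k] E))
    [q.IsMaximal] :
    ∃ s ∈ q, ∀ h ∉ decompositionGroup q, galActOrder k E R h s ∉ q := by
  classical
  by_contra! hcon
  obtain ⟨h, hh, hle⟩ := (Ideal.subset_union_prime
    (s := {h : Gal(E/k) | h ∉ decompositionGroup q}.toFinite.toFinset)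
    (f := fun h => q.comap (galActOrder k E R h)) 1 1
    (fun h _ _ _ => Ideal.comap_isPrime _ q) (I := q)).mp (fun s hs => by
      obtain ⟨h, h1, h2⟩ := hcon s hs
      exact Set.mem_biUnion (by simpa using h1) h2)
  have hh' : h ∉ decompositionGroup q := by simpa using hh
  have heq := Ideal.IsMaximal.eq_of_le ‹_›
    (Ideal.IsPrime.ne_top (Ideal.comap_isPrime (galActOrder k E R h) q)) hle
  exact hh' fun s => by conv_rhs => rw [heq, Ideal.mem_comap]

section Tower

variable (K : Type u) [Field K] [Algebra k K] [Algebra K E] [IsScalarTower k K E]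

/-- The map `R ⊗ K → R ⊗ E`. -/
noncomputable def orderMap (R : Type u) [CommRing R] [Algebra k R] : R ⊗[k] K →ₐ[R] R ⊗[k] E :=
  Algebra.TensorProduct.map (AlgHom.id R R) (IsScalarTower.toAlgHom k K E)

theorem galActOrder_orderMap [Normal k K] (g : Gal(E/k)) (s : R ⊗[k] K) :
    galActOrder k E R g (orderMap (E := E) K R s) =
      orderMap K R (galActOrder k K R (AlgEquiv.restrictNormalHom K g) s) := by
  induction s with
  | zero => simp
  | tmul r x =>
    simp only [orderMap, Algebra.TensorProduct.map_tmul, galActOrder_tmul, AlgHom.id_apply,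
      IsScalarTower.coe_toAlgHom']
    exact congrArg _ (AlgEquiv.restrictNormal_commutes g K x).symm
  | add x y hx hy => simp only [map_add, hx, hy]

theorem mem_range_algebraMap_of_fixed [FiniteDimensional k E] [IsGalois k E] [IsGalois k K] (x : E)
    (hx : ∀ g ∈ (AlgEquiv.restrictNormalHom K : Gal(E/k) →* Gal(K/k)).ker, g x = x) :
    ∃ c : K, algebraMap K E c = x := by
  have : IsGalois K E := IsGalois.tower_top_of_isGalois k K E
  have : FiniteDimensional K E := FiniteDimensional.right k K E
  refine (IsGalois.mem_range_algebraMap_iff_fixed x).mpr fun g => ?_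
  refine hx (g.restrictScalars k) (AlgEquiv.ext fun c => (algebraMap K E).injective ?_)
  refine (AlgEquiv.restrictNormal_commutes _ K c).trans ?_
  simp

theorem coord_galActOrder {ι : Type*} [DecidableEq ι] (b : Module.Basis ι k R) (g : Gal(E/k))
    (s : R ⊗[k] E) (i : ι) :
    TensorProduct.equivFinsuppOfBasisLeft b (galActOrder k E R g s) i =
      g (TensorProduct.equivFinsuppOfBasisLeft b s i) := by
  induction s with
  | zero => simp
  | tmul f x => simp [galActOrder_tmul]
  | add x y hx hy => simp only [map_add, Finsupp.add_apply, hx, hy]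

/-- Galois descent in coordinates: with respect to a k-basis of R the coordinates of s are fixed by
Gal(E/K), hence lie in K. -/
theorem exists_orderMap_eq [FiniteDimensional k E] [IsGalois k E] [IsGalois k K] (s : R ⊗[k] E)
    (hs : ∀ g ∈ (AlgEquiv.restrictNormalHom K : Gal(E/k) →* Gal(K/k)).ker,
      galActOrder k E R g s = s) : ∃ y, orderMap K R y = s := by
  classical
  let b := Module.Free.chooseBasis k R
  have hc : ∀ i, ∃ c : K, algebraMap K E c = TensorProduct.equivFinsuppOfBasisLeft b s i :=
    fun i => mem_range_algebraMap_of_fixed K _ fun g hg => by rw [← coord_galActOrder, hs g hg]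
  choose c hc using hc
  refine ⟨(TensorProduct.equivFinsuppOfBasisLeft b s).sum fun i _ => b i ⊗ₜ c i, ?_⟩
  conv_rhs => rw [← (TensorProduct.equivFinsuppOfBasisLeft b).symm_apply_apply s]
  rw [TensorProduct.equivFinsuppOfBasisLeft_symm_apply, Finsupp.sum, Finsupp.sum, map_sum]
  exact Finset.sum_congr rfl fun i _ => by simp [orderMap, hc]

/-- Multiplication by -z has finitely many eigenvalues, while x has infinitely many distinct powers.
-/
theorem exists_isUnit_add_algebraMap_pow {A : Type*} [CommRing A] [Algebra F A]
    [FiniteDimensional F A] {x : F} (hx : Function.Injective fun n : ℕ => x ^ n) (z : A) (m : ℕ) :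
    ∃ n, IsUnit (z + algebraMap F A (x ^ (n + m))) := by
  by_contra! h
  have hfin : (spectrum F (Algebra.lmul F A (-z))).Finite := Module.End.finite_spectrum _
  refine Set.infinite_of_injective_forall_mem (f := fun n : ℕ => x ^ (n + m))
    (fun a b hab => add_right_cancel (hx hab)) (fun n => ?_) hfin
  intro hu
  refine h n (Algebra.lmul_isUnit_iff (R := F).mp ?_)
  have h1 : IsUnit (algebraMap F (Module.End F A) (x ^ (n + m)) - Algebra.lmul F A (-z)) := hu
  rwa [map_neg, sub_neg_eq_add, add_comm, ← (Algebra.lmul F A).commutes, ← map_add] at h1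

end Tower

variable {π : R} {q : Ideal (R ⊗[k] E)}

/-- If both z and z + π were divisible by π² at q, up to multiples of π², then so would be their
difference π. -/
theorem exists_sub_notMem [q.IsPrime] [FaithfulSMul R F] (hπ : algebraMap R F π ≠ 0)
    (hπq : algebraMap R _ π ∈ q) (z : R ⊗[k] E) :
    ∃ c : R, (c = 0 ∨ c = π) ∧ ∀ (d : R) (t s), t ∉ q →
      t * (z + algebraMap R _ (c + π ^ 2 * d)) ≠ algebraMap R _ π ^ 2 * s := by
  by_contra! h
  obtain ⟨d, t, s, ht, h1⟩ := h 0 (Or.inl rfl)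
  obtain ⟨d', t', s', ht', h2⟩ := h π (Or.inr rfl)
  have hcancel : Function.Injective fun x : R ⊗[k] E => algebraMap R _ π * x := fun x y hxy => by
    have := congrArg (orderIncl k F E) hxy
    rw [← pow_one (algebraMap R _ π), orderIncl_pow_mul, orderIncl_pow_mul, pow_one] at this
    exact orderIncl_injective k F E (smul_right_injective _ hπ this)
  simp only [map_add, map_mul, map_pow, map_zero] at h1 h2
  have h3 : t * t' = algebraMap R _ π *
      (t * s' - t' * s + t * t' * algebraMap R _ d - t * t' * algebraMap R _ d') := hcancel (by
    linear_combination t * h2 - t' * h1)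
  exact (Ideal.IsPrime.mem_or_mem ‹_› (h3 ▸ Ideal.mul_mem_right _ _ hπq)).elim ht ht'

theorem hasOrder_one [q.IsPrime] (hq : ∀ s ∈ q, ∃ t ∉ q, ∃ s', t * s = algebraMap R _ π * s')
    {s : R ⊗[k] E} (hs : s ∈ q) (h2 : ∀ t s', t ∉ q → t * s ≠ algebraMap R _ π ^ 2 * s') :
    HasOrder π q (orderIncl k F E s) 1 := by
  obtain ⟨t, ht, s', h⟩ := hq s hs
  refine ⟨t, ht, s', fun hs' => ?_, ?_⟩
  · obtain ⟨t', ht', s'', h'⟩ := hq s' hs'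
    refine h2 (t' * t) s'' (fun h => (Ideal.IsPrime.mem_or_mem ‹_› h).elim ht' ht) ?_
    rw [mul_assoc, h, mul_left_comm, h', pow_two, mul_assoc]
  · rw [← map_mul, h, zpow_one, ← pow_one (algebraMap R _ π), orderIncl_pow_mul, pow_one]

end Decomposition

section Decomposition

/-- The norm `(F ⊗ M)ˣ → Fˣ`. -/
noncomputable def normUnits {k : Type*} (F : Type*) [Field k] [Field F] [Algebra k F] {M : Type*}
    [CommRing M] [Algebra k M] : (F ⊗[k] M)ˣ →* Fˣ :=
  Units.map (Algebra.norm F)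

variable {k R F E : Type u} [Field k] [CommRing R] [Field F] [Field E]
  [Algebra k R] [Algebra R F] [Algebra k F] [IsScalarTower k R F] [Algebra k E]
  [IsDomain R] [IsDiscreteValuationRing R] [IsFractionRing R F]
  {π : R} {q : Ideal (R ⊗[k] E)}

theorem hasOrder_algebraMap_unit [q.IsPrime] (n : ℤ) (r : Rˣ) :
    HasOrder π q (algebraMap F (F ⊗[k] E) ((algebraMap R F π) ^ n * algebraMap R F r)) n := by
  refine ⟨1, fun h => Ideal.IsPrime.ne_top ‹_› ((Ideal.eq_top_iff_one q).mpr h),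
    algebraMap R _ r, fun h => Ideal.IsPrime.ne_top ‹_›
      (Ideal.eq_top_of_isUnit_mem _ h (r.isUnit.map _)), ?_⟩
  rw [map_one, one_mul, orderIncl_algebraMap, map_mul, Algebra.smul_def]

theorem exists_eq_zpow_mul_unit (hπ : Irreducible π) {f : F} (hf : f ≠ 0) :
    ∃ (n : ℤ) (r : Rˣ), f = (algebraMap R F π) ^ n * algebraMap R F r := by
  have hπF : algebraMap R F π ≠ 0 := by simpa using hπ.ne_zero
  obtain ⟨N, r, hr⟩ := exists_pow_mul_mem hπ f
  have hr0 : r ≠ 0 := by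
    rintro rfl
    rw [map_zero] at hr
    exact mul_ne_zero (pow_ne_zero N hπF) hf hr
  obtain ⟨m, u, hu⟩ := IsDiscreteValuationRing.eq_unit_mul_pow_irreducible hr0 hπ
  refine ⟨m - N, u, ?_⟩
  apply mul_left_cancel₀ (pow_ne_zero N hπF)
  rw [hr, hu, ← mul_assoc, ← zpow_natCast (algebraMap R F π) N, ← zpow_add₀ hπF,
    add_sub_cancel, zpow_natCast, map_mul, map_pow, mul_comm]

section Tower

variable (K : Type u) [Field K] [Algebra k K] [Algebra K E] [IsScalarTower k K E]

/-- Let s ∈ q avoid h⁻¹q for all h outside the decomposition group D. The product of its conjugates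
under Gal(E/K) descends to some z over K, and gz lies in q exactly if the restriction of g to K
comes from D. Adding an element of (π) to z keeps this, and is used to make the order exactly 1 and
the element invertible over F. -/
theorem exists_orders [FiniteDimensional k E] [IsGalois k E] [FiniteDimensional k K] [IsGalois k K]
    [q.IsMaximal] (hπ : Irreducible π) (hπq : algebraMap R _ π ∈ q)
    (hq : ∀ s ∈ q, ∃ t ∉ q, ∃ s', t * s = algebraMap R _ π * s') :
    ∃ y : R ⊗[k] K, IsUnit (orderIncl k F K y) ∧
      (∀ g : Gal(E/k), AlgEquiv.restrictNormalHom K g ∈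
          (decompositionGroup q).map (AlgEquiv.restrictNormalHom K) →
        HasOrder π q (orderIncl k F E (galActOrder k E R g (orderMap K R y))) 1) ∧
      ∀ g : Gal(E/k), AlgEquiv.restrictNormalHom K g ∉
          (decompositionGroup q).map (AlgEquiv.restrictNormalHom K) →
        HasOrder π q (orderIncl k F E (galActOrder k E R g (orderMap K R y))) 0 := by
  classical
  have hπF : algebraMap R F π ≠ 0 := by simpa using hπ.ne_zero
  let res : Gal(E/k) →* Gal(K/k) := AlgEquiv.restrictNormalHom K
  obtain ⟨s, hs, hs'⟩ := exists_mem_forall_galActOrder_notMem q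
  let N : Finset Gal(E/k) := (res.ker : Set Gal(E/k)).toFinite.toFinset
  have hN : ∀ h, h ∈ N ↔ res h = 1 := fun h => by simp [N]
  have hgal : ∀ g : Gal(E/k), galActOrder k E R g (∏ h ∈ N, galActOrder k E R h s) =
      ∏ h ∈ N, galActOrder k E R (g * h) s := fun g => by
    rw [map_prod]
    exact Finset.prod_congr rfl fun h _ => (galActOrder_mul g h s).symm
  obtain ⟨z, hz⟩ := exists_orderMap_eq K (∏ h ∈ N, galActOrder k E R h s) fun g hg => by
    rw [hgal]
    refine Finset.prod_equiv (Equiv.mulLeft g) (fun h => ?_) fun h _ => rfl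
    rw [hN, hN, Equiv.coe_mulLeft, map_mul, MonoidHom.mem_ker.mp hg, one_mul]
  obtain ⟨c, hc, hc2⟩ := exists_sub_notMem (F := F) hπF hπq (orderMap K R z)
  have hinj : Function.Injective fun n : ℕ => algebraMap R F π ^ n := fun a b hab => by
    refine IsDiscreteValuationRing.unit_mul_pow_congr_pow (R := R) hπ hπ 1 1 a b ?_
    rw [Units.val_one, one_mul, one_mul]
    apply FaithfulSMul.algebraMap_injective R F
    rw [map_pow, map_pow]
    exact hab
  -- The correction π^(n+2) achieves invertibility; as a multiple of π² it does not disturb the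
  -- order 1 secured by c.
  obtain ⟨n, hn⟩ := exists_isUnit_add_algebraMap_pow hinj
    (orderIncl k F K (z + algebraMap R _ c)) 2
  have hcq : algebraMap R (R ⊗[k] E) (c + π ^ (n + 2)) ∈ q := by
    rw [map_add, map_pow, pow_succ]
    refine add_mem ?_ (Ideal.mul_mem_left _ _ hπq)
    rcases hc with rfl | rfl
    · rw [map_zero]
      exact zero_mem q
    · exact hπq
  have hmap : ∀ g : Gal(E/k),
      galActOrder k E R g (orderMap K R (z + algebraMap R _ (c + π ^ (n + 2)))) =
      (∏ h ∈ N, galActOrder k E R (g * h) s) + algebraMap R _ (c + π ^ (n + 2)) := fun g => by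
    rw [map_add, map_add, AlgHom.commutes, AlgHom.commutes, hz, hgal]
  refine ⟨z + algebraMap R _ (c + π ^ (n + 2)), ?_, fun g hg => ?_, fun g hg => ?_⟩
  · rwa [← map_pow, ← orderIncl_algebraMap k F K, ← map_add, add_assoc, ← map_add] at hn
  · obtain ⟨h, hh, hhg⟩ := hg
    rw [galActOrder_orderMap, ← hhg, ← galActOrder_orderMap, orderIncl_galActOrder]
    refine HasOrder.map_galAct hh (hasOrder_one hq ?_ fun t s' ht => ?_)
    · have := hmap 1
      rw [galActOrder_one] at this
      rw [this]
      refine add_mem (Ideal.mem_of_dvd q (Finset.dvd_prod_of_mem _ ((hN 1).mpr (map_one res))) ?_) hcq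
      rwa [mul_one, galActOrder_one]
    · have := hc2 (π ^ n) t s' ht
      rwa [← pow_add, add_comm 2 n, ← AlgHom.commutes (orderMap K R), ← map_add] at this
  · refine hasOrder_zero fun hmem => ?_
    -- A factor (gh)s in q with h trivial on K would force gh ∈ D, and gh has the same restriction
    -- to K as g.
    rw [hmap, Ideal.add_mem_iff_left _ hcq] at hmem
    obtain ⟨h, hh, hgh⟩ := (Ideal.IsPrime.prod_mem_iff).mp hmem
    refine hg ⟨g * h, ?_, ?_⟩
    · by_contra hcon
      exact hs' _ hcon hgh
    · change res (g * h) = res g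
      rw [map_mul, (hN h).mp hh, mul_one]

variable (k R F E) in
/-- There is a valuation `w` of `F ⊗ E` extending that of `R`, invariant under some `g` in the Galois group,
and such that some norm from `F ⊗ K` has order the order of the restriction of `g` to `K`. -/
theorem exists_invariant_order_hom [FiniteDimensional k E] [IsGalois k E] [FiniteDimensional k K]
    [IsGalois k K] [IsCyclic Gal(K/k)] :
    ∃ (g : Gal(E/k)) (w : (F ⊗[k] E)ˣ →* Multiplicative ℤ),
      (∀ f : Fˣ, w (Units.map (algebraMap F (F ⊗[k] E)).toMonoidHom f) = 1 ↔
        ∃ r : Rˣ, algebraMap R F r = f) ∧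
      (∀ z, w (Units.map (galAct F g).toMonoidHom z) = w z) ∧
      ∃ x : (F ⊗[k] K)ˣ, w (Units.map (algebraMap F (F ⊗[k] E)).toMonoidHom
        (normUnits F x)) =
          Multiplicative.ofAdd (orderOf (AlgEquiv.restrictNormalHom K g : Gal(K/k)) : ℤ) := by
  classical
  obtain ⟨π, hπ⟩ := IsDiscreteValuationRing.exists_irreducible R
  have hπF : algebraMap R F π ≠ 0 := by simpa using hπ.ne_zero
  obtain ⟨q, hqm, hπq, hq⟩ := exists_unramified_prime k E hπ
  obtain ⟨w, hw⟩ := exists_order_hom (F := F) hπ hπq hq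
  obtain ⟨y, ⟨x, hx⟩, hy1, hy0⟩ := exists_orders (F := F) K hπ hπq hq
  let res : Gal(E/k) →* Gal(K/k) := AlgEquiv.restrictNormalHom K
  -- The decomposition group itself need not be cyclic; only its image in the cyclic group Gal(K/k)
  -- is used, and g lifts a generator of that image.
  obtain ⟨⟨_, g, hg, rfl⟩, hgen⟩ :=
    IsCyclic.exists_generator (α := (decompositionGroup q).map res)
  have hmem : ∀ σ : Gal(K/k), σ ∈ (decompositionGroup q).map res ↔
      σ ∈ Subgroup.zpowers (res g) := fun σ => by
    refine ⟨fun h => ?_, fun h => ?_⟩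
    · obtain ⟨m, hm⟩ := hgen ⟨σ, h⟩
      exact ⟨m, congrArg Subtype.val hm⟩
    · exact (Subgroup.zpowers_le.mpr (Subgroup.mem_map_of_mem res hg)) h
  refine ⟨g, w, fun f => ?_, fun z => ?_, x, ?_⟩
  · obtain ⟨n, r, hr⟩ := exists_eq_zpow_mul_unit hπ f.ne_zero
    have h1 : w (Units.map (algebraMap F (F ⊗[k] E)).toMonoidHom f) = Multiplicative.ofAdd n := by
      refine (hw _ n).mp ?_
      change HasOrder π q (algebraMap F (F ⊗[k] E) f) n
      rw [hr]
      exact hasOrder_algebraMap_unit n r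
    rw [h1]
    refine ⟨fun h => ?_, ?_⟩
    · obtain rfl : n = 0 := Multiplicative.ofAdd.injective h
      exact ⟨r, by rw [hr, zpow_zero, one_mul]⟩
    · rintro ⟨r', hr'⟩
      rw [← h1]
      refine (hw _ 0).mp ?_
      change HasOrder π q (algebraMap F (F ⊗[k] E) f) 0
      rw [← hr', ← one_mul (algebraMap R F r'), ← zpow_zero (algebraMap R F π)]
      exact hasOrder_algebraMap_unit 0 r'
  · have := (hw z _).mpr rfl
    exact (hw _ _).mp (this.map_galAct hg)
  · obtain ⟨β⟩ := exists_basis_gal k K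
    have hsurj : Function.Surjective res := AlgEquiv.restrictNormalHom_surjective E
    choose l hl using hsurj
    let τ : Gal(K/k) → K →ₐ[k] E := fun σ => (IsScalarTower.toAlgHom k K E).comp (σ : K →ₐ[k] K)
    have hτ : Function.Injective τ := fun σ σ' h => AlgEquiv.ext fun c =>
      (algebraMap K E).injective (DFunLike.congr_fun h c)
    let v : Gal(K/k) → (F ⊗[k] E)ˣ := fun σ =>
      Units.map (Algebra.TensorProduct.map (AlgHom.id F F) (τ σ)).toMonoidHom x
    have hv : ∀ σ, ((v σ : (F ⊗[k] E)ˣ) : F ⊗[k] E) =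
        orderIncl k F E (galActOrder k E R (l σ) (orderMap K R y)) := fun σ => by
      have key : ∀ y : R ⊗[k] K,
          Algebra.TensorProduct.map (AlgHom.id F F) (τ σ) (orderIncl k F K y) =
          orderIncl k F E (galActOrder k E R (l σ) (orderMap K R y)) := fun y => by
        rw [galActOrder_orderMap]
        change _ = orderIncl k F E (orderMap K R (galActOrder k K R (res (l σ)) y))
        rw [hl]
        induction y with
        | zero => simp
        | tmul r c => simp [orderIncl, galActOrder_tmul, orderMap, τ]
        | add y z hy hz => simp only [map_add, hy, hz]
      refine Eq.trans ?_ (key y)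
      rw [← hx]
      rfl
    -- A conjugate of x has order 1 or 0 according to whether σ lies in the subgroup generated by
    -- the restriction of g. The order of the norm therefore counts that subgroup.
    have hwv : ∀ σ, w (v σ) = Multiplicative.ofAdd
        (if σ ∈ Subgroup.zpowers (res g) then 1 else 0 : ℤ) := fun σ => by
      refine (hw _ _).mp ?_
      rw [hv]
      split_ifs with h
      · exact hy1 _ (by rwa [← hmem, ← hl σ] at h)
      · exact hy0 _ (by rwa [← hmem, ← hl σ] at h)
    have hprod : Units.map (algebraMap F (F ⊗[k] E)).toMonoidHom (normUnits F x) =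
        ∏ σ, v σ := Units.ext (by
      rw [Units.coe_prod]
      exact norm_tmul_one F hτ β _)
    rw [hprod, map_prod, Finset.prod_congr rfl fun σ _ => hwv σ, ← ofAdd_sum, Finset.sum_boole,
      ← Nat.card_zpowers, Nat.card_eq_fintype_card, Fintype.card_subtype]

end Tower

end Decomposition

/-! ### Orders of norms and orbits on embeddings -/

section Periods

/-- On each orbit φ is constant, and the length of the orbit is a period of its points, hence a
multiple of d. -/
theorem dvd_sum_of_dvd_periods {α : Type*} [Fintype α] (ρ : Equiv.Perm α) (φ : α → ℤ)
    (hφ : ∀ a, φ (ρ a) = φ a) (d : ℕ) (hd : ∀ (a : α) (r : ℕ), (ρ ^ r) a = a → d ∣ r) :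
    (d : ℤ) ∣ ∑ a, φ a := by
  classical
  rw [Finset.sum_partition (MulAction.orbitRel (Subgroup.zpowers ρ) α)]
  refine Finset.dvd_sum fun o _ => ?_
  induction o using Quotient.inductionOn with
  | h a =>
  have hmem : ∀ y, (Quotient.mk (MulAction.orbitRel (Subgroup.zpowers ρ) α) y = ⟦a⟧) ↔
      y ∈ MulAction.orbit (Subgroup.zpowers ρ) a := fun y => by
    rw [Quotient.eq, MulAction.orbitRel_apply]
  have hconst : ∀ σ ∈ Subgroup.zpowers ρ, ∀ x, φ (σ x) = φ x := by
    intro σ hσ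
    obtain ⟨r, rfl⟩ := (mem_powers_iff_mem_zpowers (x := ρ)).mpr hσ
    intro x
    induction r with
    | zero => rfl
    | succ r ih =>
      change φ ((ρ ^ (r + 1)) x) = φ x
      rw [pow_succ', Equiv.Perm.mul_apply, hφ]
      exact ih ⟨r, rfl⟩
  rw [Finset.sum_congr rfl (g := fun _ => φ a) fun y hy => ?_, Finset.sum_const, nsmul_eq_mul]
  · refine Dvd.dvd.mul_right (Int.natCast_dvd_natCast.mpr ?_) _
    have hcard := MulAction.minimalPeriod_eq_card ρ a
    rw [Finset.filter_congr fun y _ => hmem y, ← Fintype.card_subtype]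
    refine (hd a _ ?_).trans (dvd_of_eq (hcard.trans (Fintype.card_congr (Equiv.refl _))))
    have := Function.isPeriodicPt_minimalPeriod (ρ • ·) a
    rw [Function.IsPeriodicPt, Function.IsFixedPt, smul_iterate] at this
    exact this
  · obtain ⟨⟨σ, hσ⟩, rfl⟩ := (hmem y).mp (Finset.mem_filter.mp hy).2
    exact hconst σ hσ a

variable {k F E : Type u} [Field k] [Field F] [Field E] [Algebra k F] [Algebra k E]

/-- The unit `f ⊗ 1` of `F ⊗ E`. -/
noncomputable def baseUnit (k E : Type u) [Field k] [Algebra k F] [Field E] [Algebra k E] :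
    Fˣ →* (F ⊗[k] E)ˣ :=
  Units.map (algebraMap F (F ⊗[k] E)).toMonoidHom

/-- The map on units of `F ⊗ M → F ⊗ N` induced by `τ : M → N`. -/
noncomputable def embUnit (F : Type u) [Field F] [Algebra k F] {M N : Type*} [CommRing M]
    [Algebra k M] [CommRing N] [Algebra k N] (τ : M →ₐ[k] N) : (F ⊗[k] M)ˣ →* (F ⊗[k] N)ˣ :=
  Units.map (Algebra.TensorProduct.map (AlgHom.id F F) τ).toMonoidHom

theorem embUnit_comp {M N P : Type*} [CommRing M] [Algebra k M] [CommRing N] [Algebra k N]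
    [CommRing P] [Algebra k P] (σ : N →ₐ[k] P) (τ : M →ₐ[k] N) (y : (F ⊗[k] M)ˣ) :
    embUnit F (σ.comp τ) y = embUnit F σ (embUnit F τ y) := by
  refine Units.ext ?_
  change Algebra.TensorProduct.map (AlgHom.id F F) (σ.comp τ) y =
    Algebra.TensorProduct.map (AlgHom.id F F) σ (Algebra.TensorProduct.map (AlgHom.id F F) τ y)
  rw [← AlgHom.comp_apply, ← Algebra.TensorProduct.map_comp, AlgHom.comp_id]

theorem baseUnit_norm {M : Type*} [CommRing M] [Algebra k M] {J : Type*} [Fintype J]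
    [FiniteDimensional k M] {τ : J → M →ₐ[k] E} (hτ : Function.Injective τ)
    (hcard : Fintype.card J = Module.finrank k M) (y : (F ⊗[k] M)ˣ) :
    baseUnit k E (normUnits F y) = ∏ j, embUnit F (τ j) y := by
  classical
  have β : Module.Basis J k M := (Module.finBasis k M).reindex (Fintype.equivFinOfCardEq hcard).symm
  refine Units.ext ?_
  rw [Units.coe_prod]
  exact norm_tmul_one F hτ β _

theorem galAct_embUnit {M : Type*} [CommRing M] [Algebra k M] (g : Gal(E/k)) (τ : M →ₐ[k] E)
    (y : (F ⊗[k] M)ˣ) :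
    Units.map (galAct F g).toMonoidHom (embUnit F τ y) =
      embUnit F ((g : E →ₐ[k] E).comp τ) y :=
  (embUnit_comp _ _ _).symm

/-- If `d` divides the lengths of the orbits of `g` on the embeddings of `M`, then it divides the order
of all norms from `F ⊗ M`. -/
theorem dvd_order_norm {M : Type*} [CommRing M] [Algebra k M] [FiniteDimensional k M]
    [Fintype (M →ₐ[k] E)] (hcard : Fintype.card (M →ₐ[k] E) = Module.finrank k M)
    (g : Gal(E/k)) (w : (F ⊗[k] E)ˣ →* Multiplicative ℤ)
    (hw : ∀ z, w (Units.map (galAct F g).toMonoidHom z) = w z) (d : ℕ)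
    (hd : ∀ (τ : M →ₐ[k] E) (r : ℕ), ((g ^ r : Gal(E/k)) : E →ₐ[k] E).comp τ = τ → d ∣ r)
    (y : (F ⊗[k] M)ˣ) :
    (d : ℤ) ∣ Multiplicative.toAdd (w (baseUnit k E (normUnits F y))) := by
  rw [baseUnit_norm Function.injective_id hcard, map_prod, toAdd_prod]
  let ρ : Equiv.Perm (M →ₐ[k] E) := AlgEquiv.arrowCongr AlgEquiv.refl g
  have hρ : ∀ τ, ρ τ = (g : E →ₐ[k] E).comp τ := fun τ => rfl
  refine dvd_sum_of_dvd_periods ρ _ (fun τ => ?_) d fun τ r hr => hd τ r ?_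
  · rw [hρ, id, ← galAct_embUnit, hw]
    rfl
  · have hpow : ∀ r : ℕ, (ρ ^ r) τ = ((g ^ r : Gal(E/k)) : E →ₐ[k] E).comp τ := fun r => by
      induction r with
      | zero => rfl
      | succ r ih =>
        rw [pow_succ', Equiv.Perm.mul_apply, ih, hρ, pow_succ']
        rfl
    rw [← hpow, hr]

/-- The embeddings of the factors, composed with the projections, are distinct homomorphisms on the
product algebra and as many as its dimension. The product formula for the norm therefore applies
although the algebra is not a field. -/
theorem map_norm_prod {K : Type*} [Field K] [Algebra k K] [FiniteDimensional k K] {I : Type*}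
    [Fintype I] {M : I → Type*} [∀ i, Field (M i)] [∀ i, Algebra k (M i)]
    [∀ i, FiniteDimensional k (M i)] [Fintype (K →ₐ[k] E)] [∀ i, Fintype (M i →ₐ[k] E)]
    (hK : Fintype.card (K →ₐ[k] E) = Module.finrank k K)
    (hM : ∀ i, Fintype.card (M i →ₐ[k] E) = Module.finrank k (M i))
    (y : (F ⊗[k] (K × ∀ i, M i))ˣ) :
    baseUnit k E (normUnits F y) =
      baseUnit k E (normUnits F
        (embUnit F (AlgHom.fst k K (∀ i, M i)) y)) *
      ∏ i, baseUnit k E (normUnits F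
        (embUnit F ((Pi.evalAlgHom k (fun i => M i) i).comp (AlgHom.snd k K (∀ i, M i))) y)) := by
  classical
  let τ : (K →ₐ[k] E) ⊕ (Σ i, M i →ₐ[k] E) → (K × ∀ i, M i) →ₐ[k] E :=
    Sum.elim (fun σ => σ.comp (AlgHom.fst k K (∀ i, M i)))
      fun σ => σ.2.comp ((Pi.evalAlgHom k (fun i => M i) σ.1).comp (AlgHom.snd k K (∀ i, M i)))
  have hτ : Function.Injective τ := by
    rintro (σ | ⟨i, σ⟩) (σ' | ⟨j, σ'⟩) h
    · exact congrArg Sum.inl (AlgHom.ext fun x => by simpa [τ] using DFunLike.congr_fun h (x, 0))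
    · simpa [τ] using DFunLike.congr_fun h (1, 0)
    · simpa [τ] using DFunLike.congr_fun h (1, 0)
    · obtain rfl : i = j := by
        by_contra hij
        simpa [τ, Pi.single_eq_of_ne (Ne.symm hij)] using
          DFunLike.congr_fun h (0, Pi.single i 1)
      obtain rfl : σ = σ' := AlgHom.ext fun x => by
        simpa [τ] using DFunLike.congr_fun h (0, Pi.single i x)
      rfl
  have hcard : Fintype.card ((K →ₐ[k] E) ⊕ (Σ i, M i →ₐ[k] E)) =
      Module.finrank k (K × ∀ i, M i) := by
    rw [Fintype.card_sum, Fintype.card_sigma, Module.finrank_prod, Module.finrank_pi_fintype, hK]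
    simp only [hM]
  rw [baseUnit_norm hτ hcard, Fintype.prod_sum_type, Fintype.prod_sigma,
    baseUnit_norm Function.injective_id hK]
  congr 1
  · exact Finset.prod_congr rfl fun σ _ => embUnit_comp _ _ _
  · refine Finset.prod_congr rfl fun i _ => ?_
    rw [baseUnit_norm Function.injective_id (hM i)]
    exact Finset.prod_congr rfl fun σ _ => embUnit_comp _ _ _

end Periods

/-! ### Subfields of `K`, the sets `Γ_i^m` and the exponents `e_i` -/

section Galois

open IntermediateField

variable {k E : Type*} [Field k] [Field E] [Algebra k E]

theorem mem_fixingSubgroup_iff_le (h : Gal(E/k)) (A : IntermediateField k E) :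
    h ∈ A.fixingSubgroup ↔ A ≤ fixedField (Subgroup.zpowers h) := by
  rw [IntermediateField.le_iff_le, Subgroup.zpowers_le]

theorem subfieldOfDegree_finrank (K : IntermediateField k E) [FiniteDimensional k K] :
    subfieldOfDegree K (Module.finrank k K) = K :=
  le_antisymm (sSup_le fun _ hM => hM.1) (le_sSup ⟨le_rfl, rfl⟩)

theorem factorField_finrank (K Ki : IntermediateField k E) [FiniteDimensional k K] {p n : ℕ}
    (hn : Module.finrank k K = p ^ n) : factorField p K Ki n = K ⊔ Ki := by
  rw [factorField, ← hn, subfieldOfDegree_finrank]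

theorem finrank_lift {K : IntermediateField k E} (M : IntermediateField k K) :
    Module.finrank k (lift M) = Module.finrank k M :=
  (liftAlgEquiv M).toLinearEquiv.finrank_eq.symm

theorem mem_fixingSubgroup_lift {K : IntermediateField k E} [Normal k K] (M : IntermediateField k K)
    (h : Gal(E/k)) :
    h ∈ (lift M).fixingSubgroup ↔ AlgEquiv.restrictNormalHom K h ∈ M.fixingSubgroup := by
  rw [IntermediateField.mem_fixingSubgroup_iff, IntermediateField.mem_fixingSubgroup_iff]
  have hres : ∀ x : K, ((AlgEquiv.restrictNormalHom K h x : K) : E) = h x :=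
    AlgEquiv.restrictNormal_commutes h K
  refine ⟨fun H x hx => Subtype.ext ((hres x).trans (H _ ((mem_lift x).mpr hx))), fun H x hx => ?_⟩
  have hxK : x ∈ K := lift_le M hx
  have := congrArg Subtype.val (H ⟨x, hxK⟩ ((mem_lift (⟨x, hxK⟩ : K)).mp hx))
  exact (hres ⟨x, hxK⟩).symm.trans this

/-- A cyclic group has at most d solutions of x^d = 1, and a subgroup of order d already provides
them all. -/
theorem mem_of_orderOf_eq_card {G : Type*} [Group G] [IsCyclic G] [Finite G] {g : G} {U : Subgroup G}
    (h : orderOf g = Nat.card U) : g ∈ U := by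
  classical
  have := Fintype.ofFinite G
  have hpos : 0 < orderOf g := orderOf_pos g
  have hsub : (U : Set G).toFinset ⊆ Finset.univ.filter fun x : G => x ^ orderOf g = 1 := fun x hx => by
    rw [Finset.mem_filter, h]
    exact ⟨Finset.mem_univ _, congrArg Subtype.val
      (pow_card_eq_one' (x := (⟨x, by simpa using hx⟩ : U)))⟩
  have heq := Finset.eq_of_subset_of_card_le hsub
    ((IsCyclic.card_pow_eq_one_le hpos).trans (by
      rw [h, Set.toFinset_card, Nat.card_eq_fintype_card]
      exact le_of_eq (Fintype.card_congr (Equiv.refl _))))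
  have : g ∈ (U : Set G).toFinset := by
    rw [heq, Finset.mem_filter]
    exact ⟨Finset.mem_univ _, pow_orderOf_eq_one g⟩
  simpa using this

variable {K : IntermediateField k E} [FiniteDimensional k K] [IsGalois k K] [IsCyclic Gal(K/k)]
  (Ki : IntermediateField k E) {p n m : ℕ} {h : Gal(E/k)}

/-- If M ⊆ K has degree p^{n-m}, then Gal(K/M) has order p^m, and in a cyclic group it contains
every element of that order. -/
theorem mem_fixingSubgroup_factorField (hp : p.Prime) (hn : Module.finrank k K = p ^ n) (hmn : m ≤ n)
    (hKi : h ∈ Ki.fixingSubgroup)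
    (hm : orderOf (AlgEquiv.restrictNormalHom K h : Gal(K/k)) = p ^ m) :
    h ∈ (factorField p K Ki (n - m)).fixingSubgroup := by
  rw [mem_fixingSubgroup_iff_le] at hKi ⊢
  refine sup_le (sSup_le fun M hM => ?_) hKi
  obtain ⟨hMK, hMd⟩ := hM
  rw [← mem_fixingSubgroup_iff_le, ← lift_restrict hMK, mem_fixingSubgroup_lift]
  refine mem_of_orderOf_eq_card ?_
  rw [hm, IsGalois.card_fixingSubgroup_eq_finrank]
  have h1 := Module.finrank_mul_finrank k (restrict hMK) K
  rw [← finrank_lift, lift_restrict, hMd, hn, ← Nat.sub_add_cancel hmn, pow_add,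
    Nat.add_sub_cancel] at h1
  exact (Nat.eq_of_mul_eq_mul_left (pow_pos hp.pos _) h1).symm

/-- Let σ be the restriction of h. The fixed field of σ^p has degree p^{n-m+1}, and σ acts on it
nontrivially since its order p^m does not divide p^{m-1}. -/
theorem notMem_fixingSubgroup_factorField (hp : p.Prime) (hn : Module.finrank k K = p ^ n)
    (hmn : m ≤ n) (hm0 : 1 ≤ m)
    (hm : orderOf (AlgEquiv.restrictNormalHom K h : Gal(K/k)) = p ^ m) :
    h ∉ (factorField p K Ki (n - m + 1)).fixingSubgroup := by
  intro hcon
  let σ : Gal(K/k) := AlgEquiv.restrictNormalHom K h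
  let U : Subgroup Gal(K/k) := Subgroup.zpowers (σ ^ p)
  have hU : Nat.card U = p ^ (m - 1) := by
    rw [Nat.card_zpowers, orderOf_pow_of_dvd hp.ne_zero (hm ▸ dvd_pow_self p (by omega)), hm]
    conv_lhs => rw [← Nat.sub_add_cancel hm0, pow_succ, Nat.mul_div_cancel _ hp.pos]
  have hM : lift (fixedField U) ≤ subfieldOfDegree K (p ^ (n - m + 1)) := by
    refine le_sSup ⟨lift_le _, ?_⟩
    have h1 := Module.finrank_mul_finrank k (fixedField U) K
    rw [finrank_fixedField_eq_card, hU, hn] at h1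
    rw [finrank_lift]
    refine Nat.eq_of_mul_eq_mul_right (pow_pos hp.pos (m - 1)) (h1.trans ?_)
    rw [← pow_add]
    congr 1
    omega
  rw [mem_fixingSubgroup_iff_le] at hcon
  have h2 := (hM.trans le_sup_left).trans hcon
  rw [← mem_fixingSubgroup_iff_le, mem_fixingSubgroup_lift, fixingSubgroup_fixedField] at h2
  have h3 := orderOf_dvd_natCard (⟨σ, h2⟩ : U)
  rw [Subgroup.orderOf_mk, hU, hm, Nat.pow_dvd_pow_iff_le_right hp.one_lt] at h3
  omega

/-- Powers of h that differ on K give different B-embeddings of A, and there are at most [A : B] of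
these. -/
theorem orderOf_le_relfinrank {A B : IntermediateField k E} (hBA : B ≤ A)
    (hKA : K ≤ A)     [FiniteDimensional k A] (hB : h ∈ B.fixingSubgroup) :
    orderOf (AlgEquiv.restrictNormalHom K h : Gal(K/k)) ≤ relfinrank B A := by
  rw [relfinrank_eq_finrank_of_le hBA]
  let h' : Gal(E/B) := fixingSubgroupEquiv B ⟨h, hB⟩
  have hh' : ∀ (j : ℕ) (x : E), (h' ^ j) x = (h ^ j) x := fun j x => by
    induction j generalizing x with
    | zero => rfl
    | succ j ih =>
      rw [pow_succ, pow_succ, AlgEquiv.mul_apply, AlgEquiv.mul_apply, ih]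
      rfl
  let f : Fin (orderOf (AlgEquiv.restrictNormalHom K h : Gal(K/k))) → (extendScalars hBA →ₐ[B] E) :=
    fun j => ((h' ^ (j : ℕ) : Gal(E/B)) : E →ₐ[B] E).comp (extendScalars hBA).val
  have hf : Function.Injective f := fun i j hij => by
    refine Fin.ext (pow_injOn_Iio_orderOf i.2 j.2 ?_)
    refine AlgEquiv.ext fun x => Subtype.ext ?_
    have h1 := DFunLike.congr_fun hij ⟨(x : E), hKA x.2⟩
    have h2 : (h ^ (i : ℕ)) (x : E) = (h ^ (j : ℕ)) (x : E) := by
      rw [← hh', ← hh']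
      exact h1
    change ((AlgEquiv.restrictNormalHom K h ^ (i : ℕ)) x : E) =
      ((AlgEquiv.restrictNormalHom K h ^ (j : ℕ)) x : E)
    rw [← map_pow, ← map_pow]
    exact (AlgEquiv.restrictNormal_commutes (h ^ (i : ℕ)) K x).trans
      (h2.trans (AlgEquiv.restrictNormal_commutes (h ^ (j : ℕ)) K x).symm)
  have : FiniteDimensional B (extendScalars hBA) := by
    have : FiniteDimensional k (extendScalars hBA) := ‹FiniteDimensional k A›
    exact FiniteDimensional.right k B _
  have hfin : Finite (extendScalars hBA →ₐ[B] E) := inferInstance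
  calc _ = Nat.card (Fin (orderOf (AlgEquiv.restrictNormalHom K h : Gal(K/k)))) := by simp
    _ ≤ Nat.card (extendScalars hBA →ₐ[B] E) := Nat.card_le_card_of_injective f hf
    _ ≤ _ :=
      have : Module.Free B (extendScalars hBA) := Module.Free.of_divisionRing B _
      card_algHom_le_finrank _ _ _

/-- The power p^m is at most [K K_i : E_i(n-m)]. An inequality suffices, since a congruence modulo a
higher power of p implies one modulo p^m; it is also compatible with `Nat.log` rounding down. -/
theorem le_factorExp_sub [FiniteDimensional k Ki] (hp : p.Prime) (hn : Module.finrank k K = p ^ n)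
    (hmn : m ≤ n) (hKi : h ∈ Ki.fixingSubgroup)
    (hm : orderOf (AlgEquiv.restrictNormalHom K h : Gal(K/k)) = p ^ m) :
    m ≤ factorExp p K Ki n - factorExp p K Ki (n - m) := by
  have hA : factorField p K Ki n = K ⊔ Ki := factorField_finrank K Ki hn
  have hBA : factorField p K Ki (n - m) ≤ K ⊔ Ki :=
    sup_le ((sSup_le fun _ hM => hM.1).trans le_sup_left) le_sup_right
  have h1 := orderOf_le_relfinrank hBA le_sup_left (mem_fixingSubgroup_factorField Ki hp hn hmn hKi hm)
  rw [hm] at h1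
  have h2 := relfinrank_mul_relfinrank (show Ki ≤ factorField p K Ki (n - m) from le_sup_right) hBA
  rw [factorExp, factorExp, hA, ← h2]
  have hx : relfinrank Ki (factorField p K Ki (n - m)) ≠ 0 := by
    intro h0
    rw [h0, zero_mul] at h2
    have h3 := relfinrank_dvd_finrank_bot (A := Ki) (B := K ⊔ Ki)
    rw [← h2, zero_dvd_iff] at h3
    exact Module.finrank_pos.ne' h3
  refine Nat.le_sub_of_add_le (Nat.le_log_of_pow_le hp.one_lt ?_)
  rw [pow_add, mul_comm]
  exact Nat.mul_le_mul (Nat.pow_log_le_self p hx) h1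

end Galois

/-! ### The degree of `K K_i` over `K_i` -/

section Compositum

open IntermediateField

/-- Restriction embeds Gal(KL/L) in Gal(K/k). For K of degree p^n this makes [KL : L] a power of p,
so that the logarithm defining e_i(n) is exact. -/
theorem relfinrank_sup_dvd {k E : Type*} [Field k] [Field E] [Algebra k E] (K L : IntermediateField k E)
    [FiniteDimensional k K] [IsGalois k K] [FiniteDimensional k L] :
    relfinrank L (K ⊔ L) ∣ Module.finrank k K := by
  let K' : IntermediateField k ↥(K ⊔ L) := restrict (le_sup_left : K ≤ K ⊔ L)
  let L' : IntermediateField k ↥(K ⊔ L) := restrict (le_sup_right : L ≤ K ⊔ L)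
  have htop : K' ⊔ L' = ⊤ := by
    apply lift_injective
    change IntermediateField.map _ _ = IntermediateField.map _ _
    rw [IntermediateField.map_sup]
    change lift K' ⊔ lift L' = lift ⊤
    rw [lift_restrict, lift_restrict, lift_top]
  let eK : K ≃ₐ[k] K' := restrictAlgEquiv le_sup_left
  let eL : L ≃ₐ[k] L' := restrictAlgEquiv le_sup_right
  have : IsGalois k K' := IsGalois.of_algEquiv eK
  have : FiniteDimensional k K' := eK.toLinearEquiv.finiteDimensional
  have : IsGalois L' ↥(K ⊔ L) := IsGalois.sup_right K' L' htop
  have h1 : Module.finrank L' ↥(K ⊔ L) ∣ Module.finrank k K := by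
    rw [eK.toLinearEquiv.finrank_eq, ← IsGalois.card_aut_eq_finrank, ← IsGalois.card_aut_eq_finrank]
    exact Subgroup.card_dvd_of_injective _ (restrictRestrictAlgEquivMapHom_injective K' L' htop)
  have h2 := Module.finrank_mul_finrank k L' ↥(K ⊔ L)
  have h3 := relfinrank_mul_relfinrank (bot_le : ⊥ ≤ L) (le_sup_right : L ≤ K ⊔ L)
  rw [relfinrank_bot_left, relfinrank_bot_left, ← h2, ← eL.toLinearEquiv.finrank_eq] at h3
  rwa [Nat.eq_of_mul_eq_mul_left Module.finrank_pos h3]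

variable {k E F : Type u} [Field k] [Field E] [Algebra k E] [Field F] [Algebra k F]
  {K : IntermediateField k E} [FiniteDimensional k K] [IsGalois k K] (Ki : IntermediateField k E)
  [FiniteDimensional k Ki] {p n : ℕ}

theorem pow_factorExp (hp : p.Prime) (hn : Module.finrank k K = p ^ n) :
    p ^ factorExp p K Ki n = relfinrank Ki (K ⊔ Ki) := by
  have h := relfinrank_sup_dvd K Ki
  rw [hn, Nat.dvd_prime_pow hp] at h
  obtain ⟨j, -, hj⟩ := h
  rw [factorExp, factorField_finrank K Ki hn, hj, Nat.log_pow hp.one_lt]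

/-- This is what makes c(i) (N_i, χ) independent of the integer representing c(i). -/
theorem pow_factorExp_nsmul [NeZero (p ^ n)] (hp : p.Prime)
    (χ : Gal(K/k) ≃* Multiplicative (ZMod (p ^ n))) (y : F ⊗[k] Ki) (b : Fˣ)
    (hb : (b : F) = Algebra.norm F y) :
    p ^ factorExp p K Ki n • cyclicHom χ (Additive.ofMul b) = 0 := by
  have hn : Module.finrank k K = p ^ n := by
    rw [← IsGalois.card_aut_eq_finrank, Nat.card_congr χ.toEquiv,
      Nat.card_congr Multiplicative.toAdd, Nat.card_zmod]
  rw [pow_factorExp Ki hp hn, relfinrank_eq_finrank_of_le le_sup_right]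
  let N : IntermediateField Ki E := extendScalars (le_sup_right : Ki ≤ K ⊔ Ki)
  let : Algebra K N := (inclusion (le_sup_left : K ≤ K ⊔ Ki)).toRingHom.toAlgebra
  have : IsScalarTower k K N := IsScalarTower.of_algebraMap_eq fun x => rfl
  have : FiniteDimensional k N := inferInstanceAs (FiniteDimensional k ↥(K ⊔ Ki))
  have : FiniteDimensional Ki N := FiniteDimensional.right k Ki N
  have : FiniteDimensional K N := FiniteDimensional.right k K N
  exact finrank_nsmul_cyclicClass_norm χ Ki N y b hb

end Compositum

/-! ### From the conditions defining `C(L)` to divisibility by p^f -/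

section Congruence

variable {k E : Type*} [Field k] [Field E] [Algebra k E] [IsGalois k E]
  {K : IntermediateField k E} [FiniteDimensional k K] [IsGalois k K] [IsCyclic Gal(K/k)]

/-- The condition that some power of `g` with restriction to `K` of order `d` fixes an embedding of `Ki`. -/
def FixesEmbedding (K : IntermediateField k E) [Normal k K] (Ki : IntermediateField k E)
    (g : Gal(E/k)) (d : ℕ) : Prop :=
  ∃ (τ : Ki →ₐ[k] E) (r : ℕ), ((g ^ r : Gal(E/k)) : E →ₐ[k] E).comp τ = τ ∧
    orderOf (AlgEquiv.restrictNormalHom K (g ^ r) : Gal(K/k)) = d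

variable {Ki : IntermediateField k E} {g : Gal(E/k)} {p n m : ℕ}

theorem FixesEmbedding.of_le (hp : p.Prime) {m' : ℕ} (h : FixesEmbedding K Ki g (p ^ m)) (hm : m' ≤ m) :
    FixesEmbedding K Ki g (p ^ m') := by
  obtain ⟨τ, r, hr, ho⟩ := h
  have hpow : ∀ j : ℕ, ((g ^ (r * j) : Gal(E/k)) : E →ₐ[k] E).comp τ = τ := fun j => by
    induction j with
    | zero => exact AlgHom.ext fun x => rfl
    | succ j ih =>
      rw [mul_add_one, pow_add]
      change ((g ^ (r * j) : Gal(E/k)) : E →ₐ[k] E).comp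
        (((g ^ r : Gal(E/k)) : E →ₐ[k] E).comp τ) = τ
      rw [hr, ih]
  refine ⟨τ, r * p ^ (m - m'), hpow _, ?_⟩
  have hdvd : p ^ (m - m') ∣ p ^ m := pow_dvd_pow p (Nat.sub_le _ _)
  rw [pow_mul, map_pow, orderOf_pow_of_dvd (pow_pos hp.pos _).ne' (ho ▸ hdvd), ho,
    Nat.pow_div (Nat.sub_le _ _) hp.pos, Nat.sub_sub_self hm]

/-- Extend τ to an automorphism σ of E and conjugate g by it: the embedding becomes the inclusion of
K_i. Restrictions to K are unchanged because Gal(K/k) is abelian. This is why conjugacy classes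
occur in Γ_i^m. -/
theorem FixesEmbedding.exists_conj {d : ℕ} (h : FixesEmbedding K Ki g d) :
    ∃ g' h' : Gal(E/k), ConjClasses.mk g' = ConjClasses.mk g ∧ h' ∈ Subgroup.zpowers g' ∧
      h' ∈ Ki.fixingSubgroup ∧ orderOf (AlgEquiv.restrictNormalHom K h' : Gal(K/k)) = d := by
  obtain ⟨τ, r, hr, rfl⟩ := h
  let σ : Gal(E/k) := AlgEquiv.ofBijective (τ.liftNormal E) (AlgHom.normal_bijective k E E _)
  have hσ : ∀ x : Ki, σ x = τ x := fun x => τ.liftNormal_commutes E x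
  refine ⟨σ⁻¹ * g * σ, (σ⁻¹ * g * σ) ^ r, ?_, ⟨r, by simp⟩, ?_, ?_⟩
  · rw [ConjClasses.mk_eq_mk_iff_isConj, isConj_iff]
    exact ⟨σ, by group⟩
  · rw [IntermediateField.mem_fixingSubgroup_iff]
    intro x hx
    have h1 := DFunLike.congr_fun hr ⟨x, hx⟩
    have h2 : (σ⁻¹ * g * σ) ^ r = σ⁻¹ * g ^ r * σ := by
      simpa using (conj_pow (i := r) (a := σ⁻¹) (b := g))
    rw [h2]
    change σ.symm ((g ^ r) (σ x)) = x
    rw [AlgEquiv.symm_apply_eq]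
    rw [hσ ⟨x, hx⟩]
    exact h1
  · have : (AlgEquiv.restrictNormalHom K (σ⁻¹ * g * σ) : Gal(K/k)) =
        AlgEquiv.restrictNormalHom K g := by
      rw [map_mul, map_mul, map_inv]
      have hcomm : ∀ x y : Gal(K/k), x * y = y * x := fun x y => by
        let := IsCyclic.commGroup (α := Gal(K/k))
        exact mul_comm x y
      rw [hcomm, mul_inv_cancel_left]
    rw [map_pow, this, map_pow]

theorem FixesEmbedding.mem_gammaSet (h : FixesEmbedding K Ki g (p ^ m)) (hp : p.Prime)
    (hn : Module.finrank k K = p ^ n) (hmn : m ≤ n) (hm : 1 ≤ m) :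
    ConjClasses.mk g ∈ gammaSet p n K Ki m := by
  obtain ⟨g', h', hg', hh', hKi, ho⟩ := h.exists_conj
  exact ⟨g', ⟨h', hh', mem_fixingSubgroup_factorField Ki hp hn hmn hKi ho,
    notMem_fixingSubgroup_factorField Ki hp hn hmn hm ho⟩, hg'⟩

theorem FixesEmbedding.le_factorExp_sub [FiniteDimensional k Ki] (h : FixesEmbedding K Ki g (p ^ m))
    (hp : p.Prime) (hn : Module.finrank k K = p ^ n) (hmn : m ≤ n) :
    m ≤ factorExp p K Ki n - factorExp p K Ki (n - m) := by
  obtain ⟨g', h', hg', hh', hKi, ho⟩ := h.exists_conj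
  exact BrauerNorm.le_factorExp_sub Ki hp hn hmn hKi ho

/-- The arithmetic core: ∑ z_i V_i = ∑ (z_i - z_j) V_i + z_j ∑ V_i. In the first sum p^{m_i} divides
z_i - z_j and p^{f - m_i} divides V_i. -/
theorem dvd_sum_of_mem_combGroup (hp : p.Prime) (hn : Module.finrank k K = p ^ n) {I : Type*}
    [Fintype I] (Ki : I → IntermediateField k E) [∀ i, FiniteDimensional k (Ki i)] (g : Gal(E/k))
    (V : I → ℤ)
    (hV : ∀ i (d : ℕ), (∀ (τ : Ki i →ₐ[k] E) (r : ℕ),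
      ((g ^ r : Gal(E/k)) : E →ₐ[k] E).comp τ = τ → d ∣ r) → (d : ℤ) ∣ V i)
    (hsum : (orderOf (AlgEquiv.restrictNormalHom K g : Gal(K/k)) : ℤ) ∣ ∑ i, V i)
    (c : combGroup p n K Ki) (z : I → ℤ) (hz : ∀ i, (z i : ZMod _) = c.1 i) :
    (orderOf (AlgEquiv.restrictNormalHom K g : Gal(K/k)) : ℤ) ∣ ∑ i, z i * V i := by
  classical
  obtain ⟨f, hfn, hf⟩ : ∃ f ≤ n, orderOf (AlgEquiv.restrictNormalHom K g : Gal(K/k)) = p ^ f := by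
    rw [← Nat.dvd_prime_pow hp, ← hn, ← IsGalois.card_aut_eq_finrank]
    exact orderOf_dvd_natCard _
  rw [hf] at hsum ⊢
  rcases isEmpty_or_nonempty I with hI | hI
  · simp
  have hex : ∀ i, ∃ m ≤ f, FixesEmbedding K (Ki i) g (p ^ m) ∧
      ∀ m' ≤ f, FixesEmbedding K (Ki i) g (p ^ m') → m' ≤ m := fun i => by
    let P : ℕ → Prop := fun m => FixesEmbedding K (Ki i) g (p ^ m)
    have h0 : P 0 := by
      refine ⟨(Ki i).val, 0, AlgHom.ext fun x => rfl, ?_⟩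
      rw [pow_zero, map_one, orderOf_one, pow_zero]
    exact ⟨Nat.findGreatest P f, Nat.findGreatest_le f, Nat.findGreatest_spec (Nat.zero_le f) h0,
      fun m' hm' h => Nat.le_findGreatest hm' h⟩
  choose m hmf hm hmax using hex
  have hdvd : ∀ i, ((p ^ (f - m i) : ℕ) : ℤ) ∣ V i := fun i => by
    refine hV i _ fun τ r hr => ?_
    -- If g^r fixes an embedding and gcd(p^f, r) = p^s, then g^r has order p^{f-s} on K. Maximality
    -- gives f - s ≤ m_i, so p^{f - m_i} divides r.
    have h1 := orderOf_pow (n := r) (AlgEquiv.restrictNormalHom K g : Gal(K/k))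
    rw [← map_pow, hf] at h1
    obtain ⟨s, hs, hgcd⟩ := (Nat.dvd_prime_pow hp).mp (Nat.gcd_dvd_left (p ^ f) r)
    rw [hgcd, Nat.pow_div hs hp.pos] at h1
    have h2 := hmax i (f - s) (Nat.sub_le _ _) ⟨τ, r, hr, h1⟩
    refine (pow_dvd_pow p ?_).trans (hgcd ▸ Nat.gcd_dvd_right (p ^ f) r)
    omega
  -- With m_j maximal, the class of g lies in Γ_j^{m_i} for every i with m_i ≥ 1.
  obtain ⟨j, hj⟩ := Finite.exists_max m
  have hcong : ∀ i, ((p ^ m i : ℕ) : ℤ) ∣ z i - z j := fun i => by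
    rcases Nat.eq_zero_or_pos (m i) with h0 | h0
    · rw [h0]
      simp
    · have hj' := (hm j).of_le hp (hj i)
      have hin : m i ≤ n := (hmf i).trans hfn
      obtain ⟨y, hy⟩ := c.2 (m i) h0 hin i j
        ⟨_, (hm i).mem_gammaSet hp hn hin h0, hj'.mem_gammaSet hp hn hin h0⟩
      have key : ∀ l, l = i ∨ l = j → FixesEmbedding K (Ki l) g (p ^ m i) →
          ((p ^ m i : ℕ) : ℤ) ∣ z l - y := fun l hl hfix => by
        have h1 := hy l hl
        rw [← hz, map_intCast, ← sub_eq_zero, ← Int.cast_sub, ZMod.intCast_zmod_eq_zero_iff_dvd] at h1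
        exact (Int.natCast_dvd_natCast.mpr
          (pow_dvd_pow p (hfix.le_factorExp_sub hp hn hin))).trans h1
      have := dvd_sub (key i (Or.inl rfl) (hm i)) (key j (Or.inr rfl) hj')
      rwa [sub_sub_sub_cancel_right] at this
  have hsplit : ∑ i, z i * V i = ∑ i, (z i - z j) * V i + z j * ∑ i, V i := by
    rw [Finset.mul_sum, ← Finset.sum_add_distrib]
    exact Finset.sum_congr rfl fun i _ => by ring
  rw [hsplit]
  refine dvd_add (Finset.dvd_sum fun i _ => ?_) (Dvd.dvd.mul_left hsum _)
  have := mul_dvd_mul (hcong i) (hdvd i)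
  rwa [← Nat.cast_mul, ← pow_add, Nat.add_sub_cancel' (hmf i)] at this

end Congruence

/-! ### Unramified sums and the homomorphism `u` -/

section Main

open IntermediateField

theorem card_algHom_of_normal {k M E : Type*} [Field k] [Field M] [Field E] [Algebra k M] [Algebra k E]
    [FiniteDimensional k M] [IsGalois k E] (f : M →ₐ[k] E) :
    Fintype.card (M →ₐ[k] E) = Module.finrank k M := by
  have : Algebra.IsSeparable k M := Algebra.IsSeparable.of_algHom k E f
  refine AlgHom.card_of_splits k M E fun x => ?_
  rw [← minpoly.algHom_eq f f.injective]
  exact Normal.splits inferInstance _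

theorem coe_cyclicHom {k K F : Type u} [Field k] [Field K] [Field F] [Algebra k K] [Algebra k F]
    [FiniteDimensional k K] [IsGalois k K] {d : ℕ} [NeZero d]
    (χ : Gal(K/k) ≃* Multiplicative (ZMod d)) (b : Fˣ) :
    cyclicClass χ b = cyclicHom χ (Additive.ofMul b) := rfl

variable {k E F : Type u} [Field k] [Field E] [Algebra k E] [IsGalois k E] {p n : ℕ} [Fact p.Prime]
  {K : IntermediateField k E} [FiniteDimensional k K] [IsGalois k K]
  (χ : Gal(K/k) ≃* Multiplicative (ZMod (p ^ n)))
  {I : Type*} [Fintype I] {Ki : I → IntermediateField k E} [∀ i, FiniteDimensional k (Ki i)]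
  [Field F] [Algebra k F]

include χ in
theorem finrank_of_equiv : Module.finrank k K = p ^ n := by
  rw [← IsGalois.card_aut_eq_finrank, Nat.card_congr χ.toEquiv,
    Nat.card_congr Multiplicative.toAdd, Nat.card_zmod]

/-- The classes `∑ c(i) (N_i, χ)` are unramified if the norm `N_K ∏ N_i` lies in the base field. -/
theorem isUnramifiedAt_sum (t : (F ⊗[k] (K × ∀ i, Ki i))ˣ) (a : kˣ)
    (ht : Algebra.norm F (t : F ⊗[k] (K × ∀ i, Ki i)) = algebraMap k F a)
    (R : ValuationSubring F) [IsDiscreteValuationRing R] (hk : ∀ x : k, algebraMap k F x ∈ R)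
    (c : combGroup p n K Ki) (z : I → ℤ) (hz : ∀ i, (z i : ZMod _) = c.1 i) :
    IsUnramifiedAt R (∑ i, z i • cyclicClass χ (normUnits F
      (embUnit F ((Pi.evalAlgHom k (fun i => Ki i) i).comp (AlgHom.snd k K (∀ i, Ki i))) t))) := by
  classical
  have : IsCyclic Gal(K/k) := isCyclic_of_surjective χ.symm χ.symm.surjective
  let : Algebra k R := ((algebraMap k F).codRestrict R.toSubring hk).toAlgebra
  have : IsScalarTower k R F := IsScalarTower.of_algebraMap_eq fun x => rfl
  -- E may be infinite over k, whereas the prime and its order function need a finite Galois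
  -- extension; E' is a finite one containing K and all K_i.
  let M : IntermediateField k E := K ⊔ ⨆ i, Ki i
  let E' : IntermediateField k E := normalClosure k M E
  have hM : M ≤ E' := le_normalClosure M
  have hKE : K ≤ E' := le_sup_left.trans hM
  have hKiE : ∀ i, Ki i ≤ E' := fun i => ((le_iSup Ki i).trans le_sup_right).trans hM
  let : Algebra K E' := (inclusion hKE).toRingHom.toAlgebra
  have : IsScalarTower k K E' := IsScalarTower.of_algebraMap_eq fun x => rfl
  obtain ⟨g, w, hw1, hw2, x, hx⟩ := exists_invariant_order_hom k R F E' K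
  -- The sets Γ_i^m are formed in Gal(E/k), so g is lifted to E.
  obtain ⟨g', rfl⟩ : ∃ g' : Gal(E/k), AlgEquiv.restrictNormalHom E' g' = g :=
    AlgEquiv.restrictNormalHom_surjective E g
  have hg' : ∀ (r : ℕ) (y : E'),
      ((((AlgEquiv.restrictNormalHom E' g') ^ r : Gal(E'/k)) y : E') : E) = (g' ^ r) y :=
    fun r y => by
      rw [← map_pow]
      exact AlgEquiv.restrictNormal_commutes (g' ^ r) E' y
  have hres : (AlgEquiv.restrictNormalHom K (AlgEquiv.restrictNormalHom E' g') : Gal(K/k)) =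
      AlgEquiv.restrictNormalHom K g' := by
    refine AlgEquiv.ext fun y => Subtype.ext ?_
    have h1 := AlgEquiv.restrictNormal_commutes (AlgEquiv.restrictNormalHom E' g') K y
    have h2 := AlgEquiv.restrictNormal_commutes g' K y
    have h3 := hg' 1 (inclusion hKE y)
    rw [pow_one, pow_one] at h3
    exact ((congrArg Subtype.val h1).trans h3).trans h2.symm
  rw [hres] at hx
  have hdvd : ∀ (L : IntermediateField k E) [FiniteDimensional k L] (hL : L ≤ E') (d : ℕ),
      (∀ (τ : L →ₐ[k] E) (r : ℕ), ((g' ^ r : Gal(E/k)) : E →ₐ[k] E).comp τ = τ → d ∣ r) →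
      ∀ y : (F ⊗[k] L)ˣ, (d : ℤ) ∣
        Multiplicative.toAdd (w (baseUnit k E' (normUnits F y))) := by
    intro L _ hL d hd y
    refine dvd_order_norm (card_algHom_of_normal (inclusion hL)) _ w hw2 d (fun τ r hr => ?_) y
    refine hd (E'.val.comp τ) r (AlgHom.ext fun x => ?_)
    exact (hg' r (τ x)).symm.trans (congrArg Subtype.val (DFunLike.congr_fun hr x))
  let N : I → Fˣ := fun i => normUnits F
    (embUnit F ((Pi.evalAlgHom k (fun i => Ki i) i).comp (AlgHom.snd k K (∀ i, Ki i))) t)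
  let v : Fˣ → ℤ := fun b => Multiplicative.toAdd (w (baseUnit k E' b))
  have hsum : (orderOf (AlgEquiv.restrictNormalHom K g' : Gal(K/k)) : ℤ) ∣ ∑ i, v (N i) := by
    have h1 := congrArg (fun b => Multiplicative.toAdd (w b)) (map_norm_prod
      (card_algHom_of_normal (inclusion hKE)) (fun i => card_algHom_of_normal (inclusion (hKiE i))) t)
    have h2 : w (baseUnit k E' (normUnits F t)) = 1 :=
      (hw1 _).mpr ⟨Units.map (algebraMap k R).toMonoidHom a, ht.symm⟩
    simp only [h2, toAdd_one, map_mul, map_prod, toAdd_mul, toAdd_prod] at h1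
    -- Since a has order 0, ∑ V_i is minus the order of the norm from K.
    rw [← dvd_neg, ← eq_neg_of_add_eq_zero_left h1.symm]
    refine hdvd K hKE _ (fun τ r hr => ?_) _
    rw [orderOf_dvd_iff_pow_eq_one, ← map_pow]
    refine AlgEquiv.ext fun y => Subtype.ext ?_
    -- As K is normal, every embedding has image K, so a power of g' fixing one embedding is trivial
    -- on K.
    obtain ⟨y', hy'⟩ : (y : E) ∈ τ.fieldRange := by
      rw [AlgHom.fieldRange_of_normal]
      exact y.2
    have h3 : (g' ^ r) (y : E) = y := hy' ▸ DFunLike.congr_fun hr y'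
    exact (AlgEquiv.restrictNormal_commutes (g' ^ r) K y).trans h3
  obtain ⟨j, hj⟩ := dvd_sum_of_mem_combGroup Fact.out (finrank_of_equiv χ) Ki g' (fun i => v (N i))
    (fun i d hd => hdvd (Ki i) (hKiE i) d hd _) hsum c z hz
  -- Here j is the quotient of ∑ z_i V_i by p^f. Dividing by the j-th power of the norm of order p^f
  -- leaves a unit of R and does not change the class.
  let b : Fˣ := (∏ i, N i ^ z i) * (normUnits F x) ^ (-j)
  obtain ⟨r, hr⟩ : ∃ r : Rˣ, algebraMap R F r = b := by
    refine (hw1 b).mp (Multiplicative.toAdd.injective ?_)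
    change Multiplicative.toAdd (w (baseUnit k E' b)) = _
    have hx' : Multiplicative.toAdd (w (baseUnit k E' (normUnits F x))) = _ :=
      congrArg Multiplicative.toAdd hx
    simp only [b, map_mul, map_prod, map_zpow, toAdd_mul, toAdd_prod, toAdd_zpow, hx', toAdd_one,
      smul_eq_mul, toAdd_ofAdd]
    refine (congrArg (· + _) hj).trans ?_
    ring
  have hcls : ∑ i, z i • cyclicClass χ (N i) = cyclicClass χ b := by
    have h0 : cyclicHom χ (Additive.ofMul (normUnits F x)) = 0 :=
      cyclicClass_norm χ _ (x : F ⊗[k] K) rfl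
    simp only [coe_cyclicHom, b, ofMul_mul, ofMul_prod, ofMul_zpow, map_add, map_sum, map_zsmul, h0,
      smul_zero, add_zero]
  change IsUnramifiedAt R (∑ i, z i • cyclicClass χ (N i))
  rw [hcls]
  refine isUnramifiedAt_cyclicClass χ b R hk (hr ▸ (r : R).2) ?_
  have : ((b⁻¹ : Fˣ) : F) = ((r⁻¹ : Rˣ) : R) := by
    rw [Units.val_inv_eq_inv_val, ← hr]
    exact (map_units_inv (algebraMap R F) r).symm
  rw [this]
  exact ((r⁻¹ : Rˣ) : R).2

theorem normUnit_eq {L ι : Type*} [CommRing L] [Algebra k L] [Fintype ι] (β : Module.Basis ι k L)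
    (a : k) (ha : a ≠ 0) [Algebra (NormCoordRing β a) F] [IsScalarTower k (NormCoordRing β a) F]
    {M : Type*} [CommRing M] [Algebra k M] (π : L →ₐ[k] M) :
    normUnit β a ha π = normUnits F
      (embUnit F π (isUnit_genericPoint (F := F) (β := β) ha).unit) := Units.ext rfl

end Main

end BrauerNorm

theorem mainTheorem9 {k E F : Type u} [Field k] [Field E] [Algebra k E] [IsGalois k E]
    (p n : ℕ) [Fact p.Prime] (hchar : ringChar k ≠ p)
    (K : IntermediateField k E) [FiniteDimensional k K] [IsGalois k K]
    (χ : Gal(K/k) ≃* Multiplicative (ZMod (p ^ n)))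
    {I : Type*} [Fintype I] (Ki : I → IntermediateField k E) [∀ i, FiniteDimensional k (Ki i)]
    {ι : Type*} [Fintype ι] (β : Module.Basis ι k (K × ∀ i, Ki i))
    (a : k) (ha : a ≠ 0)
    [Field F] [Algebra k F] [Algebra (BrauerNorm.NormCoordRing β a) F]
    [IsScalarTower k (BrauerNorm.NormCoordRing β a) F] [IsFractionRing (BrauerNorm.NormCoordRing β a) F] :
    ∃ u : BrauerNorm.combGroup p n K Ki →+ BrauerGroup.{u, u} F,
      (∀ (c : BrauerNorm.combGroup p n K Ki) (z : I → ℤ), (∀ i, (z i : ZMod _) = c.1 i) →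
        u c = ∑ i, z i • BrauerNorm.cyclicClass χ (BrauerNorm.normUnit β a ha
          ((Pi.evalAlgHom k (fun i => Ki i) i).comp (AlgHom.snd k K (∀ i, Ki i))))) ∧
      ∀ c, BrauerNorm.IsUnramifiedOver k (u c) := by
  classical
  have hn : Module.finrank k K = p ^ n := BrauerNorm.finrank_of_equiv χ
  let π : ∀ i, (K × ∀ i, Ki i) →ₐ[k] Ki i := fun i =>
    (Pi.evalAlgHom k (fun i => Ki i) i).comp (AlgHom.snd k K (∀ i, Ki i))
  let N : I → Fˣ := fun i => BrauerNorm.normUnit β a ha (π i)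
  -- Each term is defined on all of ℤ/p^{e_i(n)}; the conditions of C(L) play no role in defining
  -- `u`, only in its being unramified.
  let f : ∀ i, ZMod (p ^ BrauerNorm.factorExp p K (Ki i) n) →+ BrauerGroup.{u, u} F := fun i =>
    ZMod.lift _ ⟨zmultiplesHom _ (BrauerNorm.cyclicClass χ (N i)), by
      rw [zmultiplesHom_apply, natCast_zsmul]
      exact BrauerNorm.pow_factorExp_nsmul (Ki i) Fact.out χ _ (N i) rfl⟩
  let u : BrauerNorm.combGroup p n K Ki →+ BrauerGroup.{u, u} F :=
    (∑ i, (f i).comp (Pi.evalAddMonoidHom _ i)).comp (BrauerNorm.combGroup p n K Ki).subtype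
  have hu : ∀ (c : BrauerNorm.combGroup p n K Ki) (z : I → ℤ), (∀ i, (z i : ZMod _) = c.1 i) →
      u c = ∑ i, z i • BrauerNorm.cyclicClass χ (N i) := fun c z hz => by
    change (∑ i, (f i).comp (Pi.evalAddMonoidHom _ i)) c.1 = _
    rw [AddMonoidHom.finsetSum_apply]
    refine Finset.sum_congr rfl fun i _ => ?_
    change f i (c.1 i) = _
    rw [← hz i]
    exact ZMod.lift_coe _ _ _
  refine ⟨u, hu, fun c R _ hk => ?_⟩
  choose z hz using fun i => ZMod.intCast_surjective (c.1 i)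
  rw [hu c z hz]
  simp only [N, BrauerNorm.normUnit_eq]
  exact BrauerNorm.isUnramifiedAt_sum χ _ (Units.mk0 a ha)
    (BrauerNorm.norm_genericPoint (F := F) β a) R hk c z hz
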